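/- **Setting.** Write $\langle f,g\rangle_{L^2}=\int_{\mathbb R} f\overline g\,dx$, $\hat f(\xi)=\int_{\mathbb R}f(x)e^{-ix\xi}dx$, and let $\Pi$ be the Szegő projector, $\widehat{\Pi f}=\mathbf 1_{[0,\infty)}\hat f$, with range the Hardy space $L^2_+=\{f\in L^2(\mathbb R):\hat f=0\text{ on }(-\infty,0)\}$. An $f\in L^2_+$ is identified with the holomorphic function $f(z)=\frac1{2\pi}\int_0^\infty e^{iz\xi}\hat f(\xi)\,d\xi$ on $\mathbb C_+=\{\operatorname{Im}z>0\}$, which is in the Hardy space $H^2(\mathbb C_+)$ and has boundary value $f$. For $N\ge 1$ let $\mathcal U_N$ be the set of $N$-solitons $u(x)=\sum_{j=1}^N c_j\mathcal R(c_j(x-x_j))$, where $\mathcal R(x)=\frac{2}{1+x^2}$, $c_j>0$, $x_j\in\mathbb R$. For $u\in \mathcal U_N$: * $L_u=-i\partial_x-\Pi(u\,\cdot)$ is the Lax operator on $L^2_+$ with domain $H^1_+=H^1(\mathbb R)\cap L^2_+$, and $\mathscr H_{\rm pp}(L_u)$ is the closed span of its eigenvectors; * $S(\eta)^*f=\Pi(e^{-i\eta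 x}f)$, $\eta\ge0$, and $Gf=i\frac{d}{d\eta}\big|_{\eta=0^+}S(\eta)^*f$ (so $-iG$ is the generator of the semigroup), on the domain $\mathbf D(G)$ where this derivative exists in $L^2_+$. For $z\in\mathbb C$, $(G-z)^{-1}f$ is the element $g\in\mathbf D(G)$ with $(G-z)g=f$, when it exists and is unique; * $Q_u$ is the unique monic polynomial of degree $N$ with all roots in $\{\operatorname{Im}z<0\}$ and $\Pi u=iQ_u'/Q_u$ on $\mathbb R$; $\Theta_u=\overline{Q_u}/Q_u$, where $\overline{Q_u}$ has the conjugate coefficients; * $\lambda_1^u<\dots<\lambda_N^u<0$ are the eigenvalues of $L_u$, and $\varphi_j^u$ are the eigenfunctions with $\operatorname{Ker}(\lambda^u_j-L_u)=\mathbb C\varphi_j^u$, $\|\varphi_j^u\|_{L^2}=1$, $\int u\varphi_j^u=\sqrt{2\pi|\lambda_j^u|}$; * $I_j(u)=2\pi\lambda_j^u$, $\gamma_j(u)=\operatorname{Re}\langle G\varphi_j^u,\varphi_j^u\rangle_{L^2}$, $M_{kj}(u)=\langle G\varphi_j^u,\varphi_k^u\rangle_{L^2}$, $X(u)=(\sqrt{|\lambda_j^u|})_j$,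 $Y(u)=(1/\sqrt{|\lambda_j^u|})_j$, $\mathfrak V(u)=\operatorname{diag}(I_1(u),\dots,I_N(u))$, and $\langle A,B\rangle_{\mathbb C^N}=A^T\overline B$. **Statement.** Let $N\ge1$. 1. For every $u\in\mathcal U_N$ the objects above are well defined: $Q_u$ and $(\lambda_j^u,\varphi_j^u)_{1\le j\le N}$ exist and are unique (the $\lambda_j^u$ being all the eigenvalues of $L_u$), $1-\Theta_u\in L^2(\mathbb R)$, $\mathscr H_{\rm pp}(L_u)\subset\mathbf D(G)$, $G(\mathscr H_{\rm pp}(L_u))\subset\mathscr H_{\rm pp}(L_u)$. For every $f\in\mathscr H_{\rm pp}(L_u)$ and $z\in\mathbb C_+$, $(G-z)^{-1}f$ is well defined, lies in $\mathscr H_{\rm pp}(L_u)$, and $$f(z)=\frac1{2\pi i}\big\langle (G-z)^{-1}f,\,1-\Theta_u\big\rangle_{L^2}.$$ 2. For every $u\in\mathcal U_N$, $$M_{kj}(u)=\frac{i}{\lambda_k^u-\lambda_j^u}\sqrt{\frac{|\lambda_k^u|}{|\lambda_j^u|}}\quad (j\ne k),\qquad M_{jj}(u)=\gamma_j(u)-\frac{i}{2|\lambda_j^u|},$$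 and for every $x\in\mathbb R$ the matrix $M(u)-x$ is invertible, $(G-x)^{-1}\Pi u$ is well defined and lies in $\mathscr H_{\rm pp}(L_u)$, and (for the continuous representative of $\Pi u$) $$\Pi u(x)=\frac1{2\pi i}\big\langle (G-x)^{-1}\Pi u,\,1-\Theta_u\big\rangle_{L^2}=-i\big\langle (M(u)-x)^{-1}X(u),Y(u)\big\rangle_{\mathbb C^N}.$$ 3. The map $\Phi_N:u\mapsto (I_1(u),\dots,I_N(u);\gamma_1(u),\dots,\gamma_N(u))$ is an injective map from $\mathcal U_N$ to $\Omega_N\times\mathbb R^N$, $\Omega_N=\{r\in\mathbb R^N: r^1<\dots<r^N<0\}$. 4. If $u:\mathbb R\to\mathcal U_N$ solves the Benjamin–Ono equation $\partial_tu=\mathrm H\partial_x^2u-\partial_x(u^2)$, where $\widehat{\mathrm Hf}(\xi)=-i\,\mathrm{sign}(\xi)\hat f(\xi)$ (the time derivative being taken in $L^2(\mathbb R)$), and $u_0=u(0)$, then for all $t,x\in\mathbb R$ the matrix $M(u_0)-(x+\frac t\pi\mathfrak V(u_0))$ is invertible and $$u(t,x)=2\operatorname{Im}\Big\langle \big(M(u_0)-(x+\tfrac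 t\pi\mathfrak V(u_0))\big)^{-1}X(u_0),Y(u_0)\Big\rangle_{\mathbb C^N}.$$ -/

import Mathlib

open MeasureTheory Filter Topology FourierTransform Polynomial

noncomputable section

namespace BenjaminOno

/-- The Hilbert space `L²(ℝ) = L²(ℝ, ℂ)`. -/
abbrev L2 : Type := Lp ℂ 2 (volume : Measure ℝ)

open scoped Classical in
/-- The class in `L²(ℝ)` of a square-integrable function (and `0` if the function is not
square-integrable). -/
def toL2 (f : ℝ → ℂ) : L2 := if h : MemLp f 2 volume then h.toLp f else 0

/-- The pairing `⟨f, g⟩ = ∫ f(x) conj(g(x)) dx`, linear in the first variable. -/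
def pairing (f g : ℝ → ℂ) : ℂ := ∫ x, f x * (starRingEnd ℂ) (g x)

theorem toL2_of_memLp {f : ℝ → ℂ} (h : MemLp f 2 volume) : toL2 f = h.toLp f := dif_pos h

theorem coeFn_toL2 {f : ℝ → ℂ} (h : MemLp f 2 volume) : toL2 f =ᵐ[volume] f := by
  rw [toL2_of_memLp h]
  exact h.coeFn_toLp

theorem toL2_congr {f g : ℝ → ℂ} (h : f =ᵐ[volume] g) : toL2 f = toL2 g := by
  by_cases hf : MemLp f 2 volume
  · have hg : MemLp g 2 volume := hf.ae_eq h
    rw [toL2_of_memLp hf, toL2_of_memLp hg]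
    exact MemLp.toLp_congr hf hg h
  · have hg : ¬ MemLp g 2 volume := fun hg => hf (hg.ae_eq h.symm)
    simp [toL2, hf, hg]

theorem toL2_add {f g : ℝ → ℂ} (hf : MemLp f 2 volume) (hg : MemLp g 2 volume) :
    toL2 (fun x => f x + g x) = toL2 f + toL2 g := by
  rw [toL2_of_memLp hf, toL2_of_memLp hg, ← MemLp.toLp_add hf hg, ← toL2_of_memLp]
  rfl

theorem toL2_smul (c : ℂ) {f : ℝ → ℂ} (hf : MemLp f 2 volume) :
    toL2 (fun x => c * f x) = c • toL2 f := by
  rw [toL2_of_memLp hf, ← MemLp.toLp_const_smul c hf, ← toL2_of_memLp]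
  rfl

/-! ### Fourier multipliers

Mathlib's Fourier transform on `L²(ℝ)` is `𝓕 f (ξ) = ∫ f(x) exp(-2πi x ξ) dx`. With the
normalisation `f^(ξ) = ∫ f(x) exp(-i x ξ) dx` one has `f^(2π ξ) = 𝓕 f (ξ)`. -/

/-- The Fourier multiplier `f ↦ 𝓕⁻¹ (m · 𝓕 f)` (for `f` with `m · 𝓕 f` in `L²`). -/
def multiplier (m : ℝ → ℂ) (f : L2) : L2 := 𝓕⁻ (toL2 (fun ξ => m ξ * (𝓕 f : L2) ξ))

theorem multiplier_add (m : ℝ → ℂ) (f g : L2)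
    (hf : MemLp (fun ξ => m ξ * (𝓕 f : L2) ξ) 2 volume)
    (hg : MemLp (fun ξ => m ξ * (𝓕 g : L2) ξ) 2 volume) :
    multiplier m (f + g) = multiplier m f + multiplier m g := by
  have h : toL2 (fun ξ => m ξ * (𝓕 (f + g) : L2) ξ) =
      toL2 (fun ξ => m ξ * (𝓕 f : L2) ξ) + toL2 (fun ξ => m ξ * (𝓕 g : L2) ξ) := by
    rw [← toL2_add hf hg]
    refine toL2_congr ?_
    rw [FourierTransform.fourier_add]
    filter_upwards [Lp.coeFn_add (𝓕 f : L2) (𝓕 g : L2)] with x hx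
    rw [hx, Pi.add_apply, mul_add]
  rw [multiplier, h, FourierTransform.fourierInv_add]
  rfl

theorem multiplier_smul (m : ℝ → ℂ) (c : ℂ) (f : L2)
    (hf : MemLp (fun ξ => m ξ * (𝓕 f : L2) ξ) 2 volume) :
    multiplier m (c • f) = c • multiplier m f := by
  have h : toL2 (fun ξ => m ξ * (𝓕 (c • f) : L2) ξ) =
      c • toL2 (fun ξ => m ξ * (𝓕 f : L2) ξ) := by
    rw [← toL2_smul c hf]
    refine toL2_congr ?_
    rw [FourierTransform.fourier_smul]
    filter_upwards [Lp.coeFn_smul c (𝓕 f : L2)] with x hx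
    rw [hx, Pi.smul_apply, smul_eq_mul]
    ring
  rw [multiplier, h, FourierTransform.fourierInv_smul]
  rfl

/-- The symbol `1_{[0,∞)}` of the Szegő projector. -/
def szegoSymbol (ξ : ℝ) : ℂ := (Set.Ici (0 : ℝ)).indicator (fun _ => (1 : ℂ)) ξ

/-- The Szegő projector `Π : L²(ℝ) → L²(ℝ)`. -/
def szego (f : L2) : L2 := multiplier szegoSymbol f

/-- The Hilbert transform `H = -i sign(D)` on `L²(ℝ)`. -/
def hilbert (f : L2) : L2 := multiplier (fun ξ => -Complex.I * (Real.sign ξ : ℂ)) f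

theorem memLp_szegoSymbol_mul (g : L2) :
    MemLp (fun ξ => szegoSymbol ξ * g ξ) 2 volume := by
  have h : (fun ξ => szegoSymbol ξ * g ξ) = (Set.Ici (0 : ℝ)).indicator (fun ξ => g ξ) := by
    funext ξ
    by_cases hξ : ξ ∈ Set.Ici (0 : ℝ) <;> simp [szegoSymbol, Set.indicator, hξ]
  rw [h]
  exact (Lp.memLp g).indicator measurableSet_Ici

theorem szego_add (f g : L2) : szego (f + g) = szego f + szego g :=
  multiplier_add _ f g (memLp_szegoSymbol_mul _) (memLp_szegoSymbol_mul _)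

theorem szego_smul (c : ℂ) (f : L2) : szego (c • f) = c • szego f :=
  multiplier_smul _ c f (memLp_szegoSymbol_mul _)

/-! ### The Hardy space -/

/-- The Hardy space `L²₊ = {f ∈ L²(ℝ) : 𝓕 f = 0 on (-∞, 0)}`. -/
def hardy : Submodule ℂ L2 where
  carrier := {f | ∀ᵐ ξ : ℝ, ξ < 0 → (𝓕 f : L2) ξ = 0}
  add_mem' := by
    intro f g hf hg
    simp only [Set.mem_ofPred_eq] at hf hg ⊢
    rw [FourierTransform.fourier_add]
    filter_upwards [hf, hg, Lp.coeFn_add (𝓕 f : L2) (𝓕 g : L2)] with ξ h1 h2 h3 h4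
    rw [h3, Pi.add_apply, h1 h4, h2 h4, add_zero]
  zero_mem' := by
    simp only [Set.mem_ofPred_eq]
    have h0 : (𝓕 (0 : L2) : L2) = 0 := (Lp.fourierTransformₗᵢ ℝ ℂ).map_zero
    rw [h0]
    filter_upwards [Lp.coeFn_zero ℂ 2 (volume : Measure ℝ)] with ξ h1 _
    rw [h1, Pi.zero_apply]
  smul_mem' := by
    intro c f hf
    simp only [Set.mem_ofPred_eq] at hf ⊢
    rw [FourierTransform.fourier_smul]
    filter_upwards [hf, Lp.coeFn_smul c (𝓕 f : L2)] with ξ h1 h3 h4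
    rw [h3, Pi.smul_apply, h1 h4, smul_zero]

theorem mem_hardy_iff {f : L2} : f ∈ hardy ↔ ∀ᵐ ξ : ℝ, ξ < 0 → (𝓕 f : L2) ξ = 0 := Iff.rfl

theorem multiplier_mem_hardy {m : ℝ → ℂ} {f : L2}
    (h : ∀ᵐ ξ : ℝ, ξ < 0 → m ξ * (𝓕 f : L2) ξ = 0)
    (hm : MemLp (fun ξ => m ξ * (𝓕 f : L2) ξ) 2 volume) : multiplier m f ∈ hardy := by
  change ∀ᵐ ξ : ℝ, ξ < 0 → (𝓕 (𝓕⁻ (toL2 (fun ξ => m ξ * (𝓕 f : L2) ξ)) : L2) : L2) ξ = 0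
  rw [FourierTransform.fourier_fourierInv_eq]
  filter_upwards [h, coeFn_toL2 hm] with ξ h1 h2 h3
  rw [h2, h1 h3]

theorem szego_mem_hardy (f : L2) : szego f ∈ hardy := by
  refine multiplier_mem_hardy (ae_of_all _ fun ξ hξ => ?_) (memLp_szegoSymbol_mul _)
  simp [szegoSymbol, Set.indicator, not_le.mpr hξ]

/-- The Szegő projection `Π f` as an element of `L²₊`. -/
def szegoHardy (f : L2) : hardy := ⟨szego f, szego_mem_hardy f⟩

/-- The value at `z` of the holomorphic function on the upper half-plane that corresponds to
`f ∈ L²₊` by the Paley-Wiener theorem,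
`f(z) = ∫_0^∞ exp(2πi z ξ) 𝓕 f(ξ) dξ = (2π)⁻¹ ∫_0^∞ exp(i z ξ) f^(ξ) dξ`. -/
def hardyEval (f : L2) (z : ℂ) : ℂ :=
  ∫ ξ in Set.Ioi (0 : ℝ), Complex.exp (2 * Real.pi * Complex.I * z * ξ) * (𝓕 f : L2) ξ

/-- `F` belongs to the Hardy space `H²(ℂ₊)` and its boundary value is `f`. -/
def IsHardyExtension (f : L2) (F : ℂ → ℂ) : Prop :=
  DifferentiableOn ℂ F {z : ℂ | 0 < z.im} ∧
  (∃ C : NNReal, ∀ y : ℝ, 0 < y →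
    eLpNorm (fun x : ℝ => F (x + y * Complex.I)) 2 volume ≤ C) ∧
  Tendsto (fun y : ℝ => eLpNorm (fun x : ℝ => F (x + y * Complex.I) - f x) 2 volume)
    (𝓝[>] 0) (𝓝 0)

/-! ### The Lax operator `L_u = D - T_u` -/

/-- The filtered Sobolev space `H¹₊ = {h ∈ L²₊ : ξ 𝓕 h(ξ) ∈ L²}`. -/
def sobolevOne : Submodule ℂ hardy where
  carrier := {h | MemLp (fun ξ : ℝ => ((2 * Real.pi * ξ : ℝ) : ℂ) * (𝓕 (h : L2) : L2) ξ) 2 volume}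
  add_mem' := by
    intro f g hf hg
    simp only [Set.mem_ofPred_eq, Submodule.coe_add] at hf hg ⊢
    rw [FourierTransform.fourier_add]
    refine (hf.add hg).ae_eq ?_
    filter_upwards [Lp.coeFn_add (𝓕 (f : L2) : L2) (𝓕 (g : L2) : L2)] with ξ h3
    rw [h3, Pi.add_apply, Pi.add_apply, mul_add]
  zero_mem' := by
    simp only [Set.mem_ofPred_eq, Submodule.coe_zero]
    have h0 : (𝓕 (0 : L2) : L2) = 0 := (Lp.fourierTransformₗᵢ ℝ ℂ).map_zero
    rw [h0]
    refine (MemLp.zero (ε := ℂ)).ae_eq ?_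
    filter_upwards [Lp.coeFn_zero ℂ 2 (volume : Measure ℝ)] with ξ h1
    rw [h1]
    simp
  smul_mem' := by
    intro c f hf
    simp only [Set.mem_ofPred_eq, Submodule.coe_smul] at hf ⊢
    rw [FourierTransform.fourier_smul]
    refine (hf.const_smul c).ae_eq ?_
    filter_upwards [Lp.coeFn_smul c (𝓕 (f : L2) : L2)] with ξ h3
    rw [h3, Pi.smul_apply, Pi.smul_apply, smul_eq_mul, smul_eq_mul]
    ring

theorem integrable_fourier_of_mem_sobolevOne {h : hardy} (hh : h ∈ sobolevOne) :
    Integrable (𝓕 (h : L2) : L2) volume := by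
  set F : L2 := 𝓕 (h : L2) with hF
  have h1 : MemLp (fun ξ : ℝ => ((2 * Real.pi * ξ : ℝ) : ℂ) * F ξ) 2 volume := hh
  have hne : ∀ ξ : ℝ, (1 + ((2 * Real.pi * ξ : ℝ) : ℂ) * Complex.I) ≠ 0 := by
    intro ξ h0
    have := congrArg Complex.re h0
    simp at this
  have hw : MemLp (fun ξ : ℝ => (1 + ((2 * Real.pi * ξ : ℝ) : ℂ) * Complex.I)⁻¹) 2 volume := by
    have hc : Continuous fun ξ : ℝ => (1 + ((2 * Real.pi * ξ : ℝ) : ℂ) * Complex.I)⁻¹ :=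
      Continuous.inv₀ (by fun_prop) hne
    rw [memLp_two_iff_integrable_sq_norm hc.aestronglyMeasurable]
    refine (integrable_inv_one_add_sq.comp_mul_left' (R := 2 * Real.pi)
      (by positivity)).congr (ae_of_all _ fun ξ => ?_)
    simp only [norm_inv, inv_pow, Complex.sq_norm, Complex.normSq_apply]
    simp
    ring
  have h2 : MemLp (fun ξ : ℝ => (1 + ((2 * Real.pi * ξ : ℝ) : ℂ) * Complex.I) * F ξ) 2 volume := by
    refine ((Lp.memLp F).add (h1.const_mul Complex.I)).ae_eq (ae_of_all _ fun ξ => ?_)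
    simp only [Pi.add_apply]
    ring
  refine (hw.integrable_mul h2).congr (ae_of_all _ fun ξ => ?_)
  simp only [Pi.mul_apply]
  rw [inv_mul_cancel_left₀ (hne ξ)]

theorem fourierInv_coe_ae_eq {g : L2} (hg : Integrable g volume) :
    (𝓕⁻ g : L2) =ᵐ[volume] (𝓕⁻ (g : ℝ → ℂ) : ℝ → ℂ) := by
  have hbd : ∀ x, ‖(𝓕⁻ (g : ℝ → ℂ) : ℝ → ℂ) x‖ ≤ ∫ ξ, ‖g ξ‖ := by
    intro x
    rw [Real.fourierInv_eq]
    refine (norm_integral_le_integral_norm _).trans_eq ?_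
    simp
  have hcont : Continuous (𝓕⁻ (g : ℝ → ℂ) : ℝ → ℂ) := by
    have := VectorFourier.fourierIntegral_continuous Real.continuous_fourierChar
      (L := -(innerₗ ℝ)) (μ := volume) (by simpa using (by fun_prop : Continuous fun p : ℝ × ℝ => -(p.2 * p.1))) hg
    exact this
  refine ae_eq_of_integral_contDiff_smul_eq
    ((Lp.memLp _).locallyIntegrable (by norm_num)) hcont.locallyIntegrable ?_
  intro φ hφ hsupp
  let φc : ℝ → ℂ := fun x => (φ x : ℂ)
  have h1 : HasCompactSupport φc := hsupp.comp_left (g := fun y : ℝ => (y : ℂ)) (by simp)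
  have h2 : ContDiff ℝ (⊤ : ℕ∞) φc := Complex.ofRealCLM.contDiff.comp hφ
  let ψ : SchwartzMap ℝ ℂ := h1.toSchwartzMap h2
  have hψ : ∀ x, ψ x = (φ x : ℂ) := fun x => rfl
  have e1 : (∫ x, φ x • (𝓕⁻ g : L2) x) = ∫ x, ψ x • (𝓕⁻ g : L2) x := by
    simp [hψ]
  have e2 : (∫ x, φ x • (𝓕⁻ (g : ℝ → ℂ) : ℝ → ℂ) x) =
      ∫ x, ψ x • (𝓕⁻ (g : ℝ → ℂ) : ℝ → ℂ) x := by
    simp [hψ]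
  rw [e1, e2, ← Lp.toTemperedDistribution_apply, ← Lp.fourierInv_toTemperedDistribution_eq,
    TemperedDistribution.fourierInv_apply, Lp.toTemperedDistribution_apply]
  have key := VectorFourier.integral_fourierIntegral_smul_eq_flip (L := -(innerₗ ℝ))
    (μ := volume) (ν := volume) (f := ψ) (g := (g : ℝ → ℂ)) Real.continuous_fourierChar
    (by simpa using (by fun_prop : Continuous fun p : ℝ × ℝ => -(p.2 * p.1))) ψ.integrable hg
  have hflip : (-(innerₗ ℝ)).flip = -(innerₗ ℝ) := by
    ext
    simp
  rw [hflip] at key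
  rw [SchwartzMap.fourierInv_coe]
  exact key

/-- The functions in `H¹₊` are bounded. -/
theorem memLp_top_of_mem_sobolevOne {h : hardy} (hh : h ∈ sobolevOne) :
    MemLp (h : L2) ⊤ volume := by
  have hi := integrable_fourier_of_mem_sobolevOne hh
  have he := fourierInv_coe_ae_eq hi
  rw [FourierTransform.fourierInv_fourier_eq] at he
  refine memLp_top_of_bound (Lp.memLp _).1 (∫ ξ, ‖(𝓕 (h : L2) : L2) ξ‖) ?_
  filter_upwards [he] with x hx
  rw [hx, Real.fourierInv_eq]
  refine (norm_integral_le_integral_norm _).trans_eq ?_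
  simp

theorem memLp_mul_of_mem_sobolevOne (u : L2) {h : hardy} (hh : h ∈ sobolevOne) :
    MemLp (fun x => u x * (h : L2) x) 2 volume :=
  (memLp_top_of_mem_sobolevOne hh).mul (Lp.memLp u)

/-- `D h - T_u h`, where `D = -i d/dx` is the Fourier multiplier with symbol `2π ξ` and
`T_u h = Π(u h)` is the Toeplitz operator of symbol `u`. -/
def laxApply (u h : L2) : L2 :=
  multiplier (fun ξ : ℝ => ((2 * Real.pi * ξ : ℝ) : ℂ)) h - szego (toL2 (fun x => u x * h x))

theorem laxApply_mem_hardy (u : L2) {h : hardy} (hh : h ∈ sobolevOne) :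
    laxApply u (h : L2) ∈ hardy :=
  hardy.sub_mem
    (multiplier_mem_hardy
      ((mem_hardy_iff.1 h.2).mono fun ξ hξ hneg => by rw [hξ hneg, mul_zero]) hh)
    (szego_mem_hardy _)

theorem laxApply_add (u : L2) {f g : hardy} (hf : f ∈ sobolevOne) (hg : g ∈ sobolevOne) :
    laxApply u ((f : L2) + (g : L2)) = laxApply u (f : L2) + laxApply u (g : L2) := by
  have h2 : toL2 (fun x => u x * ((f : L2) + (g : L2) : L2) x) =
      toL2 (fun x => u x * (f : L2) x) + toL2 (fun x => u x * (g : L2) x) := by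
    rw [← toL2_add (memLp_mul_of_mem_sobolevOne u hf) (memLp_mul_of_mem_sobolevOne u hg)]
    refine toL2_congr ?_
    filter_upwards [Lp.coeFn_add (f : L2) (g : L2)] with x hx
    rw [hx, Pi.add_apply, mul_add]
  rw [laxApply, h2, szego_add, multiplier_add _ _ _ hf hg, laxApply, laxApply]
  abel

theorem laxApply_smul (u : L2) (c : ℂ) {f : hardy} (hf : f ∈ sobolevOne) :
    laxApply u (c • (f : L2)) = c • laxApply u (f : L2) := by
  have h2 : toL2 (fun x => u x * (c • (f : L2) : L2) x) =
      c • toL2 (fun x => u x * (f : L2) x) := by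
    rw [← toL2_smul c (memLp_mul_of_mem_sobolevOne u hf)]
    refine toL2_congr ?_
    filter_upwards [Lp.coeFn_smul c (f : L2)] with x hx
    rw [hx, Pi.smul_apply, smul_eq_mul]
    ring
  rw [laxApply, h2, szego_smul, multiplier_smul _ _ _ hf, laxApply, smul_sub]

/-- The Lax operator `L_u = D - T_u` on `L²₊`, with domain `H¹₊`. -/
def laxOp (u : L2) : hardy →ₗ.[ℂ] hardy where
  domain := sobolevOne
  toFun :=
    { toFun := fun h => ⟨laxApply u ((h : hardy) : L2), laxApply_mem_hardy u h.2⟩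
      map_add' := fun f g => Subtype.ext (laxApply_add u f.2 g.2)
      map_smul' := fun c f => Subtype.ext (laxApply_smul u c f.2) }

/-- The eigenspace `Ker(λ - L_u)`. -/
def laxEigenspace (u : L2) (lam : ℝ) : Submodule ℂ hardy :=
  (LinearMap.ker ((laxOp u).toFun - (lam : ℂ) • (laxOp u).domain.subtype)).map
    (laxOp u).domain.subtype

/-- The pure point subspace of `L_u`: the closed linear span of all eigenvectors. -/
def purePoint (u : L2) : Submodule ℂ hardy :=
  (⨆ lam : ℝ, laxEigenspace u lam).topologicalClosure

/-! ### The generator `G` of the adjoint shift semigroup -/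

theorem memLp_exp_mul (η : ℝ) (f : L2) :
    MemLp (fun x : ℝ => Complex.exp (-(Complex.I * η * x)) * f x) 2 volume := by
  have hc : Continuous fun x : ℝ => Complex.exp (-(Complex.I * η * x)) := by fun_prop
  refine (Lp.memLp f).of_le (hc.aestronglyMeasurable.mul (Lp.memLp f).1) (ae_of_all _ fun x => ?_)
  have h : -(Complex.I * η * x) = ((-(η * x) : ℝ) : ℂ) * Complex.I := by push_cast; ring
  rw [norm_mul, h, Complex.norm_exp_ofReal_mul_I, one_mul]

/-- The adjoint `S(η)* : f ↦ Π(exp(-iηx) f)` of the multiplication by `exp(iηx)` on `L²₊`. -/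
def shiftAdj (η : ℝ) (f : hardy) : hardy :=
  ⟨szego (toL2 (fun x : ℝ => Complex.exp (-(Complex.I * η * x)) * (f : L2) x)), szego_mem_hardy _⟩

theorem shiftAdj_add (η : ℝ) (f g : hardy) :
    shiftAdj η (f + g) = shiftAdj η f + shiftAdj η g := by
  ext1
  simp only [shiftAdj, Submodule.coe_add]
  rw [← szego_add, ← toL2_add (memLp_exp_mul η _) (memLp_exp_mul η _)]
  congr 1
  refine toL2_congr ?_
  filter_upwards [Lp.coeFn_add (f : L2) (g : L2)] with x hx
  rw [hx, Pi.add_apply, mul_add]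

theorem shiftAdj_smul (η : ℝ) (c : ℂ) (f : hardy) :
    shiftAdj η (c • f) = c • shiftAdj η f := by
  ext1
  simp only [shiftAdj, Submodule.coe_smul]
  rw [← szego_smul, ← toL2_smul c (memLp_exp_mul η _)]
  congr 1
  refine toL2_congr ?_
  filter_upwards [Lp.coeFn_smul c (f : L2)] with x hx
  rw [hx, Pi.smul_apply, smul_eq_mul]
  ring

/-- `g = i d/dη (S(η)* f)` at `η = 0⁺`, the derivative being taken in `L²₊`. -/
def IsGenerator (f g : hardy) : Prop :=
  Tendsto (fun η : ℝ => (Complex.I / η) • (shiftAdj η f - f)) (𝓝[>] 0) (𝓝 g)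

theorem IsGenerator.add {f g f' g' : hardy} (h : IsGenerator f g) (h' : IsGenerator f' g') :
    IsGenerator (f + f') (g + g') := by
  refine (Tendsto.add h h').congr fun η => ?_
  rw [shiftAdj_add, ← smul_add]
  congr 1
  abel

theorem IsGenerator.smul {f g : hardy} (c : ℂ) (h : IsGenerator f g) :
    IsGenerator (c • f) (c • g) := by
  refine (Tendsto.const_smul h c).congr fun η => ?_
  rw [shiftAdj_smul, ← smul_sub, smul_comm]

/-- The operator `G` on `L²₊`: `-iG` is the infinitesimal generator of the contraction semigroup
`(S(η)*)_{η ≥ 0}`. -/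
def genG : hardy →ₗ.[ℂ] hardy where
  domain :=
    { carrier := {f | ∃ g, IsGenerator f g}
      add_mem' := fun ⟨g, hg⟩ ⟨g', hg'⟩ => ⟨g + g', hg.add hg'⟩
      zero_mem' := ⟨(0 : ℂ) • 0, by
        have h0 : ∀ η : ℝ, shiftAdj η (0 : hardy) = 0 := fun η => by
          have := shiftAdj_smul η 0 0
          simpa using this
        simp [IsGenerator, h0]⟩
      smul_mem' := fun c _ ⟨g, hg⟩ => ⟨c • g, hg.smul c⟩ }
  toFun :=
    { toFun := fun f => Classical.choose f.2
      map_add' := fun f f' => tendsto_nhds_unique (Classical.choose_spec (f + f').2)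
        ((Classical.choose_spec f.2).add (Classical.choose_spec f'.2))
      map_smul' := fun c f => tendsto_nhds_unique (Classical.choose_spec (c • f).2)
        ((Classical.choose_spec f.2).smul c) }

open scoped Classical in
/-- `G f` for `f` in the domain of `G` (and `0` otherwise). -/
def genGApply (f : hardy) : hardy := if h : f ∈ genG.domain then genG ⟨f, h⟩ else 0

/-- `g = (G - z)⁻¹ f`, that is, `g ∈ D(G)` and `(G - z) g = f`. -/
def IsResolvent (z : ℂ) (f g : hardy) : Prop :=
  ∃ h : g ∈ genG.domain, genG ⟨g, h⟩ - z • g = f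

/-! ### Multi-solitons -/

/-- The soliton profile `R(x) = 2 / (1 + x²)`. -/
def profile (x : ℝ) : ℝ := 2 / (1 + x ^ 2)

/-- The set `U_N` of `N`-solitons `u(x) = ∑_j R_{c_j}(x - x_j)`, `R_c(x) = c R(c x)`, `c_j > 0`. -/
def solitons (N : ℕ) : Set (ℝ → ℝ) :=
  {u | ∃ c y : Fin N → ℝ, (∀ j, 0 < c j) ∧
    ∀ x, u x = ∑ j, c j * profile (c j * (x - y j))}

/-- The class in `L²(ℝ)` of a real-valued function. -/
def cls (u : ℝ → ℝ) : L2 := toL2 (fun x => (u x : ℂ))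

/-- `Q` is a monic polynomial of degree `N` with all its roots in the lower half-plane such that
`Π u = i Q' / Q`. -/
def IsCharPoly (N : ℕ) (u : ℝ → ℝ) (Q : ℂ[X]) : Prop :=
  Q.Monic ∧ Q.natDegree = N ∧ (∀ z : ℂ, Q.IsRoot z → z.im < 0) ∧
    szego (cls u) =ᵐ[volume]
      fun x : ℝ => Complex.I * (Polynomial.derivative Q).eval (x : ℂ) / Q.eval (x : ℂ)

/-- The characteristic polynomial `Q_u` of the `N`-soliton `u`. -/
def charPoly (N : ℕ) (u : ℝ → ℝ) : ℂ[X] := Classical.epsilon (IsCharPoly N u)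

/-- The inner function `Θ_u = conj(Q_u) / Q_u`, where `conj(Q_u)` has the conjugate coefficients. -/
def innerFn (N : ℕ) (u : ℝ → ℝ) (z : ℂ) : ℂ :=
  ((charPoly N u).map (starRingEnd ℂ)).eval z / (charPoly N u).eval z

/-- The function `1 - Θ_u` on the real line. -/
def oneSubInner (N : ℕ) (u : ℝ → ℝ) (x : ℝ) : ℂ := 1 - innerFn N u x

/-- `(λ_j), (φ_j)` are the increasing enumeration of the eigenvalues of `L_u`, all of them negative
and simple, and the normalised eigenfunctions: `Ker(λ_j - L_u) = ℂ φ_j`, `‖φ_j‖ = 1` and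
`∫ u φ_j = √(2π |λ_j|)`. -/
structure IsSpectralData (N : ℕ) (u : ℝ → ℝ) (p : (Fin N → ℝ) × (Fin N → hardy)) : Prop where
  strictMono : StrictMono p.1
  eigenvalue_iff : ∀ μ : ℝ, laxEigenspace (cls u) μ ≠ ⊥ ↔ ∃ j, p.1 j = μ
  neg : ∀ j, p.1 j < 0
  eigenspace_eq : ∀ j, laxEigenspace (cls u) (p.1 j) = Submodule.span ℂ {p.2 j}
  norm_eq : ∀ j, ‖p.2 j‖ = 1
  integral_eq : ∀ j, ∫ x, (u x : ℂ) * (p.2 j : L2) x = (Real.sqrt (2 * Real.pi * |p.1 j|) : ℂ)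

/-- The eigenvalues `λ_1^u < ⋯ < λ_N^u` and the eigenfunctions `φ_1^u, …, φ_N^u`. -/
def spectralData (N : ℕ) (u : ℝ → ℝ) : (Fin N → ℝ) × (Fin N → hardy) :=
  Classical.epsilon (IsSpectralData N u)

/-- The eigenvalue `λ_j^u`. -/
def eigval (N : ℕ) (u : ℝ → ℝ) (j : Fin N) : ℝ := (spectralData N u).1 j

/-- The eigenfunction `φ_j^u`. -/
def eigfun (N : ℕ) (u : ℝ → ℝ) (j : Fin N) : hardy := (spectralData N u).2 j

/-- The matrix `M(u)` of `G` in the basis `φ_1^u, …, φ_N^u`: `M_{kj}(u) = ⟨G φ_j^u, φ_k^u⟩`. -/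
def matM (N : ℕ) (u : ℝ → ℝ) : Matrix (Fin N) (Fin N) ℂ :=
  Matrix.of fun k j => pairing (genGApply (eigfun N u j) : L2) (eigfun N u k : L2)

/-- The action `I_j(u) = 2π λ_j^u`. -/
def action (N : ℕ) (u : ℝ → ℝ) (j : Fin N) : ℝ := 2 * Real.pi * eigval N u j

/-- The generalised angle `γ_j(u) = Re ⟨G φ_j^u, φ_j^u⟩`. -/
def angle (N : ℕ) (u : ℝ → ℝ) (j : Fin N) : ℝ :=
  (pairing (genGApply (eigfun N u j) : L2) (eigfun N u j : L2)).re

/-- The action-angle map `Φ_N`. -/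
def actionAngle (N : ℕ) (u : ℝ → ℝ) : (Fin N → ℝ) × (Fin N → ℝ) := (action N u, angle N u)

/-- The set of actions `Ω_N = {r : r^1 < ⋯ < r^N < 0}`. -/
def actionSet (N : ℕ) : Set (Fin N → ℝ) := {r | StrictMono r ∧ ∀ j, r j < 0}

/-- The vector `X(u) = (√|λ_j^u|)_j`. -/
def vecX (N : ℕ) (u : ℝ → ℝ) (j : Fin N) : ℂ := (Real.sqrt |eigval N u j| : ℂ)

/-- The vector `Y(u) = (1/√|λ_j^u|)_j`. -/
def vecY (N : ℕ) (u : ℝ → ℝ) (j : Fin N) : ℂ := ((Real.sqrt |eigval N u j|)⁻¹ : ℂ)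

/-- The diagonal matrix `V(u)` of the actions. -/
def matV (N : ℕ) (u : ℝ → ℝ) : Matrix (Fin N) (Fin N) ℂ :=
  Matrix.diagonal fun j => (action N u j : ℂ)

/-- `⟨A⁻¹ X, Y⟩` for the inner product `⟨X, Y⟩ = Xᵀ conj(Y)` of `ℂ^N`. -/
def matPair {N : ℕ} (A : Matrix (Fin N) (Fin N) ℂ) (X Y : Fin N → ℂ) : ℂ :=
  dotProduct (A⁻¹.mulVec X) (star Y)

/-- `u : t ↦ u(t) ∈ U_N` solves the Benjamin-Ono equation `∂_t u = H ∂_x² u - ∂_x(u²)`, the time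
derivative being taken in `L²(ℝ)`. -/
def IsSolitonSolution (N : ℕ) (u : ℝ → ℝ → ℝ) : Prop :=
  (∀ t, u t ∈ solitons N) ∧
  ∀ t, HasDerivAt (fun s => cls (u s))
    (hilbert (cls (iteratedDeriv 2 (u t))) - cls (deriv fun x => u t x ^ 2)) t

end BenjaminOno

end

/-!
Everything is reduced to rational functions. Let `RatPlus` be the set of proper rational functions
with poles in the lower half-plane: they lie in the Hardy space, the kernels `1 / (x - b)` with
`Im b < 0` have a dense span there, and the conjugates `RatMinus` lie in the orthogonal
complement. On such functions `Π` is a partial fraction decomposition, `L_u f = -i f' - u f + β`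
with a correction `β` in `RatMinus` (`LaxRel`), and `G f = x f - c(f)`, where `c(f)` is the limit
of `x f(x)` at infinity (`isGenerator_ratPlus`). Integrals are computed from leading coefficients
at infinity (`integral_add_ratMinus`), which replaces the residue theorem.

*Spectral theory.* An `N`-soliton is `u = w + conj w` with `w = i Q' / Q`, where `Q` has the roots
`x_j - i / c_j`; put `Θ = conj Q / Q`. The model space `L²₊ ∩ (Θ L²₊)^⊥ = {P / Q : deg P < N}` is
stable under `L_u` and `G`. On `Θ L²₊` the operator `L_u` is unitarily equivalent to `-i d/dx`,
which has no eigenvectors, so all eigenvectors are in the model space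
(`laxEigenspace_le_modelSpace`), where the symmetric operator `L_u` is diagonalised. The
commutator `[L_u, G] f = -i f + c(f) Π u` (`LaxRel.commutator`) gives `‖f‖² = -2π λ |c(f)|²` for
an eigenfunction. Hence the eigenvalues are negative and simple, and the entries of the matrix
`M(u)` follow (`EigenFn.sub_mul_pairing`); the imaginary part of its diagonal is the defect of
symmetry of `G`.

*Inversion formula.* On the model space `(G - z)⁻¹ f = (f - f(z)) / (x - z)`, and pairing with
`1 - Θ` reads off `-2πi c` (`ModelMem.pairing_one_sub`), so that `⟨(G - z)⁻¹ f, 1 - Θ⟩ = 2πi f(z)`.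
Writing this for `f = Π u` in the basis of eigenfunctions expresses `Π u`, hence `u`, by the
actions and the angles; this is the injectivity of the action-angle map.

*The flow.* For a solution `u(t)` and fixed `s` and `x₀`, let `f` solve
`(G + 2 (t - s) L_{u(t)} - x₀) f = Π u(t)` in the model space of `u(t)`. The operator on the left is injective, again by the
commutator (`LaxRel.eq_zero_of_pencil`), so the solution exists, and its coefficients are
differentiable in `t` because they solve a linear system with differentiable coefficients. The
function `T = ∂_t f - i f'' - 2 w' f - 2 (L_u f)'` solves the homogeneous equation with the
constant `∂_t c(f)`; by injectivity `∂_t c(f) = 0` (`deriv_const_eq_zero`). At `t = s` the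
equation evaluated at `x₀` shows `c(f) = -Π u(s, x₀)`, and at `t = 0` the number `c(f)` is
`i ⟨(M(u₀) - x₀ - 2 s diag(λ_j))⁻¹ X, Y⟩`.
-/

open MeasureTheory Filter Topology FourierTransform Polynomial

noncomputable section

namespace BenjaminOno

/-! ### The Szegő projector as an orthogonal projection -/

theorem pairing_congr {f f' g g' : ℝ → ℂ} (hf : f =ᵐ[volume] f') (hg : g =ᵐ[volume] g') :
    pairing f g = pairing f' g' := by
  refine integral_congr_ae ?_
  filter_upwards [hf, hg] with x h1 h2
  rw [h1, h2]

theorem inner_eq_pairing (f g : L2) : inner ℂ g f = pairing f g := by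
  rw [L2.inner_def]
  rfl

theorem inner_toL2 {f g : ℝ → ℂ} (hf : MemLp f 2 volume) (hg : MemLp g 2 volume) :
    inner ℂ (toL2 g) (toL2 f) = pairing f g := by
  rw [inner_eq_pairing]
  exact pairing_congr (coeFn_toL2 hf) (coeFn_toL2 hg)

theorem inner_toL2_right (h : L2) {f : ℝ → ℂ} (hf : MemLp f 2 volume) :
    inner ℂ h (toL2 f) = pairing f h := by
  rw [inner_eq_pairing]
  exact pairing_congr (coeFn_toL2 hf) (ae_eq_refl _)

theorem inner_toL2_left (h : L2) {f : ℝ → ℂ} (hf : MemLp f 2 volume) :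
    inner ℂ (toL2 f) h = pairing h f := by
  rw [inner_eq_pairing]
  exact pairing_congr (ae_eq_refl _) (coeFn_toL2 hf)

theorem toL2_coe (f : L2) : toL2 (f : ℝ → ℂ) = f := by
  rw [toL2_of_memLp (Lp.memLp f)]
  exact Lp.toLp_coeFn f _

theorem fourier_szego (f : L2) :
    (𝓕 (szego f) : L2) =ᵐ[volume] fun ξ => szegoSymbol ξ * (𝓕 f : L2) ξ := by
  rw [szego, multiplier, FourierTransform.fourier_fourierInv_eq]
  exact coeFn_toL2 (memLp_szegoSymbol_mul _)

theorem inner_fourier (f g : L2) : inner ℂ g f = pairing (𝓕 f : L2) (𝓕 g : L2) := by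
  rw [← inner_eq_pairing, Lp.inner_fourier_eq]

theorem ae_ne_zero : ∀ᵐ ξ : ℝ, ξ ≠ 0 := by
  simp [ae_iff]

theorem inner_szego {g : L2} (hg : g ∈ hardy) (f : L2) :
    inner ℂ g (szego f) = inner ℂ g f := by
  rw [inner_fourier, inner_fourier]
  refine integral_congr_ae ?_
  filter_upwards [fourier_szego f, mem_hardy_iff.1 hg] with ξ h1 h2
  rw [h1]
  by_cases h : 0 ≤ ξ
  · simp [szegoSymbol, h]
  · rw [h2 (not_le.1 h)]
    simp

theorem szego_eq_self {f : L2} (hf : f ∈ hardy) : szego f = f := by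
  have h : toL2 (fun ξ => szegoSymbol ξ * (𝓕 f : L2) ξ) = 𝓕 f := by
    rw [← toL2_coe (𝓕 f)]
    refine toL2_congr ?_
    filter_upwards [mem_hardy_iff.1 hf, coeFn_toL2 (Lp.memLp (𝓕 f))] with ξ h2 h3
    rw [h3]
    by_cases h : 0 ≤ ξ
    · simp [szegoSymbol, h]
    · rw [h2 (not_le.1 h)]
      simp
  rw [szego, multiplier, h, FourierTransform.fourierInv_fourier_eq]

theorem mem_hardy_iff_szego_eq {f : L2} : f ∈ hardy ↔ szego f = f :=
  ⟨szego_eq_self, fun h => h ▸ szego_mem_hardy f⟩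

theorem norm_szego_le (f : L2) : ‖szego f‖ ≤ ‖f‖ := by
  have h1 := inner_szego (szego_mem_hardy f) f
  have h2 : ‖szego f‖ * ‖szego f‖ ≤ ‖szego f‖ * ‖f‖ := by
    calc _ = ‖inner ℂ (szego f) (szego f)‖ := by
          rw [inner_self_eq_norm_sq_to_K]
          simp [sq]
      _ = ‖inner ℂ (szego f) f‖ := by rw [h1]
      _ ≤ _ := norm_inner_le_norm _ _
  by_cases h : ‖szego f‖ = 0
  · rw [h]; positivity
  · exact le_of_mul_le_mul_left h2 (lt_of_le_of_ne (norm_nonneg _) (Ne.symm h))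

/-- The Szegő projector as a bounded operator. -/
def szegoCLM : L2 →L[ℂ] L2 :=
  LinearMap.mkContinuous
    { toFun := szego
      map_add' := szego_add
      map_smul' := szego_smul } 1 (fun f => by simpa using norm_szego_le f)

theorem szego_sub (f g : L2) : szego (f - g) = szego f - szego g := szegoCLM.map_sub f g

theorem isClosed_hardy : IsClosed (hardy : Set L2) := by
  have : (hardy : Set L2) = {f | szegoCLM f = f} := by
    ext f
    exact mem_hardy_iff_szego_eq
  rw [this]
  exact isClosed_eq szegoCLM.continuous continuous_id

theorem szego_eq_zero {f : L2} (hf : f ∈ hardyᗮ) : szego f = 0 := by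
  have h := inner_szego (szego_mem_hardy f) f
  rw [(Submodule.mem_orthogonal _ _).1 hf _ (szego_mem_hardy f)] at h
  exact inner_self_eq_zero.1 h

theorem eq_szego_of_add {f g p : L2} (hg : g ∈ hardyᗮ) (hp : p ∈ hardy) (h : f = p + g) :
    szego f = p := by
  rw [h, szego_add, szego_eq_zero hg, szego_eq_self hp, add_zero]

theorem eq_zero_of_mem_hardy_of_mem_orthogonal {f : L2} (h : f ∈ hardy) (h' : f ∈ hardyᗮ) :
    f = 0 := by
  rw [← szego_eq_self h, szego_eq_zero h']

theorem mem_hardyOrthogonal_of_fourier {f : L2} (h : ∀ᵐ ξ : ℝ, 0 < ξ → (𝓕 f : L2) ξ = 0) :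
    f ∈ hardyᗮ := by
  refine (Submodule.mem_orthogonal _ _).2 fun g hg => ?_
  rw [inner_fourier]
  refine integral_eq_zero_of_ae ?_
  filter_upwards [h, mem_hardy_iff.1 hg, ae_ne_zero] with ξ h1 h2 h3
  rcases lt_or_gt_of_ne h3 with h4 | h4
  · simp [h2 h4]
  · simp [h1 h4]

/-! ### The reproducing kernels of the Hardy space -/

/-- The kernel `x ↦ 1 / (x - b)`. It belongs to the Hardy space if `Im b < 0` and to its orthogonal
complement if `Im b > 0`. -/
def kernel (b : ℂ) (x : ℝ) : ℂ := ((x : ℂ) - b)⁻¹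

theorem ofReal_sub_ne_zero {b : ℂ} (hb : b.im ≠ 0) (x : ℝ) : (x : ℂ) - b ≠ 0 := by
  intro h
  have := congrArg Complex.im h
  simp at this
  exact hb this

theorem continuous_kernel {b : ℂ} (hb : b.im ≠ 0) : Continuous (kernel b) :=
  Continuous.inv₀ (by fun_prop) (ofReal_sub_ne_zero hb)

theorem integrable_exp_Ioi {A : ℂ} (hA : A.re < 0) (c : ℝ) :
    IntegrableOn (fun ξ : ℝ => Complex.exp (A * ξ)) (Set.Ioi c) :=
  integrableOn_exp_mul_complex_Ioi hA c

theorem norm_exp_mul_ofReal (A : ℂ) (ξ : ℝ) : ‖Complex.exp (A * ξ)‖ = Real.exp (A.re * ξ) := by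
  rw [Complex.norm_exp]
  simp

theorem memLp_indicator_exp {A : ℂ} {s : Set ℝ} (hs : MeasurableSet s) (σ : ℂ)
    (h : IntegrableOn (fun ξ : ℝ => Complex.exp (2 * A * ξ)) s) :
    MemLp (s.indicator fun ξ : ℝ => σ * Complex.exp (A * ξ)) 2 volume := by
  rw [memLp_indicator_iff_restrict hs]
  have hc : Continuous fun ξ : ℝ => σ * Complex.exp (A * ξ) := by fun_prop
  rw [memLp_two_iff_integrable_sq_norm hc.aestronglyMeasurable]
  refine (h.norm.const_mul (‖σ‖ ^ 2)).congr (ae_of_all _ fun ξ => ?_)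
  simp only [norm_mul, mul_pow, norm_exp_mul_ofReal, ← Real.exp_nat_mul]
  congr 2
  simp
  ring

theorem fourierInv_toL2_eq {g f : ℝ → ℂ} (hg : Integrable g) (hg2 : MemLp g 2 volume)
    (h : ∀ x, (𝓕⁻ g : ℝ → ℂ) x = f x) : (𝓕⁻ (toL2 g) : L2) = toL2 f ∧ MemLp f 2 volume := by
  have h1 := fourierInv_coe_ae_eq (g := toL2 g) (hg.congr (coeFn_toL2 hg2).symm)
  have h2 : (𝓕⁻ ((toL2 g : L2) : ℝ → ℂ) : ℝ → ℂ) = f := by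
    funext x
    rw [← h x, Real.fourierInv_eq, Real.fourierInv_eq]
    refine integral_congr_ae ?_
    filter_upwards [coeFn_toL2 hg2] with ξ hξ
    rw [hξ]
  rw [h2] at h1
  exact ⟨by rw [← toL2_coe (𝓕⁻ (toL2 g))]; exact toL2_congr h1, (Lp.memLp _).ae_eq h1⟩

theorem fourierInv_indicator_exp {A : ℂ} {s : Set ℝ} (hs : MeasurableSet s) (σ : ℂ) (x : ℝ) :
    (𝓕⁻ (s.indicator fun ξ : ℝ => σ * Complex.exp (A * ξ)) : ℝ → ℂ) x =
      σ * ∫ ξ in s, Complex.exp ((A + 2 * Real.pi * Complex.I * x) * ξ) := by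
  rw [Real.fourierInv_eq', ← integral_const_mul, ← integral_indicator hs]
  congr 1
  funext ξ
  by_cases h : ξ ∈ s
  · simp only [Set.indicator_of_mem h, smul_eq_mul]
    rw [mul_left_comm, ← Complex.exp_add]
    congr 2
    simp
    ring
  · simp [h]

theorem two_pi_I_ne_zero : (2 * Real.pi * Complex.I : ℂ) ≠ 0 := by
  simp [Real.pi_ne_zero]

/-- The Fourier transform of `x ↦ exp(2πi c (x-b)) / (x - b)` for `Im b < 0`: an exponential on the
half-line `(c, ∞)`, cut off at `c`. -/
theorem fourier_modulated_kernel {b : ℂ} (hb : b.im < 0) (c : ℝ) :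
    MemLp (fun x : ℝ => Complex.exp (2 * Real.pi * Complex.I * c * (x - b)) * kernel b x) 2 volume ∧
    (𝓕 (toL2 fun x : ℝ => Complex.exp (2 * Real.pi * Complex.I * c * (x - b)) * kernel b x) : L2)
      =ᵐ[volume] (Set.Ioi c).indicator fun ξ : ℝ =>
        -(2 * Real.pi * Complex.I) * Complex.exp (-(2 * Real.pi * Complex.I * b) * ξ) := by
  set A : ℂ := -(2 * Real.pi * Complex.I * b) with hAdef
  have hA : A.re < 0 := by
    simp [hAdef]
    nlinarith [Real.pi_pos]
  have h2A : (2 * A).re < 0 := by simp; linarith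
  have hm := memLp_indicator_exp (A := A) (s := Set.Ioi c) measurableSet_Ioi
    (-(2 * Real.pi * Complex.I)) (integrable_exp_Ioi h2A c)
  have hi : Integrable ((Set.Ioi c).indicator fun ξ : ℝ =>
      -(2 * Real.pi * Complex.I) * Complex.exp (A * ξ)) :=
    (integrable_indicator_iff measurableSet_Ioi).2 ((integrable_exp_Ioi hA c).const_mul _)
  have key := fourierInv_toL2_eq hi hm
    (f := fun x : ℝ => Complex.exp (2 * Real.pi * Complex.I * c * (x - b)) * kernel b x) (by
      intro x
      rw [fourierInv_indicator_exp measurableSet_Ioi, integral_exp_mul_complex_Ioi (by simpa using hA)]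
      have h1 : A + 2 * Real.pi * Complex.I * x = (2 * Real.pi * Complex.I) * (x - b) := by
        rw [hAdef]; ring
      have h2 := ofReal_sub_ne_zero hb.ne x
      have h3 := two_pi_I_ne_zero
      rw [h1, kernel]
      have h4 : (2 * Real.pi * Complex.I * (x - b) * c : ℂ) =
        2 * Real.pi * Complex.I * c * (x - b) := by ring
      rw [h4]
      field_simp)
  refine ⟨key.2, ?_⟩
  rw [← key.1, FourierTransform.fourier_fourierInv_eq]
  exact coeFn_toL2 hm

theorem fourier_kernel {b : ℂ} (hb : b.im < 0) :
    (𝓕 (toL2 (kernel b)) : L2) =ᵐ[volume] (Set.Ioi (0 : ℝ)).indicator fun ξ : ℝ =>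
        -(2 * Real.pi * Complex.I) * Complex.exp (-(2 * Real.pi * Complex.I * b) * ξ) := by
  have := (fourier_modulated_kernel hb 0).2
  simpa using this

theorem memLp_kernel_of_neg {b : ℂ} (hb : b.im < 0) : MemLp (kernel b) 2 volume := by
  have := (fourier_modulated_kernel hb 0).1
  simpa using this

theorem conj_kernel (b : ℂ) (x : ℝ) :
    (starRingEnd ℂ) (kernel b x) = kernel ((starRingEnd ℂ) b) x := by
  simp [kernel]

theorem memLp_conj {f : ℝ → ℂ} (h : MemLp f 2 volume) :
    MemLp (fun x => (starRingEnd ℂ) (f x)) 2 volume :=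
  h.star

theorem memLp_kernel {b : ℂ} (hb : b.im ≠ 0) : MemLp (kernel b) 2 volume := by
  rcases lt_or_gt_of_ne hb with h | h
  · exact memLp_kernel_of_neg h
  · have := memLp_conj (memLp_kernel_of_neg (b := (starRingEnd ℂ) b) (by simpa using h))
    simpa [conj_kernel] using this

theorem kernel_mem_hardy {b : ℂ} (hb : b.im < 0) : toL2 (kernel b) ∈ hardy := by
  refine mem_hardy_iff.2 ?_
  filter_upwards [fourier_kernel hb] with ξ h1 h2
  rw [h1, Set.indicator_of_notMem]
  simpa using h2.le

theorem kernel_mem_hardyOrthogonal {a : ℂ} (ha : 0 < a.im) : toL2 (kernel a) ∈ hardyᗮ := by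
  set A : ℂ := -(2 * Real.pi * Complex.I * a) with hAdef
  have hA : 0 < A.re := by
    simp [hAdef]
    nlinarith [Real.pi_pos]
  have h2A : 0 < (2 * A).re := by simpa using hA
  have hm := memLp_indicator_exp (A := A) (s := Set.Iic 0) measurableSet_Iic
    (2 * Real.pi * Complex.I) (integrableOn_exp_mul_complex_Iic h2A 0)
  have hi : Integrable ((Set.Iic 0).indicator fun ξ : ℝ =>
      (2 * Real.pi * Complex.I) * Complex.exp (A * ξ)) :=
    (integrable_indicator_iff measurableSet_Iic).2
      ((integrableOn_exp_mul_complex_Iic hA 0).const_mul _)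
  have key := fourierInv_toL2_eq hi hm (f := kernel a) (by
      intro x
      rw [fourierInv_indicator_exp measurableSet_Iic, integral_exp_mul_complex_Iic (by simpa using hA)]
      have h1 : A + 2 * Real.pi * Complex.I * x = (2 * Real.pi * Complex.I) * (x - a) := by
        rw [hAdef]; ring
      have h2 := ofReal_sub_ne_zero ha.ne' x
      have h3 := two_pi_I_ne_zero
      rw [h1, kernel]
      simp only [Complex.ofReal_zero, mul_zero, Complex.exp_zero]
      rw [one_div, mul_inv, mul_inv_cancel_left₀ h3])
  refine mem_hardyOrthogonal_of_fourier ?_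
  rw [← key.1, FourierTransform.fourier_fourierInv_eq]
  filter_upwards [coeFn_toL2 hm] with ξ h1 h2
  rw [h1, Set.indicator_of_notMem]
  simpa using h2

/-- The reproducing property: the holomorphic extension of `f` is obtained by pairing with
kernels. -/
theorem pairing_kernel {f : L2} {a : ℂ} (ha : 0 < a.im) :
    pairing f (kernel ((starRingEnd ℂ) a)) =
      pairing (szego f) (kernel ((starRingEnd ℂ) a)) ∧
    pairing f (kernel ((starRingEnd ℂ) a)) = 2 * Real.pi * Complex.I * hardyEval f a := by
  have hb : ((starRingEnd ℂ) a).im < 0 := by simpa using ha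
  constructor
  · rw [← inner_toL2_left _ (memLp_kernel hb.ne), ← inner_toL2_left _ (memLp_kernel hb.ne),
      inner_szego (kernel_mem_hardy hb)]
  · rw [← inner_toL2_left _ (memLp_kernel hb.ne), inner_fourier, hardyEval, ← integral_const_mul,
      ← integral_indicator measurableSet_Ioi]
    refine integral_congr_ae ?_
    filter_upwards [fourier_kernel hb] with ξ h1
    rw [h1]
    by_cases h : ξ ∈ Set.Ioi (0 : ℝ)
    · simp only [Set.indicator_of_mem h, map_mul, map_neg, ← Complex.exp_conj, Complex.conj_ofReal,
        Complex.conj_I, Complex.conj_conj, map_ofNat]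
      have : -(2 * (Real.pi : ℂ) * -Complex.I * a) * ξ = 2 * Real.pi * Complex.I * a * ξ := by ring
      rw [this]
      ring
    · simp [h]

/-! ### Density of the kernels -/

theorem integrable_and_memLp_exp_decay {w : ℝ → ℂ} (hw : AEStronglyMeasurable w volume) {C δ : ℝ}
    (hδ : 0 < δ) (hb : ∀ ξ, 0 < ξ → ‖w ξ‖ ≤ C * Real.exp (-δ * ξ)) (Φ : L2) :
    Integrable ((Set.Ioi (0 : ℝ)).indicator fun ξ => w ξ * Φ ξ) ∧
    MemLp ((Set.Ioi (0 : ℝ)).indicator fun ξ => w ξ * Φ ξ) 2 volume := by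
  have hE : MemLp ((Set.Ioi (0 : ℝ)).indicator fun ξ : ℝ => (C : ℂ) * Complex.exp ((-δ : ℂ) * ξ)) 2
      volume := by
    refine memLp_indicator_exp measurableSet_Ioi _ (integrable_exp_Ioi ?_ 0)
    simpa using hδ
  have hw2 : MemLp ((Set.Ioi (0 : ℝ)).indicator w) 2 volume := by
    refine hE.of_le (hw.indicator measurableSet_Ioi) (ae_of_all _ fun ξ => ?_)
    by_cases h : ξ ∈ Set.Ioi (0 : ℝ)
    · simp only [Set.indicator_of_mem h, norm_mul, norm_exp_mul_ofReal]
      refine (hb ξ h).trans ?_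
      simp only [Complex.norm_real, Complex.neg_re, Complex.ofReal_re]
      gcongr
      exact le_abs_self C
    · simp [h]
  have he : ((Set.Ioi (0 : ℝ)).indicator fun ξ => w ξ * Φ ξ) =
      fun ξ => (Set.Ioi (0 : ℝ)).indicator w ξ * Φ ξ := by
    funext ξ
    by_cases h : ξ ∈ Set.Ioi (0 : ℝ) <;> simp [h]
  rw [he]
  refine ⟨hw2.integrable_mul (Lp.memLp Φ), ?_⟩
  refine (Lp.memLp Φ).of_le_mul (c := |C|) (hw2.1.mul (Lp.memLp Φ).1) (ae_of_all _ fun ξ => ?_)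
  rw [norm_mul]
  gcongr
  by_cases h : ξ ∈ Set.Ioi (0 : ℝ)
  · rw [Set.indicator_of_mem h]
    refine (hb ξ h).trans ((mul_le_mul_of_nonneg_right (le_abs_self C) (Real.exp_nonneg _)).trans ?_)
    refine mul_le_of_le_one_right (abs_nonneg _) (Real.exp_le_one_iff.2 ?_)
    have : 0 < ξ := h
    nlinarith
  · simp [h]

/-- Injectivity of the Laplace-Fourier transform along a horizontal line, for an element of
`L²(0, ∞)` multiplied by a weight of moderate growth. -/
theorem ae_eq_zero_of_laplace {m : ℝ → ℂ} (hm : Continuous m) {C s δ : ℝ} (hδ : 0 < δ)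
    (hb : ∀ ξ, 0 < ξ → ‖m ξ * Complex.exp (-(2 * Real.pi * s) * ξ)‖ ≤ C * Real.exp (-δ * ξ)) (Φ : L2)
    (h : ∀ x : ℝ, ∫ ξ in Set.Ioi (0 : ℝ),
      Complex.exp (2 * Real.pi * Complex.I * (x + s * Complex.I) * ξ) * (m ξ * Φ ξ) = 0) :
    ∀ᵐ ξ : ℝ, 0 < ξ → m ξ * Φ ξ = 0 := by
  set w : ℝ → ℂ := fun ξ => m ξ * Complex.exp (-(2 * Real.pi * s) * ξ) with hw
  have hwc : Continuous w := by fun_prop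
  obtain ⟨hi, h2⟩ := integrable_and_memLp_exp_decay hwc.aestronglyMeasurable hδ hb Φ
  have key := fourierInv_toL2_eq (f := fun _ => 0) hi h2 (by
    intro x
    rw [Real.fourierInv_eq', ← h x, ← integral_indicator measurableSet_Ioi]
    congr 1
    funext ξ
    by_cases hξ : ξ ∈ Set.Ioi (0 : ℝ)
    · simp only [Set.indicator_of_mem hξ, smul_eq_mul, hw]
      have : Complex.exp (2 * Real.pi * Complex.I * (x + s * Complex.I) * ξ) =
          Complex.exp ((2 * Real.pi * (inner ℝ ξ x : ℝ) : ℝ) * Complex.I) *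
            Complex.exp (-(2 * Real.pi * s) * ξ) := by
        rw [← Complex.exp_add]
        congr 1
        simp
        linear_combination (2 * Real.pi * s * ξ : ℂ) * Complex.I_sq
      rw [this]
      ring
    · simp [hξ])
  have hz : toL2 (fun _ : ℝ => (0 : ℂ)) = 0 := by
    rw [toL2_of_memLp MemLp.zero']
    exact MemLp.toLp_zero _
  rw [hz] at key
  have h0 : toL2 ((Set.Ioi (0 : ℝ)).indicator fun ξ => w ξ * Φ ξ) = 0 := by
    have h7 := congrArg (fun g : L2 => (𝓕 g : L2)) key.1
    simp only [FourierTransform.fourier_fourierInv_eq] at h7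
    rw [h7]
    exact (Lp.fourierTransformₗᵢ ℝ ℂ).map_zero
  have h1 := coeFn_toL2 h2
  rw [h0] at h1
  filter_upwards [h1, Lp.coeFn_zero ℂ 2 (volume : Measure ℝ)] with ξ h3 h4 h5
  rw [h4, Set.indicator_of_mem (by exact h5)] at h3
  have h6 : m ξ * Φ ξ * Complex.exp (-(2 * Real.pi * s) * ξ) = 0 := by
    rw [Pi.zero_apply] at h3
    rw [h3]; simp only [hw]; ring
  exact (mul_eq_zero.1 h6).resolve_right (Complex.exp_ne_zero _)

theorem eq_zero_of_fourier_pos {f : L2} (hf : f ∈ hardy)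
    (h : ∀ᵐ ξ : ℝ, 0 < ξ → (𝓕 f : L2) ξ = 0) : f = 0 :=
  eq_zero_of_mem_hardy_of_mem_orthogonal hf (mem_hardyOrthogonal_of_fourier h)

theorem eq_zero_of_hardyEval {f : L2} (hf : f ∈ hardy) {s : ℝ} (hs : 0 < s)
    (h : ∀ x : ℝ, hardyEval f (x + s * Complex.I) = 0) : f = 0 := by
  refine eq_zero_of_fourier_pos hf ?_
  have := ae_eq_zero_of_laplace (m := fun _ => 1) continuous_const (C := 1) (s := s)
    (δ := 2 * Real.pi * s) (by positivity) (fun ξ _ => by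
      rw [norm_mul, ← Complex.ofReal_ofNat, ← Complex.ofReal_mul, ← Complex.ofReal_mul,
        ← Complex.ofReal_neg, norm_exp_mul_ofReal]
      simp) (𝓕 f) (fun x => by simpa [hardyEval] using h x)
  simpa using this

theorem eq_zero_of_inner_kernel {f : L2} (hf : f ∈ hardy) {s : ℝ} (hs : 0 < s)
    (h : ∀ b : ℂ, b.im = -s → inner ℂ (toL2 (kernel b)) f = 0) : f = 0 := by
  refine eq_zero_of_hardyEval hf hs fun x => ?_
  have h1 := h ((starRingEnd ℂ) (x + s * Complex.I)) (by simp)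
  rw [inner_toL2_left _ (memLp_kernel (by simp [hs.ne'])),
    (pairing_kernel (by simpa using hs)).2] at h1
  exact (mul_eq_zero.1 h1).resolve_left two_pi_I_ne_zero

/-- The kernels on a horizontal line span a dense subspace of the Hardy space. -/
theorem hardy_le_of_kernel_mem {S : Submodule ℂ L2} (hS : IsClosed (S : Set L2)) {s : ℝ} (hs : 0 < s)
    (h : ∀ b : ℂ, b.im = -s → toL2 (kernel b) ∈ S) : hardy ≤ S := by
  intro f hf
  set K : Submodule ℂ L2 :=
    (Submodule.span ℂ {g | ∃ b : ℂ, b.im = -s ∧ g = toL2 (kernel b)}).topologicalClosure with hK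
  have hKS : K ≤ S := by
    refine Submodule.topologicalClosure_minimal _ (Submodule.span_le.2 ?_) hS
    rintro _ ⟨b, hb, rfl⟩
    exact h b hb
  have hKH : K ≤ hardy := by
    refine Submodule.topologicalClosure_minimal _ (Submodule.span_le.2 ?_) isClosed_hardy
    rintro _ ⟨b, hb, rfl⟩
    exact kernel_mem_hardy (by rw [hb]; linarith)
  have : CompleteSpace K := (Submodule.isClosed_topologicalClosure _).completeSpace_coe
  obtain ⟨p, hp, q, hq, hpq⟩ := K.exists_add_mem_mem_orthogonal f
  have hq0 : q = 0 := by
    refine eq_zero_of_inner_kernel (s := s) ?_ hs fun b hb => ?_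
    · have : q = f - p := by rw [hpq]; abel
      rw [this]
      exact hardy.sub_mem hf (hKH hp)
    · refine (Submodule.mem_orthogonal _ _).1 hq _ ?_
      exact Submodule.le_topologicalClosure _ (Submodule.subset_span ⟨b, hb, rfl⟩)
  rw [hpq, hq0, add_zero]
  exact hKS hp

/-! ### Multiplication by bounded functions -/

theorem memLp_mul_bounded {g : ℝ → ℂ} (hg : Continuous g) {C : ℝ} (hC : ∀ x, ‖g x‖ ≤ C) {f : ℝ → ℂ}
    (hf : MemLp f 2 volume) : MemLp (fun x => f x * g x) 2 volume :=
  hf.of_le_mul (c := C) (hf.1.mul hg.aestronglyMeasurable) (ae_of_all _ fun x => by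
    rw [norm_mul, mul_comm]
    exact mul_le_mul_of_nonneg_right (hC x) (norm_nonneg _))

/-- Multiplication by a bounded continuous function as a bounded operator of `L²(ℝ)`. -/
def mulCLM (g : ℝ → ℂ) (hg : Continuous g) (C : ℝ) (hC : ∀ x, ‖g x‖ ≤ C) : L2 →L[ℂ] L2 :=
  LinearMap.mkContinuous
    { toFun := fun f => toL2 (fun x => f x * g x)
      map_add' := fun f f' => by
        rw [← toL2_add (memLp_mul_bounded hg hC (Lp.memLp f)) (memLp_mul_bounded hg hC (Lp.memLp f'))]
        refine toL2_congr ?_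
        filter_upwards [Lp.coeFn_add f f'] with x hx
        rw [hx, Pi.add_apply, add_mul]
      map_smul' := fun c f => by
        rw [RingHom.id_apply, ← toL2_smul c (memLp_mul_bounded hg hC (Lp.memLp f))]
        refine toL2_congr ?_
        filter_upwards [Lp.coeFn_smul c f] with x hx
        rw [hx, Pi.smul_apply, smul_eq_mul, mul_assoc] } C (fun f => by
      refine Lp.norm_le_mul_norm_of_ae_le_mul ?_
      filter_upwards [coeFn_toL2 (memLp_mul_bounded hg hC (Lp.memLp f))] with x hx
      simp only [LinearMap.coe_mk, AddHom.coe_mk]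
      rw [hx, norm_mul, mul_comm]
      exact mul_le_mul_of_nonneg_right (hC x) (norm_nonneg _))

theorem mulCLM_apply (g : ℝ → ℂ) (hg : Continuous g) (C : ℝ) (hC : ∀ x, ‖g x‖ ≤ C) (f : L2) :
    mulCLM g hg C hC f = toL2 (fun x => f x * g x) := rfl

theorem toL2_mul_coe {f : ℝ → ℂ} (hf : MemLp f 2 volume) (g : ℝ → ℂ) :
    toL2 (fun x => (toL2 f : L2) x * g x) = toL2 (fun x => f x * g x) := by
  refine toL2_congr ?_
  filter_upwards [coeFn_toL2 hf] with x hx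
  rw [hx]

theorem norm_kernel_le {b : ℂ} (hb : b.im ≠ 0) (x : ℝ) : ‖kernel b x‖ ≤ |b.im|⁻¹ := by
  rw [kernel, norm_inv]
  refine inv_anti₀ (abs_pos.2 hb) ?_
  refine le_trans ?_ (Complex.abs_im_le_norm _)
  simp

theorem kernel_mul_kernel {b b' : ℂ} (hb : b.im ≠ 0) (hb' : b'.im ≠ 0) (hne : b ≠ b') (x : ℝ) :
    kernel b x * kernel b' x = (b - b')⁻¹ * kernel b x + (-(b - b')⁻¹) * kernel b' x := by
  have h1 := ofReal_sub_ne_zero hb x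
  have h2 := ofReal_sub_ne_zero hb' x
  have h3 := sub_ne_zero.2 hne
  simp only [kernel]
  field_simp
  ring

theorem toL2_comb {f g : ℝ → ℂ} (α β : ℂ) (hf : MemLp f 2 volume) (hg : MemLp g 2 volume) :
    toL2 (fun x => α * f x + β * g x) = α • toL2 f + β • toL2 g := by
  rw [toL2_add (hf.const_mul α) (hg.const_mul β), toL2_smul _ hf, toL2_smul _ hg]

theorem mul_kernel_mem_hardy {b : ℂ} (hb : b.im < 0) {f : L2} (hf : f ∈ hardy) :
    toL2 (fun x => f x * kernel b x) ∈ hardy := by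
  set T := mulCLM (kernel b) (continuous_kernel hb.ne) _ (norm_kernel_le hb.ne)
  have hle : hardy ≤ hardy.comap (T : L2 →ₗ[ℂ] L2) := by
    refine hardy_le_of_kernel_mem (isClosed_hardy.preimage T.continuous) (s := 1 - b.im)
      (by linarith) fun b' hb' => ?_
    have hb'' : b'.im < 0 := by linarith
    have hne : b' ≠ b := fun h => by rw [h] at hb'; linarith
    change toL2 (fun x => (toL2 (kernel b') : L2) x * kernel b x) ∈ hardy
    rw [toL2_mul_coe (memLp_kernel hb''.ne), funext (kernel_mul_kernel hb''.ne hb.ne hne),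
      toL2_comb _ _ (memLp_kernel hb''.ne) (memLp_kernel hb.ne)]
    exact hardy.add_mem (hardy.smul_mem _ (kernel_mem_hardy hb''))
      (hardy.smul_mem _ (kernel_mem_hardy hb))
  exact hle hf

theorem mul_kernel_mem_hardyOrthogonal {a : ℂ} (ha : 0 < a.im) {f : L2} (hf : f ∈ hardyᗮ) :
    toL2 (fun x => f x * kernel a x) ∈ hardyᗮ := by
  refine (Submodule.mem_orthogonal _ _).2 fun g hg => ?_
  have hb : ((starRingEnd ℂ) a).im < 0 := by simpa using ha
  have h1 := (Submodule.mem_orthogonal _ _).1 hf _ (mul_kernel_mem_hardy hb hg)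
  rw [inner_toL2_left _ (memLp_mul_bounded (continuous_kernel hb.ne) (norm_kernel_le hb.ne)
    (Lp.memLp g))] at h1
  rw [inner_toL2_right _ (memLp_mul_bounded (continuous_kernel ha.ne') (norm_kernel_le ha.ne')
    (Lp.memLp f)), ← h1]
  refine integral_congr_ae (ae_of_all _ fun x => ?_)
  simp only [map_mul, conj_kernel, Complex.conj_conj]
  ring

theorem hardyEval_kernel {b a : ℂ} (hb : b.im < 0) (ha : 0 < a.im) :
    hardyEval (toL2 (kernel b)) a = (a - b)⁻¹ := by
  have hne : a - b ≠ 0 := fun h => by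
    have := congrArg Complex.im h
    simp at this
    linarith
  have h1 : hardyEval (toL2 (kernel b)) a = ∫ ξ in Set.Ioi (0 : ℝ), -(2 * Real.pi * Complex.I) *
      Complex.exp ((2 * Real.pi * Complex.I * (a - b)) * ξ) := by
    refine integral_congr_ae ?_
    filter_upwards [ae_restrict_of_ae (fourier_kernel hb), ae_restrict_mem measurableSet_Ioi]
      with ξ h1 h2
    rw [h1, Set.indicator_of_mem h2, mul_left_comm, ← Complex.exp_add]
    congr 2
    ring
  rw [h1, integral_const_mul, integral_exp_mul_complex_Ioi (by
    simp
    nlinarith [Real.pi_pos])]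
  have h3 := two_pi_I_ne_zero
  simp only [Complex.ofReal_zero, mul_zero, Complex.exp_zero]
  rw [mul_comm (2 * (Real.pi : ℂ) * Complex.I) (a - b), neg_mul, neg_div, mul_neg, neg_neg, one_div,
    mul_inv, mul_left_comm, mul_inv_cancel₀ h3, mul_one]

/-- For `f` in the Hardy space, `(f - f(a)) / (x - a)` is in the Hardy space. -/
theorem mul_kernel_sub_mem_hardy {a : ℂ} (ha : 0 < a.im) {f : L2} (hf : f ∈ hardy) :
    toL2 (fun x => f x * kernel a x) - hardyEval f a • toL2 (kernel a) ∈ hardy := by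
  have hb0 : ((starRingEnd ℂ) a).im < 0 := by simpa using ha
  set T : L2 →L[ℂ] L2 := mulCLM (kernel a) (continuous_kernel ha.ne') _ (norm_kernel_le ha.ne') -
    (2 * Real.pi * Complex.I : ℂ)⁻¹ •
      (innerSL ℂ (toL2 (kernel ((starRingEnd ℂ) a)))).smulRight (toL2 (kernel a)) with hT
  have hTa : ∀ f, T f = toL2 (fun x => f x * kernel a x) - hardyEval f a • toL2 (kernel a) := by
    intro f
    simp only [hT, sub_apply, mulCLM_apply, smul_apply,
      ContinuousLinearMap.smulRight_apply, innerSL_apply_apply]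
    rw [inner_toL2_left _ (memLp_kernel hb0.ne), (pairing_kernel ha).2, smul_smul,
      inv_mul_cancel_left₀ two_pi_I_ne_zero]
  rw [← hTa]
  have hle : hardy ≤ hardy.comap (T : L2 →ₗ[ℂ] L2) := by
    refine hardy_le_of_kernel_mem (isClosed_hardy.preimage T.continuous) one_pos fun b hb => ?_
    have hb' : b.im < 0 := by linarith
    have hne : b ≠ a := fun h => by rw [h] at hb'; linarith
    change T (toL2 (kernel b)) ∈ hardy
    rw [hTa, toL2_mul_coe (memLp_kernel hb'.ne), funext (kernel_mul_kernel hb'.ne ha.ne' hne),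
      toL2_comb _ _ (memLp_kernel hb'.ne) (memLp_kernel ha.ne'), hardyEval_kernel hb' ha]
    have : -(b - a)⁻¹ = (a - b)⁻¹ := by rw [← inv_neg, neg_sub]
    rw [this, add_sub_cancel_right]
    exact hardy.smul_mem _ (kernel_mem_hardy hb')
  exact hle hf

/-! ### Rational functions in the Hardy space -/

/-- The restrictions to `ℝ` of the proper rational functions with all poles in the lower
half-plane, as the smallest space of functions that contains the kernels `1 / (x - b)`, `Im b < 0`,
and is stable under multiplication by them. -/
inductive RatPlus : (ℝ → ℂ) → Prop
  | kernel {b : ℂ} (hb : b.im < 0) : RatPlus (kernel b)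
  | add {f g : ℝ → ℂ} (hf : RatPlus f) (hg : RatPlus g) : RatPlus (fun x => f x + g x)
  | smul (c : ℂ) {f : ℝ → ℂ} (hf : RatPlus f) : RatPlus (fun x => c * f x)
  | mul_kernel {b : ℂ} (hb : b.im < 0) {f : ℝ → ℂ} (hf : RatPlus f) :
      RatPlus (fun x => f x * BenjaminOno.kernel b x)

/-- The proper rational functions with all poles in the upper half-plane: the conjugates of the
elements of `RatPlus`. -/
def RatMinus (f : ℝ → ℂ) : Prop := RatPlus fun x => (starRingEnd ℂ) (f x)

namespace RatPlus

theorem congr {f g : ℝ → ℂ} (hf : RatPlus f) (h : ∀ x, g x = f x) : RatPlus g := by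
  rwa [funext h]

theorem zero : RatPlus (fun _ => 0) :=
  (smul 0 (kernel (b := -Complex.I) (by simp))).congr fun x => by simp

theorem neg {f : ℝ → ℂ} (hf : RatPlus f) : RatPlus (fun x => -f x) :=
  (smul (-1) hf).congr fun x => by simp

theorem sub {f g : ℝ → ℂ} (hf : RatPlus f) (hg : RatPlus g) : RatPlus (fun x => f x - g x) :=
  (hf.add hg.neg).congr fun x => by ring

theorem sum {ι : Type*} (s : Finset ι) {f : ι → ℝ → ℂ} (h : ∀ i ∈ s, RatPlus (f i)) :
    RatPlus (fun x => ∑ i ∈ s, f i x) := by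
  classical
  induction s using Finset.induction_on with
  | empty => simpa using zero
  | insert i s hi ih =>
    refine ((h i (by simp)).add (ih fun j hj => h j (by simp [hj]))).congr fun x => ?_
    rw [Finset.sum_insert hi]

theorem mul {f g : ℝ → ℂ} (hf : RatPlus f) (hg : RatPlus g) : RatPlus (fun x => f x * g x) := by
  induction hg with
  | kernel hb => exact hf.mul_kernel hb
  | add _ _ h1 h2 => exact (h1.add h2).congr fun x => by ring
  | smul c _ h => exact (h.smul c).congr fun x => by ring
  | mul_kernel hb _ h => exact (h.mul_kernel hb).congr fun x => by ring

theorem continuous {f : ℝ → ℂ} (hf : RatPlus f) : Continuous f := by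
  induction hf with
  | kernel hb => exact continuous_kernel hb.ne
  | add _ _ h1 h2 => exact h1.add h2
  | smul c _ h => exact continuous_const.mul h
  | mul_kernel hb _ h => exact h.mul (continuous_kernel hb.ne)

theorem bounded {f : ℝ → ℂ} (hf : RatPlus f) : ∃ C, ∀ x, ‖f x‖ ≤ C := by
  induction hf with
  | kernel hb => exact ⟨_, norm_kernel_le hb.ne⟩
  | add _ _ h1 h2 =>
    obtain ⟨C, hC⟩ := h1
    obtain ⟨D, hD⟩ := h2
    exact ⟨C + D, fun x => (norm_add_le _ _).trans (add_le_add (hC x) (hD x))⟩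
  | smul c _ h =>
    obtain ⟨C, hC⟩ := h
    exact ⟨‖c‖ * C, fun x => by
      rw [norm_mul]; exact mul_le_mul_of_nonneg_left (hC x) (norm_nonneg _)⟩
  | mul_kernel hb _ h =>
    obtain ⟨C, hC⟩ := h
    exact ⟨C * _, fun x => by
      rw [norm_mul]
      exact mul_le_mul (hC x) (norm_kernel_le hb.ne x) (norm_nonneg _) ((norm_nonneg _).trans (hC x))⟩

theorem memLp {f : ℝ → ℂ} (hf : RatPlus f) : MemLp f 2 volume := by
  induction hf with
  | kernel hb => exact memLp_kernel hb.ne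
  | add _ _ h1 h2 => exact h1.add h2
  | smul c _ h => exact h.const_mul c
  | mul_kernel hb _ h => exact memLp_mul_bounded (continuous_kernel hb.ne) (norm_kernel_le hb.ne) h

theorem mem_hardy {f : ℝ → ℂ} (hf : RatPlus f) : toL2 f ∈ hardy := by
  induction hf with
  | kernel hb => exact kernel_mem_hardy hb
  | add h h' h1 h2 => rw [toL2_add h.memLp h'.memLp]; exact hardy.add_mem h1 h2
  | smul c h h1 => rw [toL2_smul c h.memLp]; exact hardy.smul_mem c h1
  | mul_kernel hb h h1 => rw [← toL2_mul_coe h.memLp]; exact mul_kernel_mem_hardy hb h1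

theorem hasDerivAt_kernel {b : ℂ} (hb : b.im ≠ 0) (x : ℝ) :
    HasDerivAt (BenjaminOno.kernel b) (-(BenjaminOno.kernel b x * BenjaminOno.kernel b x)) x := by
  have h1 : HasDerivAt (fun x : ℝ => (x : ℂ) - b) 1 x := (Complex.ofRealCLM.hasDerivAt).sub_const b
  refine (h1.inv (ofReal_sub_ne_zero hb x)).congr_deriv ?_
  have := ofReal_sub_ne_zero hb x
  simp only [BenjaminOno.kernel]
  field_simp

theorem exists_hasDerivAt {f : ℝ → ℂ} (hf : RatPlus f) :
    ∃ g, RatPlus g ∧ ∀ x, HasDerivAt f (g x) x := by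
  induction hf with
  | kernel hb =>
    exact ⟨_, ((kernel hb).mul (kernel hb)).neg, hasDerivAt_kernel hb.ne⟩
  | add _ _ h1 h2 =>
    obtain ⟨g, hg, h⟩ := h1
    obtain ⟨g', hg', h'⟩ := h2
    exact ⟨_, hg.add hg', fun x => (h x).add (h' x)⟩
  | smul c _ h1 =>
    obtain ⟨g, hg, h⟩ := h1
    exact ⟨_, hg.smul c, fun x => (h x).const_mul c⟩
  | mul_kernel hb hf h1 =>
    obtain ⟨g, hg, h⟩ := h1
    exact ⟨_, (hg.mul_kernel hb).add (hf.mul (((kernel hb).mul (kernel hb)).neg)),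
      fun x => (h x).mul (hasDerivAt_kernel hb.ne x)⟩

theorem differentiable {f : ℝ → ℂ} (hf : RatPlus f) : Differentiable ℝ f := by
  obtain ⟨g, _, h⟩ := hf.exists_hasDerivAt
  exact fun x => (h x).differentiableAt

theorem deriv {f : ℝ → ℂ} (hf : RatPlus f) : RatPlus (deriv f) := by
  obtain ⟨g, hg, h⟩ := hf.exists_hasDerivAt
  exact hg.congr fun x => (h x).deriv

theorem hasDerivAt {f : ℝ → ℂ} (hf : RatPlus f) (x : ℝ) : HasDerivAt f (_root_.deriv f x) x :=
  (hf.differentiable x).hasDerivAt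

/-- For `f` in `RatPlus` there is `c` (the limit of `x f(x)` at infinity) with `x f - c` in
`RatPlus`. -/
theorem exists_const {f : ℝ → ℂ} (hf : RatPlus f) :
    ∃ (c : ℂ) (k : ℝ → ℂ), RatPlus k ∧ ∀ x : ℝ, x * f x = k x + c := by
  induction hf with
  | @kernel b hb =>
    refine ⟨1, _, (kernel hb).smul b, fun x => ?_⟩
    have := ofReal_sub_ne_zero hb.ne x
    simp only [BenjaminOno.kernel]
    field_simp
    ring
  | add _ _ h1 h2 =>
    obtain ⟨c, k, hk, h⟩ := h1
    obtain ⟨c', k', hk', h'⟩ := h2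
    refine ⟨c + c', _, hk.add hk', fun x => ?_⟩
    linear_combination h x + h' x
  | smul a _ h1 =>
    obtain ⟨c, k, hk, h⟩ := h1
    refine ⟨a * c, _, hk.smul a, fun x => ?_⟩
    linear_combination a * h x
  | @mul_kernel b hb f hf _ =>
    refine ⟨0, _, hf.add ((hf.mul_kernel hb).smul b), fun x => ?_⟩
    have := ofReal_sub_ne_zero hb.ne x
    simp only [BenjaminOno.kernel]
    field_simp
    ring

theorem tendsto_zero {f : ℝ → ℂ} (hf : RatPlus f) : Tendsto f atTop (𝓝 0) := by
  have hk : ∀ b : ℂ, Tendsto (BenjaminOno.kernel b) atTop (𝓝 0) := by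
    intro b
    have h1 : Tendsto (fun x : ℝ => (x : ℂ)) atTop (Bornology.cobounded ℂ) := by
      rw [← tendsto_norm_atTop_iff_cobounded]
      simpa using tendsto_abs_atTop_atTop
    have h2 := (tendsto_add_const_cobounded (-b)).comp h1
    exact (tendsto_inv₀_cobounded.comp h2).congr fun x => by simp [BenjaminOno.kernel, sub_eq_add_neg]
  induction hf with
  | kernel hb => exact hk _
  | add _ _ h1 h2 => simpa using h1.add h2
  | smul a _ h1 => simpa using h1.const_mul a
  | mul_kernel hb hf h => simpa using h.mul (hk _)

theorem eq_of_ae_eq {f g : ℝ → ℂ} (hf : RatPlus f) (hg : RatPlus g)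
    (h : f =ᵐ[volume] g) : f = g :=
  (hf.continuous.ae_eq_iff_eq volume hg.continuous).1 h

end RatPlus

namespace RatMinus

theorem conj {f : ℝ → ℂ} (hf : RatMinus f) : RatPlus fun x => (starRingEnd ℂ) (f x) := hf

theorem of_conj {f : ℝ → ℂ} (hf : RatPlus f) : RatMinus fun x => (starRingEnd ℂ) (f x) := by
  simpa [RatMinus] using hf

theorem congr {f g : ℝ → ℂ} (hf : RatMinus f) (h : ∀ x, g x = f x) : RatMinus g := by
  rwa [funext h]

theorem add {f g : ℝ → ℂ} (hf : RatMinus f) (hg : RatMinus g) : RatMinus (fun x => f x + g x) :=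
  (RatPlus.add hf hg).congr fun x => by simp

theorem smul (c : ℂ) {f : ℝ → ℂ} (hf : RatMinus f) : RatMinus (fun x => c * f x) :=
  (RatPlus.smul ((starRingEnd ℂ) c) hf).congr fun x => by simp

theorem neg {f : ℝ → ℂ} (hf : RatMinus f) : RatMinus (fun x => -f x) :=
  (RatPlus.neg hf).congr fun x => by simp

theorem sub {f g : ℝ → ℂ} (hf : RatMinus f) (hg : RatMinus g) : RatMinus (fun x => f x - g x) :=
  (RatPlus.sub hf hg).congr fun x => by simp

theorem mul {f g : ℝ → ℂ} (hf : RatMinus f) (hg : RatMinus g) : RatMinus (fun x => f x * g x) :=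
  (RatPlus.mul hf hg).congr fun x => by simp

theorem zero : RatMinus (fun _ => 0) := by simpa [RatMinus] using RatPlus.zero

theorem kernel {a : ℂ} (ha : 0 < a.im) : RatMinus (BenjaminOno.kernel a) :=
  (RatPlus.kernel (b := (starRingEnd ℂ) a) (by simpa using ha)).congr (conj_kernel a)

/-- Induction over rational functions with poles in the upper half-plane. -/
theorem induction {p : (ℝ → ℂ) → Prop} (hk : ∀ a : ℂ, 0 < a.im → p (BenjaminOno.kernel a))
    (ha : ∀ f g, RatMinus f → RatMinus g → p f → p g → p (fun x => f x + g x))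
    (hs : ∀ (c : ℂ) f, RatMinus f → p f → p (fun x => c * f x))
    (hm : ∀ a : ℂ, 0 < a.im → ∀ f, RatMinus f → p f → p (fun x => f x * BenjaminOno.kernel a x))
    {f : ℝ → ℂ} (hf : RatMinus f) : p f := by
  suffices h : ∀ g : ℝ → ℂ, RatPlus g → p (fun x => (starRingEnd ℂ) (g x)) by
    simpa using h _ hf
  intro g hg
  induction hg with
  | @kernel b hb =>
    simpa [conj_kernel] using hk ((starRingEnd ℂ) b) (by simpa using hb)
  | add h h' h1 h2 => simpa using ha _ _ (of_conj h) (of_conj h') h1 h2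
  | smul c h h1 => simpa using hs ((starRingEnd ℂ) c) _ (of_conj h) h1
  | @mul_kernel b hb f h h1 =>
    simpa [conj_kernel] using hm ((starRingEnd ℂ) b) (by simpa using hb) _ (of_conj h) h1

theorem continuous {f : ℝ → ℂ} (hf : RatMinus f) : Continuous f := by
  simpa [Function.comp_def] using Complex.continuous_conj.comp (RatPlus.continuous hf)

theorem memLp {f : ℝ → ℂ} (hf : RatMinus f) : MemLp f 2 volume := by
  simpa using memLp_conj (RatPlus.memLp hf)

theorem mem_hardyOrthogonal {f : ℝ → ℂ} (hf : RatMinus f) : toL2 f ∈ hardyᗮ := by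
  refine induction (p := fun f => toL2 f ∈ hardyᗮ) (fun a ha => kernel_mem_hardyOrthogonal ha)
    (fun f g hf hg h1 h2 => ?_) (fun c f hf h => ?_) (fun a ha f hf h => ?_) hf
  · rw [toL2_add hf.memLp hg.memLp]; exact Submodule.add_mem _ h1 h2
  · rw [toL2_smul c hf.memLp]; exact Submodule.smul_mem _ c h
  · rw [← toL2_mul_coe hf.memLp]; exact mul_kernel_mem_hardyOrthogonal ha h

theorem hasDerivAt_conj {f : ℝ → ℂ} {f' : ℂ} {x : ℝ} (h : HasDerivAt f f' x) :
    HasDerivAt (fun x => (starRingEnd ℂ) (f x)) ((starRingEnd ℂ) f') x :=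
  h.star

theorem hasDerivAt {f : ℝ → ℂ} (hf : RatMinus f) (x : ℝ) : HasDerivAt f (_root_.deriv f x) x := by
  have := hasDerivAt_conj (RatPlus.hasDerivAt hf x)
  simp only [Complex.conj_conj] at this
  exact this.differentiableAt.hasDerivAt

theorem deriv {f : ℝ → ℂ} (hf : RatMinus f) : RatMinus (deriv f) := by
  refine (RatPlus.deriv hf).congr fun x => ?_
  exact (hasDerivAt_conj (hf.hasDerivAt x)).deriv.symm

theorem exists_const {f : ℝ → ℂ} (hf : RatMinus f) :
    ∃ (c : ℂ) (k : ℝ → ℂ), RatMinus k ∧ ∀ x : ℝ, x * f x = k x + c := by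
  obtain ⟨c, k, hk, h⟩ := RatPlus.exists_const hf
  refine ⟨(starRingEnd ℂ) c, _, of_conj hk, fun x => ?_⟩
  have := congrArg (starRingEnd ℂ) (h x)
  simpa using this

theorem tendsto_zero {f : ℝ → ℂ} (hf : RatMinus f) : Tendsto f atTop (𝓝 0) := by
  simpa [Function.comp_def] using (Complex.continuous_conj.tendsto 0).comp (RatPlus.tendsto_zero hf)

end RatMinus

/-- A proper rational function cannot have its poles both in the lower and in the upper half-plane
unless it vanishes. -/
theorem eq_zero_of_ratPlus_of_ratMinus {f : ℝ → ℂ} (hf : RatPlus f) (hf' : RatMinus f) :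
    ∀ x, f x = 0 := by
  have h := eq_zero_of_mem_hardy_of_mem_orthogonal hf.mem_hardy hf'.mem_hardyOrthogonal
  have h1 := coeFn_toL2 hf.memLp
  rw [h] at h1
  have h2 : f =ᵐ[volume] fun _ => 0 := h1.symm.trans (Lp.coeFn_zero _ _ _)
  exact congrFun (hf.eq_of_ae_eq RatPlus.zero h2)

theorem RatPlus.mul_kernel_upper {a : ℂ} (ha : 0 < a.im) {f : ℝ → ℂ} (hf : RatPlus f) :
    ∃ (p : ℝ → ℂ) (c : ℂ), RatPlus p ∧ ∀ x, f x * BenjaminOno.kernel a x =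
      p x + c * BenjaminOno.kernel a x := by
  induction hf with
  | @kernel b hb =>
    have hne : b ≠ a := fun h => by rw [h] at hb; linarith
    exact ⟨_, _, (RatPlus.kernel hb).smul _, kernel_mul_kernel hb.ne ha.ne' hne⟩
  | add _ _ h1 h2 =>
    obtain ⟨p, c, hp, h⟩ := h1
    obtain ⟨p', c', hp', h'⟩ := h2
    exact ⟨_, c + c', hp.add hp', fun x => by linear_combination h x + h' x⟩
  | smul α _ h1 =>
    obtain ⟨p, c, hp, h⟩ := h1
    exact ⟨_, α * c, hp.smul α, fun x => by linear_combination α * h x⟩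
  | @mul_kernel b hb f hf h1 =>
    obtain ⟨p, c, hp, h⟩ := h1
    have hne : b ≠ a := fun h => by rw [h] at hb; linarith
    refine ⟨_, c * -(b - a)⁻¹,
      (hp.mul_kernel hb).add ((RatPlus.kernel hb).smul (c * (b - a)⁻¹)), fun x => ?_⟩
    linear_combination BenjaminOno.kernel b x * h x + c * kernel_mul_kernel hb.ne ha.ne' hne x

/-- Partial fractions: a product of rational functions with poles in opposite half-planes. -/
theorem RatPlus.mul_ratMinus {f m : ℝ → ℂ} (hf : RatPlus f) (hm : RatMinus m) :
    ∃ p q : ℝ → ℂ, RatPlus p ∧ RatMinus q ∧ ∀ x, f x * m x = p x + q x := by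
  refine RatMinus.induction (p := fun m => ∃ p q : ℝ → ℂ, RatPlus p ∧ RatMinus q ∧
    ∀ x, f x * m x = p x + q x) (fun a ha => ?_) ?_ ?_ ?_ hm
  · obtain ⟨p, c, hp, h⟩ := hf.mul_kernel_upper ha
    exact ⟨p, _, hp, (RatMinus.kernel ha).smul c, h⟩
  · rintro m m' _ _ ⟨p, q, hp, hq, h⟩ ⟨p', q', hp', hq', h'⟩
    exact ⟨_, _, hp.add hp', hq.add hq', fun x => by linear_combination h x + h' x⟩
  · rintro c m _ ⟨p, q, hp, hq, h⟩
    exact ⟨_, _, hp.smul c, hq.smul c, fun x => by linear_combination c * h x⟩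
  · rintro a ha m _ ⟨p, q, hp, hq, h⟩
    obtain ⟨p', c, hp', h'⟩ := hp.mul_kernel_upper ha
    refine ⟨p', _, hp', ((RatMinus.kernel ha).smul c).add (hq.mul (RatMinus.kernel ha)), fun x => ?_⟩
    linear_combination BenjaminOno.kernel a x * h x + h' x

/-- The product of an element of the Hardy space and a rational function with poles in the upper
half-plane is, up to an element of the Hardy space, again such a rational function. -/
theorem exists_mul_ratMinus {f : L2} (hf : f ∈ hardy) {m : ℝ → ℂ} (hm : RatMinus m) :
    ∃ (p : L2) (q : ℝ → ℂ), p ∈ hardy ∧ RatMinus q ∧ (fun x => f x * m x) =ᵐ[volume]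
      fun x => p x + q x := by
  refine RatMinus.induction (p := fun m => ∃ (p : L2) (q : ℝ → ℂ), p ∈ hardy ∧ RatMinus q ∧
    (fun x => f x * m x) =ᵐ[volume] fun x => p x + q x) (fun a ha => ?_) ?_ ?_ ?_ hm
  all_goals
    have main : ∀ f ∈ hardy, ∀ a : ℂ, 0 < a.im → ∃ (p : L2) (c : ℂ), p ∈ hardy ∧
        (fun x => f x * kernel a x) =ᵐ[volume] fun x => p x + c * kernel a x := by
      intro f hf a ha
      have h1 := mul_kernel_sub_mem_hardy ha hf
      refine ⟨_, hardyEval f a, h1, ?_⟩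
      have h2 := memLp_mul_bounded (continuous_kernel ha.ne') (norm_kernel_le ha.ne') (Lp.memLp f)
      filter_upwards [Lp.coeFn_sub (toL2 fun x => f x * kernel a x)
        (hardyEval f a • toL2 (kernel a)), Lp.coeFn_smul (hardyEval f a) (toL2 (kernel a)),
        coeFn_toL2 h2, coeFn_toL2 (memLp_kernel ha.ne')] with x h3 h4 h5 h6
      rw [h3, Pi.sub_apply, h4, Pi.smul_apply, h5, h6, smul_eq_mul]
      ring
  · obtain ⟨p, c, hp, h⟩ := main f hf a ha
    exact ⟨p, _, hp, (RatMinus.kernel ha).smul c, h⟩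
  · rintro m m' _ _ ⟨p, q, hp, hq, h⟩ ⟨p', q', hp', hq', h'⟩
    refine ⟨p + p', _, hardy.add_mem hp hp', hq.add hq', ?_⟩
    filter_upwards [h, h', Lp.coeFn_add p p'] with x h1 h2 h3
    rw [h3, Pi.add_apply]
    linear_combination h1 + h2
  · rintro c m _ ⟨p, q, hp, hq, h⟩
    refine ⟨c • p, _, hardy.smul_mem c hp, hq.smul c, ?_⟩
    filter_upwards [h, Lp.coeFn_smul c p] with x h1 h3
    rw [h3, Pi.smul_apply, smul_eq_mul]
    linear_combination c * h1
  · rintro a ha m _ ⟨p, q, hp, hq, h⟩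
    obtain ⟨p', c, hp', h'⟩ := main p hp a ha
    refine ⟨p', _, hp', ((RatMinus.kernel ha).smul c).add (hq.mul (RatMinus.kernel ha)), ?_⟩
    filter_upwards [h, h'] with x h1 h2
    linear_combination kernel a x * h1 + h2

/-! ### Integrals and pairings of rational functions -/

theorem RatPlus.const_unique {k k' : ℝ → ℂ} {c c' : ℂ} (hk : RatPlus k) (hk' : RatPlus k')
    (h : ∀ x, k x + c = k' x + c') : c = c' := by
  have h1 : Tendsto (fun x => k x + c) atTop (𝓝 (0 + c)) := hk.tendsto_zero.add_const c
  have h2 : Tendsto (fun x => k x + c) atTop (𝓝 (0 + c')) := by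
    rw [funext h]; exact hk'.tendsto_zero.add_const c'
  simpa using tendsto_nhds_unique h1 h2

theorem integrable_mul_of_memLp {f g : ℝ → ℂ} (hf : MemLp f 2 volume) (hg : MemLp g 2 volume) :
    Integrable (fun x => f x * g x) :=
  hf.integrable_mul hg

theorem integrable_mul_conj {f g : ℝ → ℂ} (hf : MemLp f 2 volume) (hg : MemLp g 2 volume) :
    Integrable (fun x => f x * (starRingEnd ℂ) (g x)) :=
  hf.integrable_mul (memLp_conj hg)

theorem RatPlus.integral_mul {f g : ℝ → ℂ} (hf : RatPlus f) (hg : RatPlus g) :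
    ∫ x, f x * g x = 0 := by
  have h := (Submodule.mem_orthogonal _ _).1 (RatMinus.of_conj hg).mem_hardyOrthogonal _ hf.mem_hardy
  rw [inner_toL2 (RatMinus.of_conj hg).memLp hf.memLp] at h
  have h2 := congrArg (starRingEnd ℂ) h
  rw [pairing, ← integral_conj, map_zero] at h2
  rw [← h2]
  refine integral_congr_ae (ae_of_all _ fun x => ?_)
  simp [mul_comm]

theorem RatMinus.integral_mul {f g : ℝ → ℂ} (hf : RatMinus f) (hg : RatMinus g) :
    ∫ x, f x * g x = 0 := by
  have h := RatPlus.integral_mul hf hg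
  have h2 := congrArg (starRingEnd ℂ) h
  rw [← integral_conj, map_zero] at h2
  simpa using h2

theorem RatPlus.pairing_ratMinus {f m : ℝ → ℂ} (hf : RatPlus f) (hm : RatMinus m) :
    pairing f m = 0 := hf.integral_mul hm

theorem RatMinus.pairing_ratPlus {f m : ℝ → ℂ} (hm : RatMinus m) (hf : RatPlus f) :
    pairing m f = 0 := RatMinus.integral_mul hm (of_conj hf)

theorem pairing_comb_left {f g h : ℝ → ℂ} (α β : ℂ) (hf : MemLp f 2 volume) (hg : MemLp g 2 volume)
    (hh : MemLp h 2 volume) :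
    pairing (fun x => α * f x + β * g x) h = α * pairing f h + β * pairing g h := by
  simp only [pairing]
  rw [← integral_const_mul, ← integral_const_mul, ← integral_add
    ((integrable_mul_conj hf hh).const_mul α) ((integrable_mul_conj hg hh).const_mul β)]
  congr 1
  funext x
  ring

theorem pairing_conj (f g : ℝ → ℂ) : (starRingEnd ℂ) (pairing f g) = pairing g f := by
  rw [pairing, ← integral_conj, pairing]
  congr 1
  funext x
  simp [mul_comm]

theorem pairing_comb_right {f g h : ℝ → ℂ} (α β : ℂ) (hf : MemLp f 2 volume) (hg : MemLp g 2 volume)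
    (hh : MemLp h 2 volume) :
    pairing h (fun x => α * f x + β * g x) =
      (starRingEnd ℂ) α * pairing h f + (starRingEnd ℂ) β * pairing h g := by
  rw [← pairing_conj, pairing_comb_left α β hf hg hh, map_add, map_mul, map_mul, pairing_conj,
    pairing_conj]

theorem integral_kernel_sub :
    ∫ x : ℝ, (kernel (-Complex.I) x - kernel Complex.I x) = -(2 * Real.pi * Complex.I) := by
  have h : ∀ x : ℝ, kernel (-Complex.I) x - kernel Complex.I x =
      (-(2 * Complex.I)) * (((1 + x ^ 2)⁻¹ : ℝ) : ℂ) := by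
    intro x
    have h1 : (x : ℂ) - Complex.I ≠ 0 := ofReal_sub_ne_zero (by simp) x
    have h2 : (x : ℂ) - -Complex.I ≠ 0 := ofReal_sub_ne_zero (by simp) x
    have h3 : (1 + (x : ℂ) ^ 2) = (x - Complex.I) * (x - -Complex.I) := by
      ring_nf; simp; ring
    simp only [kernel]
    push_cast
    rw [h3]
    field_simp
    ring
  simp_rw [h]
  rw [integral_const_mul, integral_complex_ofReal, integral_univ_inv_one_add_sq]
  ring

/-- If `p + m` decays like `x⁻²`, where the poles of `p` lie in the lower half-plane, those of `m`
in the upper half-plane, and `x p → c`, then the integral of `p + m` is `-2πi c`. -/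
theorem integral_add_ratMinus {p k m l : ℝ → ℂ} {c : ℂ} (hp : RatPlus p) (hk : RatPlus k)
    (hm : RatMinus m) (hl : RatMinus l) (h1 : ∀ x : ℝ, x * p x = k x + c)
    (h2 : ∀ x : ℝ, x * m x = l x - c) :
    ∫ x, (p x + m x) = -(2 * Real.pi * Complex.I) * c := by
  have hi : Complex.I.im ≠ 0 := by simp
  have hi' : (-Complex.I).im ≠ 0 := by simp
  have hP : RatPlus fun x => k x + Complex.I * p x := hk.add (hp.smul _)
  have hM : RatMinus fun x => l x + (-Complex.I) * m x := hl.add (hm.smul _)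
  have hkp : RatPlus (kernel (-Complex.I)) := .kernel (by simp)
  have hkm : RatMinus (kernel Complex.I) := .kernel (by simp)
  have he : ∀ x, p x + m x = (k x + Complex.I * p x) * kernel (-Complex.I) x +
      (l x + (-Complex.I) * m x) * kernel Complex.I x +
      c * (kernel (-Complex.I) x - kernel Complex.I x) := by
    intro x
    have h3 : (x : ℂ) - Complex.I ≠ 0 := ofReal_sub_ne_zero (by simp) x
    have h4 : (x : ℂ) - -Complex.I ≠ 0 := ofReal_sub_ne_zero (by simp) x
    have e1 : p x = (k x + c + Complex.I * p x) * kernel (-Complex.I) x := by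
      simp only [kernel]
      field_simp
      linear_combination h1 x
    have e2 : m x = (l x - c - Complex.I * m x) * kernel Complex.I x := by
      simp only [kernel]
      field_simp
      linear_combination h2 x
    linear_combination e1 + e2
  simp_rw [he]
  have i1 := integrable_mul_of_memLp hP.memLp hkp.memLp
  have i2 := integrable_mul_of_memLp hM.memLp hkm.memLp
  have i3 : Integrable fun x => c * (kernel (-Complex.I) x - kernel Complex.I x) := by
    -- a function whose Bochner integral is not zero is integrable
    by_contra hc
    have hne : c ≠ 0 := fun h0 => hc (by simp [h0])
    have h4 := integral_undef (mt (fun h => Integrable.const_mul h c) hc)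
    rw [integral_kernel_sub] at h4
    exact two_pi_I_ne_zero (neg_eq_zero.1 h4)
  have e3 := integral_add (i1.add i2) i3
  have e4 := integral_add i1 i2
  simp only [Pi.add_apply] at e3
  rw [e3, e4, hP.integral_mul hkp, hM.integral_mul hkm, integral_const_mul, integral_kernel_sub]
  ring

/-- The defect of symmetry of `f ↦ x f - c` on rational functions. -/
theorem pairing_mul_sub_pairing_mul {f k f' k' : ℝ → ℂ} {c c' : ℂ} (hf : RatPlus f) (hk : RatPlus k)
    (hf' : RatPlus f') (hk' : RatPlus k') (h : ∀ x : ℝ, x * f x = k x + c)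
    (h' : ∀ x : ℝ, x * f' x = k' x + c') :
    pairing k f' - pairing f k' = -(2 * Real.pi * Complex.I) * (c * (starRingEnd ℂ) c') := by
  rw [← integral_add_ratMinus (hf.smul ((starRingEnd ℂ) c')) (hk.smul ((starRingEnd ℂ) c'))
    (m := fun x => -c * (starRingEnd ℂ) (f' x)) (l := fun x => -c * (starRingEnd ℂ) (k' x))
    ((RatMinus.of_conj hf').smul _) ((RatMinus.of_conj hk').smul _)
    (fun x => by linear_combination (starRingEnd ℂ) c' * h x)
    (fun x => by
      have := congrArg (starRingEnd ℂ) (h' x)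
      simp only [map_mul, map_add, Complex.conj_ofReal] at this
      linear_combination -c * this), pairing, pairing, ← integral_sub
        (integrable_mul_conj hk.memLp hf'.memLp) (integrable_mul_conj hf.memLp hk'.memLp)]
  congr 1
  funext x
  have h2 := congrArg (starRingEnd ℂ) (h' x)
  simp only [map_mul, map_add, Complex.conj_ofReal] at h2
  linear_combination -(starRingEnd ℂ) (f' x) * h x + f x * h2

theorem integral_mul_deriv_ratPlus {f g : ℝ → ℂ} (hf : RatPlus f) (hg : RatPlus g) :
    pairing (fun x => -Complex.I * deriv f x) g = pairing f (fun x => -Complex.I * deriv g x) := by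
  have hg' := RatMinus.of_conj hg
  have := integral_mul_deriv_eq_deriv_mul_of_integrable (u := f) (u' := deriv f)
    (v := fun x => (starRingEnd ℂ) (g x)) (v' := fun x => (starRingEnd ℂ) (deriv g x))
    (fun x _ => hf.hasDerivAt x) (fun x _ => RatMinus.hasDerivAt_conj (hg.hasDerivAt x))
    (integrable_mul_conj hf.memLp hg.deriv.memLp) (integrable_mul_conj hf.deriv.memLp hg.memLp)
    (integrable_mul_conj hf.memLp hg.memLp)
  simp only [pairing, map_mul, map_neg, Complex.conj_I, neg_neg]
  have e1 : ∀ x, -Complex.I * deriv f x * (starRingEnd ℂ) (g x) =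
      -Complex.I * (deriv f x * (starRingEnd ℂ) (g x)) := fun x => by ring
  have e2 : ∀ x, f x * (Complex.I * (starRingEnd ℂ) (deriv g x)) =
      Complex.I * (f x * (starRingEnd ℂ) (deriv g x)) := fun x => by ring
  simp_rw [e1, e2]
  rw [integral_const_mul, integral_const_mul, this]
  ring

/-- Dominated convergence in `L²(ℝ)`. -/
theorem tendsto_eLpNorm_two_of_dominated {ι : Type*} {l : Filter ι} [l.IsCountablyGenerated]
    {F : ι → ℝ → ℂ} {φ : ℝ → ℝ} (hφ : MemLp φ 2 volume)
    (hm : ∀ᶠ i in l, Measurable (F i)) (hb : ∀ᶠ i in l, ∀ x, ‖F i x‖ ≤ φ x)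
    (hl : ∀ᵐ x : ℝ, Tendsto (fun i => F i x) l (𝓝 0)) :
    Tendsto (fun i => eLpNorm (F i) 2 volume) l (𝓝 0) := by
  have e : ∀ {E : Type} [NormedAddCommGroup E] (f : ℝ → E), eLpNorm f 2 volume =
      (∫⁻ x, ‖f x‖ₑ ^ (2 : ℝ)) ^ (1 / 2 : ℝ) := by
    intro E _ f
    rw [eLpNorm_eq_lintegral_rpow_enorm_toReal (by norm_num) (by norm_num)]
    simp
  have h0 : ∫⁻ x, ‖φ x‖ₑ ^ (2 : ℝ) ≠ ⊤ := by
    have h1 := hφ.2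
    rw [e] at h1
    intro h
    rw [h] at h1
    simp at h1
  have key := tendsto_lintegral_filter_of_dominated_convergence (μ := volume) (l := l)
    (F := fun i x => ‖F i x‖ₑ ^ (2 : ℝ)) (f := fun _ => 0)
    (fun x => ‖φ x‖ₑ ^ (2 : ℝ)) (by
      filter_upwards [hm] with i hi
      exact hi.enorm.pow_const _) (by
      filter_upwards [hb] with i hi
      refine ae_of_all _ fun x => ?_
      refine ENNReal.rpow_le_rpow ?_ (by norm_num)
      rw [enorm_le_iff_norm_le]
      exact (hi x).trans (le_abs_self _)) h0 (by
      filter_upwards [hl] with x hx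
      have := (ENNReal.continuous_rpow_const (y := (2 : ℝ))).tendsto (0 : ENNReal)
      have h2 := this.comp (by simpa using hx.enorm : Tendsto (fun i => ‖F i x‖ₑ) l (𝓝 0))
      simpa [Function.comp_def] using h2)
  have h3 := ((ENNReal.continuous_rpow_const (y := (1 / 2 : ℝ))).tendsto _).comp key
  simpa [Function.comp_def, e] using h3

/-! ### Holomorphic extensions of rational functions -/

/-- If `(f - v) / (x - a)` is in `RatPlus`, then `v` is the value at `a` of the extension of `f`. -/
theorem hardyEval_eq_of_sub {f g : ℝ → ℂ} (hf : RatPlus f) (hg : RatPlus g) {a v : ℂ}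
    (ha : 0 < a.im) (h : ∀ x : ℝ, f x - v = (x - a) * g x) : hardyEval (toL2 f) a = v := by
  have h0 : ((starRingEnd ℂ) a).im < 0 := by simpa using ha
  have h1 := (pairing_kernel (f := toL2 f) ha).2
  have h2 : pairing (toL2 f) (kernel ((starRingEnd ℂ) a)) = ∫ x, (g x + v * kernel a x) := by
    refine integral_congr_ae ?_
    filter_upwards [coeFn_toL2 hf.memLp] with x hx
    have h3 : (x : ℂ) - a ≠ 0 := ofReal_sub_ne_zero ha.ne' x
    rw [hx, conj_kernel, Complex.conj_conj, kernel]
    field_simp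
    linear_combination h x
  have h4 : ∀ x : ℝ, (x : ℂ) * (v * kernel a x) = a * v * kernel a x - (-v) := by
    intro x
    have h3 : (x : ℂ) - a ≠ 0 := ofReal_sub_ne_zero ha.ne' x
    simp only [kernel]
    field_simp
    ring
  rw [h2, integral_add_ratMinus (c := -v) hg (hf.add (hg.smul a)) ((RatMinus.kernel ha).smul v)
    ((RatMinus.kernel ha).smul (a * v)) (fun x => by linear_combination -h x) h4] at h1
  refine mul_left_cancel₀ two_pi_I_ne_zero ?_
  linear_combination -h1

/-- A rational function with poles in the lower half-plane extends holomorphically to the upper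
half-plane, with an `L²` bound that is uniform in the height, and its difference quotients are
rational functions of the same kind. -/
theorem RatPlus.exists_extension {f : ℝ → ℂ} (hf : RatPlus f) :
    ∃ (F : ℂ → ℂ) (φ : ℝ → ℝ), (∀ z : ℂ, 0 ≤ z.im → DifferentiableAt ℂ F z) ∧ (∀ x : ℝ, F x = f x) ∧
      MemLp φ 2 volume ∧ (∀ x y : ℝ, 0 ≤ y → ‖F (x + y * Complex.I)‖ ≤ φ x) ∧
      ∀ a : ℂ, 0 < a.im → ∃ g, RatPlus g ∧ ∀ x : ℝ, f x - F a = (x - a) * g x := by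
  have hne : ∀ {b : ℂ}, b.im < 0 → ∀ z : ℂ, 0 ≤ z.im → z - b ≠ 0 := by
    intro b hb z hz h
    have := congrArg Complex.im h
    simp at this
    linarith
  have hkb : ∀ {b : ℂ}, b.im < 0 → ∀ x y : ℝ, 0 ≤ y →
      ‖((x + y * Complex.I : ℂ) - b)⁻¹‖ ≤ ‖BenjaminOno.kernel b x‖ := by
    intro b hb x y hy
    rw [BenjaminOno.kernel, norm_inv, norm_inv]
    refine inv_anti₀ (norm_pos_iff.2 (ofReal_sub_ne_zero hb.ne x)) ?_
    rw [Complex.norm_def, Complex.norm_def]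
    refine Real.sqrt_le_sqrt ?_
    simp [Complex.normSq_apply]
    nlinarith
  induction hf with
  | @kernel b hb =>
    refine ⟨fun z => (z - b)⁻¹, fun x => ‖BenjaminOno.kernel b x‖, fun z hz => ?_, fun x => rfl,
      (memLp_kernel hb.ne).norm, fun x y hy => hkb hb x y hy, fun a ha => ?_⟩
    · exact (differentiableAt_id.sub_const b).inv (hne hb z hz)
    · refine ⟨_, (kernel hb).smul (-(a - b)⁻¹), fun x => ?_⟩
      have h1 := ofReal_sub_ne_zero hb.ne x
      have h2 := hne hb a ha.le
      simp only [BenjaminOno.kernel]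
      field_simp
      ring
  | add _ _ h1 h2 =>
    obtain ⟨F, φ, d, e, m, b, g⟩ := h1
    obtain ⟨F', φ', d', e', m', b', g'⟩ := h2
    refine ⟨fun z => F z + F' z, fun x => φ x + φ' x, fun z hz => (d z hz).add (d' z hz),
      fun x => by simp only [e, e'], m.add m',
      fun x y hy => (norm_add_le _ _).trans (add_le_add (b x y hy) (b' x y hy)), fun a ha => ?_⟩
    obtain ⟨q, hq, h⟩ := g a ha
    obtain ⟨q', hq', h'⟩ := g' a ha
    exact ⟨_, hq.add hq', fun x => by linear_combination h x + h' x⟩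
  | smul c _ h1 =>
    obtain ⟨F, φ, d, e, m, b, g⟩ := h1
    refine ⟨fun z => c * F z, fun x => ‖c‖ * φ x, fun z hz => (d z hz).const_mul c,
      fun x => by simp only [e], m.const_mul _,
      fun x y hy => by
        rw [norm_mul]; exact mul_le_mul_of_nonneg_left (b x y hy) (norm_nonneg _), fun a ha => ?_⟩
    obtain ⟨q, hq, h⟩ := g a ha
    exact ⟨_, hq.smul c, fun x => by linear_combination c * h x⟩
  | @mul_kernel b hb f hf h1 =>
    obtain ⟨F, φ, d, e, m, bd, g⟩ := h1
    refine ⟨fun z => F z * (z - b)⁻¹, fun x => φ x * |b.im|⁻¹,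
      fun z hz => (d z hz).mul ((differentiableAt_id.sub_const b).inv (hne hb z hz)),
      fun x => by simp only [e, BenjaminOno.kernel], m.mul_const _, fun x y hy => ?_, fun a ha => ?_⟩
    · rw [norm_mul]
      exact mul_le_mul (bd x y hy) ((hkb hb x y hy).trans (norm_kernel_le hb.ne x)) (norm_nonneg _)
        ((norm_nonneg _).trans (bd x y hy))
    · obtain ⟨q, hq, h⟩ := g a ha
      refine ⟨_, (hq.mul_kernel hb).add ((RatPlus.kernel hb).smul (-(F a * (a - b)⁻¹))), fun x => ?_⟩
      have h1 := ofReal_sub_ne_zero hb.ne x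
      have h2 := hne hb a ha.le
      simp only [BenjaminOno.kernel]
      field_simp
      linear_combination (a - b) * h x

theorem RatPlus.isHardyExtension {f : ℝ → ℂ} (hf : RatPlus f) :
    IsHardyExtension (toL2 f) (hardyEval (toL2 f)) := by
  obtain ⟨F, φ, d, e, m, b, g⟩ := hf.exists_extension
  have hF : ∀ a : ℂ, 0 < a.im → hardyEval (toL2 f) a = F a := by
    intro a ha
    obtain ⟨q, hq, h⟩ := g a ha
    exact hardyEval_eq_of_sub hf hq ha h
  have hy : ∀ x y : ℝ, 0 < y → hardyEval (toL2 f) (x + y * Complex.I) = F (x + y * Complex.I) :=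
    fun x y hy => hF _ (by simpa using hy)
  have hcont : ∀ y : ℝ, 0 ≤ y → Continuous fun x : ℝ => F (x + y * Complex.I) := by
    intro y hy
    refine continuous_iff_continuousAt.2 fun x => ?_
    exact ContinuousAt.comp (f := fun x : ℝ => (x + y * Complex.I : ℂ))
      (d _ (by simpa using hy)).continuousAt (by fun_prop)
  refine ⟨fun z hz => ((d z (le_of_lt hz)).congr_of_eventuallyEq ?_).differentiableWithinAt, ?_, ?_⟩
  · filter_upwards [(isOpen_lt (continuous_const (y := (0 : ℝ))) Complex.continuous_im).mem_nhds hz]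
      with w hw
    exact hF w hw
  · refine ⟨(eLpNorm φ 2 volume).toNNReal, fun y hy0 => ?_⟩
    rw [ENNReal.coe_toNNReal m.2.ne]
    refine eLpNorm_mono_real fun x => ?_
    rw [hy x y hy0]
    exact b x y hy0.le
  · have h1 : ∀ᶠ y : ℝ in 𝓝[>] (0 : ℝ), eLpNorm (fun x : ℝ => F (x + y * Complex.I) - f x) 2 volume =
        eLpNorm (fun x : ℝ => hardyEval (toL2 f) (x + y * Complex.I) - (toL2 f : L2) x) 2 volume := by
      filter_upwards [self_mem_nhdsWithin] with y hy0
      refine eLpNorm_congr_ae ?_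
      filter_upwards [coeFn_toL2 hf.memLp] with x hx
      rw [hx, hy x y hy0]
    refine Tendsto.congr' h1 ?_
    refine tendsto_eLpNorm_two_of_dominated (φ := fun x => φ x + ‖f x‖) (m.add hf.memLp.norm) ?_ ?_
      ?_
    · filter_upwards [self_mem_nhdsWithin] with y hy0
      exact ((hcont y (le_of_lt hy0)).sub hf.continuous).measurable
    · filter_upwards [self_mem_nhdsWithin] with y hy0
      exact fun x => (norm_sub_le _ _).trans (add_le_add (b x y (le_of_lt hy0)) le_rfl)
    · refine ae_of_all _ fun x => ?_
      have h2 : ContinuousAt (fun y : ℝ => F (x + y * Complex.I)) 0 :=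
        ContinuousAt.comp (f := fun y : ℝ => (x + y * Complex.I : ℂ))
          (d _ (by simp)).continuousAt (by fun_prop)
      have h3 : Tendsto (fun y : ℝ => F (x + y * Complex.I)) (𝓝[>] 0) (𝓝 (f x)) := by
        have := h2.tendsto.mono_left (nhdsWithin_le_nhds (s := Set.Ioi 0))
        simpa [e] using this
      simpa using h3.sub_const (f x)

/-! ### The operators `D`, `L_u` and `G` on rational functions -/

theorem integral_schwartz_mul_fourier (ψ : SchwartzMap ℝ ℂ) (f : L2) :
    ∫ ξ, ψ ξ * (𝓕 f : L2) ξ = ∫ x, (𝓕 ψ : SchwartzMap ℝ ℂ) x * f x := by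
  have h := Lp.fourier_toTemperedDistribution_eq f
  have h1 := congrArg (fun T => T ψ) h
  simp only [TemperedDistribution.fourier_apply, Lp.toTemperedDistribution_apply, smul_eq_mul] at h1
  exact h1.symm

/-- The Fourier multiplier `D` acts on rational functions as `-i d/dx`. -/
theorem fourier_deriv_ratPlus {f : ℝ → ℂ} (hf : RatPlus f) :
    (fun ξ : ℝ => ((2 * Real.pi * ξ : ℝ) : ℂ) * (𝓕 (toL2 f) : L2) ξ) =ᵐ[volume]
      (𝓕 (toL2 fun x => -Complex.I * deriv f x) : L2) := by
  have hg := (hf.deriv.smul (-Complex.I)).memLp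
  refine ae_eq_of_integral_contDiff_smul_eq ?_
    ((Lp.memLp _).locallyIntegrable (by norm_num)) ?_
  · refine locallyIntegrable_iff.2 fun K hK => ?_
    have h1 := locallyIntegrable_iff.1
      ((Lp.memLp (𝓕 (toL2 f) : L2)).locallyIntegrable (by norm_num)) K hK
    exact h1.continuousOn_mul (Continuous.continuousOn (by fun_prop)) hK
  intro φ hφ hsupp
  let φc : ℝ → ℂ := fun x => (φ x : ℂ)
  have h1 : HasCompactSupport φc := hsupp.comp_left (g := fun y : ℝ => (y : ℂ)) (by simp)
  have h2 : ContDiff ℝ (⊤ : ℕ∞) φc := Complex.ofRealCLM.contDiff.comp hφ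
  have h3 : ContDiff ℝ (⊤ : ℕ∞) fun ξ : ℝ => ((2 * Real.pi * ξ : ℝ) : ℂ) :=
    Complex.ofRealCLM.contDiff.comp (contDiff_const.mul contDiff_id)
  let ψ : SchwartzMap ℝ ℂ := h1.toSchwartzMap h2
  let χ : SchwartzMap ℝ ℂ := (h1.mul_left (f := fun ξ : ℝ => ((2 * Real.pi * ξ : ℝ) : ℂ))).toSchwartzMap
    (h3.mul h2)
  have hψ : ∀ x, ψ x = (φ x : ℂ) := fun x => rfl
  have hχ : ∀ x, χ x = ((2 * Real.pi * x : ℝ) : ℂ) * (φ x : ℂ) := fun x => rfl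
  have e1 : (∫ ξ, φ ξ • (((2 * Real.pi * ξ : ℝ) : ℂ) * (𝓕 (toL2 f) : L2) ξ)) =
      ∫ ξ, χ ξ * (𝓕 (toL2 f) : L2) ξ := by
    refine integral_congr_ae (ae_of_all _ fun ξ => ?_)
    simp only [hχ, Complex.real_smul]
    ring
  have e2 : (∫ ξ, φ ξ • (𝓕 (toL2 fun x => -Complex.I * deriv f x) : L2) ξ) =
      ∫ ξ, ψ ξ * (𝓕 (toL2 fun x => -Complex.I * deriv f x) : L2) ξ := by
    refine integral_congr_ae (ae_of_all _ fun ξ => ?_)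
    simp only [hψ, Complex.real_smul]
  rw [e1, e2, integral_schwartz_mul_fourier, integral_schwartz_mul_fourier]
  have e3 : ∫ x, (𝓕 χ : SchwartzMap ℝ ℂ) x * (toL2 f : L2) x =
      ∫ x, (𝓕 χ : SchwartzMap ℝ ℂ) x * f x := by
    refine integral_congr_ae ?_
    filter_upwards [coeFn_toL2 hf.memLp] with x hx
    rw [hx]
  have e4 : ∫ x, (𝓕 ψ : SchwartzMap ℝ ℂ) x * (toL2 fun x => -Complex.I * deriv f x : L2) x =
      ∫ x, (𝓕 ψ : SchwartzMap ℝ ℂ) x * (-Complex.I * deriv f x) := by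
    refine integral_congr_ae ?_
    filter_upwards [coeFn_toL2 hg] with x hx
    rw [hx]
  rw [e3, e4]
  have hd : ∀ x : ℝ, HasDerivAt (fun x => (𝓕 ψ : SchwartzMap ℝ ℂ) x)
      (-Complex.I * (𝓕 χ : SchwartzMap ℝ ℂ) x) x := by
    intro x
    have hxi : Integrable (fun x : ℝ => x • ψ x) := by
      have := (χ.integrable (μ := volume)).const_mul ((2 * Real.pi : ℂ)⁻¹)
      refine this.congr (ae_of_all _ fun x => ?_)
      simp only [hχ, hψ, Complex.real_smul]
      push_cast
      have : (Real.pi : ℂ) ≠ 0 := by simp [Real.pi_ne_zero]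
      field_simp
    have h5 := Real.hasDerivAt_fourier ψ.integrable hxi x
    rw [← SchwartzMap.fourier_coe] at h5
    refine h5.congr_deriv ?_
    rw [SchwartzMap.fourier_coe, Real.fourier_eq, Real.fourier_eq, ← integral_const_mul]
    refine integral_congr_ae (ae_of_all _ fun y => ?_)
    simp only [hχ, hψ, Circle.smul_def, smul_eq_mul]
    push_cast
    ring
  have m1 : MemLp (fun x => (𝓕 ψ : SchwartzMap ℝ ℂ) x) 2 volume := (𝓕 ψ : SchwartzMap ℝ ℂ).memLp 2
  have m2 : MemLp (fun x => (𝓕 χ : SchwartzMap ℝ ℂ) x) 2 volume := (𝓕 χ : SchwartzMap ℝ ℂ).memLp 2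
  have ibp := integral_mul_deriv_eq_deriv_mul_of_integrable (u := f) (u' := deriv f)
    (v := fun x => (𝓕 ψ : SchwartzMap ℝ ℂ) x) (v' := fun x => -Complex.I * (𝓕 χ : SchwartzMap ℝ ℂ) x)
    (fun x _ => hf.hasDerivAt x) (fun x _ => hd x)
    (integrable_mul_of_memLp hf.memLp (m2.const_mul _))
    (integrable_mul_of_memLp hf.deriv.memLp m1) (integrable_mul_of_memLp hf.memLp m1)
  have e5 : ∀ x, (𝓕 χ : SchwartzMap ℝ ℂ) x * f x =
      Complex.I * (f x * (-Complex.I * (𝓕 χ : SchwartzMap ℝ ℂ) x)) := fun x => by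
    linear_combination (𝓕 χ : SchwartzMap ℝ ℂ) x * f x * Complex.I_sq
  have e6 : ∀ x, (𝓕 ψ : SchwartzMap ℝ ℂ) x * (-Complex.I * deriv f x) =
      -Complex.I * (deriv f x * (𝓕 ψ : SchwartzMap ℝ ℂ) x) := fun x => by ring
  simp_rw [e5, e6]
  rw [integral_const_mul, integral_const_mul, ibp]
  ring

/-- The element of `L²₊` given by a rational function with poles in the lower half-plane. -/
def RatPlus.toHardy {f : ℝ → ℂ} (hf : RatPlus f) : hardy := ⟨toL2 f, hf.mem_hardy⟩

@[simp] theorem RatPlus.coe_toHardy {f : ℝ → ℂ} (hf : RatPlus f) : (hf.toHardy : L2) = toL2 f := rfl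

theorem RatPlus.toHardy_mem_sobolevOne {f : ℝ → ℂ} (hf : RatPlus f) : hf.toHardy ∈ sobolevOne :=
  (Lp.memLp (𝓕 (toL2 fun x => -Complex.I * _root_.deriv f x) : L2)).ae_eq
    (fourier_deriv_ratPlus hf).symm

theorem multiplier_ratPlus {f : ℝ → ℂ} (hf : RatPlus f) :
    multiplier (fun ξ : ℝ => ((2 * Real.pi * ξ : ℝ) : ℂ)) (toL2 f) =
      toL2 fun x => -Complex.I * deriv f x := by
  rw [multiplier, toL2_congr (fourier_deriv_ratPlus hf), toL2_coe,
    FourierTransform.fourierInv_fourier_eq]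

theorem szego_add_toL2 {p m : ℝ → ℂ} (hp : RatPlus p) (hm : RatMinus m) :
    szego (toL2 fun x => p x + m x) = toL2 p :=
  eq_szego_of_add hm.mem_hardyOrthogonal hp.mem_hardy (toL2_add hp.memLp hm.memLp)

theorem toL2_sub {f g : ℝ → ℂ} (hf : MemLp f 2 volume) (hg : MemLp g 2 volume) :
    toL2 (fun x => f x - g x) = toL2 f - toL2 g := by
  have := toL2_comb 1 (-1) hf hg
  simp only [one_mul, neg_mul, one_smul, neg_smul] at this
  rw [sub_eq_add_neg, ← this]
  simp only [sub_eq_add_neg]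

/-- `u = w + conj w` with a rational function `w` in the Hardy space. -/
def IsRealPartOf (u : ℝ → ℝ) (w : ℝ → ℂ) : Prop :=
  RatPlus w ∧ ∀ x, (u x : ℂ) = w x + (starRingEnd ℂ) (w x)

/-- `L_u f = g` for rational functions: `g = -i f' - u f + β`, where the correction `β` has its
poles in the upper half-plane and equals `(1 - Π)(u f)`. -/
structure LaxRel (u : ℝ → ℝ) (f g β : ℝ → ℂ) : Prop where
  left : RatPlus f
  right : RatPlus g
  rem : RatMinus β
  eq : ∀ x, g x = -Complex.I * deriv f x - u x * f x + β x

namespace IsRealPartOf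

variable {u : ℝ → ℝ} {w : ℝ → ℂ}

theorem memLp (h : IsRealPartOf u w) : MemLp (fun x => (u x : ℂ)) 2 volume := by
  rw [funext h.2]
  exact h.1.memLp.add (RatMinus.of_conj h.1).memLp

theorem szego_cls (h : IsRealPartOf u w) : szego (cls u) = toL2 w := by
  rw [cls, funext h.2]
  exact szego_add_toL2 h.1 (RatMinus.of_conj h.1)

theorem cls_ae (h : IsRealPartOf u w) : cls u =ᵐ[volume] fun x => (u x : ℂ) := coeFn_toL2 h.memLp

theorem exists_laxRel (h : IsRealPartOf u w) {f : ℝ → ℂ} (hf : RatPlus f) :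
    ∃ g β, LaxRel u f g β := by
  obtain ⟨p, q, hp, hq, hpq⟩ := hf.mul_ratMinus (RatMinus.of_conj h.1)
  refine ⟨_, q, hf, ((hf.deriv.smul (-Complex.I)).sub (h.1.mul hf)).sub hp, hq, fun x => ?_⟩
  rw [h.2]
  linear_combination hpq x

end IsRealPartOf

theorem integral_sub_add {f g h : ℝ → ℂ} (hf : Integrable f) (hg : Integrable g)
    (hh : Integrable h) : ∫ x, (f x - g x + h x) = (∫ x, f x) - (∫ x, g x) + ∫ x, h x := by
  have h1 := integral_add (hf.sub hg) hh
  simp only [Pi.sub_apply] at h1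
  rw [h1, integral_sub hf hg]

namespace LaxRel

variable {u : ℝ → ℝ} {w : ℝ → ℂ} {f g β f' g' β' : ℝ → ℂ}

theorem laxApply_eq (h : LaxRel u f g β) (hu : IsRealPartOf u w) :
    laxApply (cls u) (toL2 f) = toL2 g := by
  have h1 : toL2 (fun x => (cls u : L2) x * (toL2 f : L2) x) =
      toL2 fun x => (-Complex.I * deriv f x - g x) + β x := by
    refine toL2_congr ?_
    filter_upwards [hu.cls_ae, coeFn_toL2 h.left.memLp] with x h1 h2
    rw [h1, h2, h.eq]
    ring
  have hd := h.left.deriv.smul (-Complex.I)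
  rw [laxApply, multiplier_ratPlus h.left, h1, szego_add_toL2 (hd.sub h.right) h.rem,
    toL2_sub hd.memLp h.right.memLp]
  abel

theorem laxOp_eq (h : LaxRel u f g β) (hu : IsRealPartOf u w) :
    laxOp (cls u) ⟨h.left.toHardy, h.left.toHardy_mem_sobolevOne⟩ = h.right.toHardy :=
  Subtype.ext (h.laxApply_eq hu)

theorem comb (a b : ℂ) (h : LaxRel u f g β) (h' : LaxRel u f' g' β') :
    LaxRel u (fun x => a * f x + b * f' x) (fun x => a * g x + b * g' x)
      (fun x => a * β x + b * β' x) where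
  left := (h.left.smul a).add (h'.left.smul b)
  right := (h.right.smul a).add (h'.right.smul b)
  rem := (h.rem.smul a).add (h'.rem.smul b)
  eq x := by
    have : HasDerivAt (fun x => a * f x + b * f' x) (a * deriv f x + b * deriv f' x) x :=
      ((h.left.hasDerivAt x).const_mul a).add ((h'.left.hasDerivAt x).const_mul b)
    rw [this.deriv]
    linear_combination a * h.eq x + b * h'.eq x

theorem unique (h : LaxRel u f g β) (h' : LaxRel u f g' β') : ∀ x, g x = g' x := by
  have h1 : ∀ x, g x - g' x = β x - β' x := fun x => by rw [h.eq, h'.eq]; ring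
  have h2 := eq_zero_of_ratPlus_of_ratMinus (h.right.sub h'.right) ((h.rem.sub h'.rem).congr h1)
  exact fun x => sub_eq_zero.1 (h2 x)

theorem eq_zero (h : LaxRel u f g β) (hf : ∀ x, f x = 0) : ∀ x, g x = 0 := by
  obtain rfl : f = fun _ => 0 := funext hf
  have h1 : ∀ x, g x = β x := fun x => by rw [h.eq]; simp
  exact eq_zero_of_ratPlus_of_ratMinus h.right (h.rem.congr h1)

/-- `L_u` is symmetric on rational functions. -/
theorem symm (hu : IsRealPartOf u w) (h : LaxRel u f g β) (h' : LaxRel u f' g' β') :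
    pairing g f' = pairing f g' := by
  have hd := h.left.deriv.smul (-Complex.I)
  have hd' := h'.left.deriv.smul (-Complex.I)
  have mu : ∀ {f : ℝ → ℂ}, RatPlus f → MemLp (fun x => u x * f x) 2 volume := fun hf => by
    obtain ⟨C, hC⟩ := hf.bounded
    exact memLp_mul_bounded hf.continuous hC hu.memLp
  have e1 : pairing g f' = pairing (fun x => -Complex.I * deriv f x) f' -
      ∫ x, u x * f x * (starRingEnd ℂ) (f' x) := by
    have h0 := h.rem.pairing_ratPlus h'.left
    rw [← add_zero (_ - _), ← h0]
    simp only [pairing]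
    rw [← integral_sub_add (integrable_mul_conj hd.memLp h'.left.memLp)
      (integrable_mul_conj (mu h.left) h'.left.memLp) (integrable_mul_conj h.rem.memLp h'.left.memLp)]
    refine integral_congr_ae (ae_of_all _ fun x => ?_)
    simp only [h.eq]
    ring
  have e2 : pairing f g' = pairing f (fun x => -Complex.I * deriv f' x) -
      ∫ x, u x * f x * (starRingEnd ℂ) (f' x) := by
    have h0 := h.left.pairing_ratMinus h'.rem
    rw [← add_zero (_ - _), ← h0]
    simp only [pairing]
    rw [← integral_sub_add (integrable_mul_conj h.left.memLp hd'.memLp)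
      (integrable_mul_conj (mu h.left) h'.left.memLp) (integrable_mul_conj h.left.memLp h'.rem.memLp)]
    refine integral_congr_ae (ae_of_all _ fun x => ?_)
    simp only [h'.eq, map_add, map_sub, map_mul, Complex.conj_ofReal]
    ring
  rw [e1, e2, integral_mul_deriv_ratPlus h.left h'.left]

theorem deriv_const {f k : ℝ → ℂ} {c : ℂ} (hf : RatPlus f) (hk : RatPlus k)
    (h : ∀ x : ℝ, x * f x = k x + c) (x : ℝ) : x * deriv f x = deriv k x - f x := by
  have h1 : HasDerivAt (fun x : ℝ => (x : ℂ) * f x) (1 * f x + x * deriv f x) x :=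
    (Complex.ofRealCLM.hasDerivAt).mul (hf.hasDerivAt x)
  have h2 : HasDerivAt (fun x : ℝ => (x : ℂ) * f x) (deriv k x) x := by
    rw [funext h]
    exact (hk.hasDerivAt x).add_const c
  linear_combination h1.unique h2

/-- `L_u f` and the correction `(1 - Π)(u f)` have the same leading coefficient at infinity. -/
theorem rem_const (h : LaxRel u f g β) (hu : IsRealPartOf u w) {c : ℂ} {k : ℝ → ℂ}
    (hk : RatPlus k) (hc : ∀ x : ℝ, x * g x = k x + c) :
    ∃ l, RatMinus l ∧ ∀ x : ℝ, x * β x = l x + c := by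
  obtain ⟨c', l, hl, h1⟩ := h.rem.exists_const
  obtain ⟨a, q, hq, h2⟩ := h.left.exists_const
  have h3 : ∀ x : ℝ, l x + c' = (k x + c) + Complex.I * (deriv q x - f x) +
      (w x + (starRingEnd ℂ) (w x)) * (q x + a) := by
    intro x
    rw [← h1, ← hc, ← deriv_const h.left hq h2, ← h2, h.eq, ← hu.2]
    ring
  have t1 : Tendsto (fun x => l x + c') atTop (𝓝 (0 + c')) := hl.tendsto_zero.add_const c'
  have t2 : Tendsto (fun x => l x + c') atTop (𝓝 ((0 + c) + Complex.I * (0 - 0) +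
      (0 + 0) * (0 + a))) := by
    rw [funext h3]
    exact ((hk.tendsto_zero.add_const c).add ((hq.deriv.tendsto_zero.sub
      h.left.tendsto_zero).const_mul _)).add ((hu.1.tendsto_zero.add
      (RatMinus.of_conj hu.1).tendsto_zero).mul (hq.tendsto_zero.add_const a))
  have := tendsto_nhds_unique t1 t2
  simp at this
  exact ⟨l, hl, by rw [← this]; exact h1⟩

/-- `∫ u f = 2πi c` if `x L_u f → c` at infinity. -/
theorem integral_mul_eq (h : LaxRel u f g β) (hu : IsRealPartOf u w) {c : ℂ} {k : ℝ → ℂ}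
    (hk : RatPlus k) (hc : ∀ x : ℝ, x * g x = k x + c) :
    ∫ x, (u x : ℂ) * f x = 2 * Real.pi * Complex.I * c := by
  obtain ⟨l, hl, h1⟩ := h.rem_const hu hk hc
  obtain ⟨a, q, hq, h2⟩ := h.left.exists_const
  have := integral_add_ratMinus (c := -c) ((h.right.add (h.left.deriv.smul Complex.I)).neg)
    ((hk.add ((hq.deriv.sub h.left).smul Complex.I)).neg) h.rem hl
    (fun x => by linear_combination -hc x - Complex.I * deriv_const h.left hq h2 x)
    (fun x => by linear_combination h1 x)
  have h3 : ∀ x, (u x : ℂ) * f x = -(g x + Complex.I * deriv f x) + β x := fun x => by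
    rw [h.eq]; ring
  simp_rw [h3]
  rw [this]
  ring

/-- The commutator of `L_u` with `f ↦ x f - c`. -/
theorem commutator (h : LaxRel u f g β) (hu : IsRealPartOf u w) {c c' : ℂ} {k k' : ℝ → ℂ}
    (hk : RatPlus k) (hc : ∀ x : ℝ, x * f x = k x + c)
    (hk' : RatPlus k') (hc' : ∀ x : ℝ, x * g x = k' x + c') :
    ∃ γ, LaxRel u k (fun x => k' x + (-Complex.I) * f x + c * w x) γ := by
  obtain ⟨l, hl, h1⟩ := h.rem_const hu hk' hc'
  refine ⟨_, hk, (hk'.add (h.left.smul _)).add (hu.1.smul c),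
    hl.add ((RatMinus.of_conj hu.1).smul (-c)), fun x => ?_⟩
  have h2 := deriv_const h.left hk hc x
  have h3 := h.eq x
  linear_combination -Complex.I * h2 - hc' x + h1 x + x * h3 + (-u x) * hc x - c * hu.2 x

end LaxRel

theorem RatPlus.eq_zero_of_pairing_self {f : ℝ → ℂ} (hf : RatPlus f) (h : pairing f f = 0) :
    ∀ x, f x = 0 := by
  rw [← inner_toL2 hf.memLp hf.memLp, inner_self_eq_zero] at h
  have h1 := coeFn_toL2 hf.memLp
  rw [h] at h1
  have h2 : f =ᵐ[volume] fun _ => 0 := h1.symm.trans (Lp.coeFn_zero _ _ _)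
  exact congrFun (hf.eq_of_ae_eq RatPlus.zero h2)

/-- The operator `G - x₀ + 2τ L_u` is injective for real `x₀`, `τ`: the imaginary part of `G` forces
an element `v` of the kernel to have no leading coefficient, and then the commutator `[G, L_u]`
forces `i ‖v‖² = 0`. -/
theorem LaxRel.eq_zero_of_pencil {u : ℝ → ℝ} {w v g β : ℝ → ℂ} (hu : IsRealPartOf u w)
    (h : LaxRel u v g β) (τ x₀ : ℝ) {c : ℂ}
    (he : ∀ x : ℝ, (x - x₀) * v x - c + 2 * τ * g x = 0) : (∀ x, v x = 0) ∧ c = 0 := by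
  have mv := h.left.memLp
  have mg := h.right.memLp
  have hk := (h.left.smul (x₀ : ℂ)).add (h.right.smul (-2 * τ : ℂ))
  have hkc : ∀ x : ℝ, x * v x = (x₀ * v x + (-2 * τ) * g x) + c := fun x => by
    linear_combination he x
  have hs := h.symm hu h
  have h1 := pairing_mul_sub_pairing_mul h.left hk h.left hk hkc hkc
  rw [pairing_comb_left _ _ mv mg mv, pairing_comb_right _ _ mv mg mv, hs] at h1
  simp only [map_mul, map_neg, map_ofNat, Complex.conj_ofReal, sub_self] at h1
  have hc : c = 0 := by
    have h2 := (mul_eq_zero.1 h1.symm).resolve_left (neg_ne_zero.2 two_pi_I_ne_zero)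
    simpa using h2
  subst hc
  refine ⟨?_, rfl⟩
  obtain ⟨p, β', hp⟩ := hu.exists_laxRel h.right
  obtain ⟨c', k', hk', hc'⟩ := h.right.exists_const
  obtain ⟨γ, hγ⟩ := h.commutator hu hk hkc hk' hc'
  have h2 := (h.comb (x₀ : ℂ) (-2 * τ : ℂ) hp).unique hγ
  have mp := hp.right.memLp
  have h3 : k' = fun x => 1 * (x₀ * g x + (-2 * τ) * p x) + Complex.I * v x := by
    funext x
    linear_combination -h2 x
  have h4 := pairing_mul_sub_pairing_mul h.right hk' h.left hk hc' hkc
  rw [h3, pairing_comb_left _ _ ((hp.left.smul _).add (hp.right.smul _)).memLp mv mv,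
    pairing_comb_left _ _ mg mp mv, pairing_comb_right _ _ mv mg mg, hp.symm hu h] at h4
  simp only [map_mul, map_neg, map_ofNat, Complex.conj_ofReal, map_zero, mul_zero] at h4
  have h5 : Complex.I * pairing v v = 0 := by linear_combination h4
  exact h.left.eq_zero_of_pairing_self ((mul_eq_zero.1 h5).resolve_left Complex.I_ne_zero)

/-! ### The generator `G` -/

theorem norm_exp_neg_I_sub_one_le (η x : ℝ) :
    ‖Complex.exp (-(Complex.I * η * x)) - 1‖ ≤ |η| * |x| := by
  have := Real.norm_exp_I_mul_ofReal_sub_one_le (x := -(η * x))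
  rw [Real.norm_eq_abs, abs_neg, abs_mul] at this
  refine le_trans (le_of_eq ?_) this
  congr 3
  push_cast
  ring

theorem tendsto_exp_quotient (b : ℂ) :
    Tendsto (fun η : ℝ => Complex.I / η * (Complex.exp (-(Complex.I * η * b)) - 1)) (𝓝[>] 0)
      (𝓝 b) := by
  have h1 : HasDerivAt (fun η : ℝ => Complex.exp (-(Complex.I * η * b))) (-(Complex.I * b)) 0 := by
    have h2 : HasDerivAt (fun η : ℝ => -(Complex.I * η * b)) (-(Complex.I * 1 * b)) 0 :=
      ((((Complex.ofRealCLM.hasDerivAt (x := (0 : ℝ))).const_mul Complex.I).mul_const b)).neg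
    have := h2.cexp
    simpa using this
  have h3 := (hasDerivAt_iff_tendsto_slope_zero.1 h1).mono_left
    (nhdsWithin_mono (0 : ℝ) (fun x (hx : 0 < x) => hx.ne'))
  have h4 := h3.const_mul Complex.I
  have e : Complex.I * -(Complex.I * b) = b := by linear_combination -b * Complex.I_sq
  rw [e] at h4
  refine h4.congr fun η => ?_
  simp only [zero_add, Complex.ofReal_zero, mul_zero, zero_mul, neg_zero, Complex.exp_zero,
    Complex.real_smul, Complex.ofReal_inv]
  ring

/-- `G f = x f` if `x f` is again in the Hardy space: the difference quotients are dominated by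
`x f`. -/
theorem isGenerator_of_mul_eq {f k : ℝ → ℂ} (hf : RatPlus f) (hk : RatPlus k)
    (h : ∀ x : ℝ, x * f x = k x) : IsGenerator hf.toHardy hk.toHardy := by
  set F : ℝ → ℝ → ℂ := fun η x =>
    Complex.I / η * (Complex.exp (-(Complex.I * η * x)) - 1) * f x - k x with hF
  have hb : ∀ η : ℝ, 0 < η → ∀ x, ‖F η x‖ ≤ 2 * ‖k x‖ := by
    intro η hη x
    have h1 : ‖Complex.I / η * (Complex.exp (-(Complex.I * η * x)) - 1) * f x‖ ≤ ‖k x‖ := by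
      rw [← h, norm_mul, norm_mul, norm_mul]
      refine mul_le_mul_of_nonneg_right ?_ (norm_nonneg _)
      have h2 := norm_exp_neg_I_sub_one_le η x
      rw [norm_div, Complex.norm_I, Complex.norm_real, Complex.norm_real, Real.norm_eq_abs,
        Real.norm_eq_abs]
      have h3 : 0 < |η| := abs_pos.2 hη.ne'
      calc 1 / |η| * _ ≤ 1 / |η| * (|η| * |x|) := by gcongr
        _ = |x| := by field_simp
    calc _ ≤ ‖_‖ + ‖k x‖ := norm_sub_le _ _
      _ ≤ _ := by linarith
  have hc : ∀ η : ℝ, Continuous (F η) := fun η => by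
    have := hf.continuous
    have := hk.continuous
    simp only [hF]
    fun_prop
  have hm : ∀ η : ℝ, 0 < η → MemLp (F η) 2 volume := fun η hη =>
    (hk.memLp.norm.const_mul 2).of_le (hc η).aestronglyMeasurable (ae_of_all _ fun x => by
      refine (hb η hη x).trans (le_abs_self _))
  have hlim := tendsto_eLpNorm_two_of_dominated (l := 𝓝[>] (0 : ℝ)) (F := F)
    (hk.memLp.norm.const_mul 2) (Eventually.of_forall fun η => (hc η).measurable)
    (by filter_upwards [self_mem_nhdsWithin] with η hη using hb η hη)
    (ae_of_all _ fun x => by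
      have := ((tendsto_exp_quotient x).mul_const (f x)).sub_const (k x)
      rwa [h, sub_self] at this)
  rw [IsGenerator, tendsto_iff_norm_sub_tendsto_zero]
  have hlim2 : Tendsto (fun η => (eLpNorm (F η) 2 volume).toReal) (𝓝[>] 0) (𝓝 0) := by
    have := (ENNReal.tendsto_toReal ENNReal.zero_ne_top).comp hlim
    simpa [Function.comp_def] using this
  refine squeeze_zero' (Eventually.of_forall fun _ => norm_nonneg _) ?_ hlim2
  filter_upwards [self_mem_nhdsWithin] with η hη
  have he : ((Complex.I / η : ℂ) • (shiftAdj η hf.toHardy - hf.toHardy) - hk.toHardy : hardy) =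
      (⟨szego (toL2 (F η)), szego_mem_hardy _⟩ : hardy) := by
    ext1
    have m1 := memLp_exp_mul η (toL2 f)
    have m2 : MemLp (fun x : ℝ => Complex.exp (-(Complex.I * η * x)) * (toL2 f : L2) x - f x) 2
        volume := m1.sub hf.memLp
    have e1 : toL2 (F η) = (Complex.I / η : ℂ) •
        (toL2 (fun x : ℝ => Complex.exp (-(Complex.I * η * x)) * (toL2 f : L2) x) - toL2 f) -
        toL2 k := by
      rw [← toL2_sub m1 hf.memLp, ← toL2_smul _ m2,
        ← toL2_sub (m2.const_mul _) hk.memLp]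
      refine toL2_congr ?_
      filter_upwards [coeFn_toL2 hf.memLp] with x hx
      simp only [hF, hx]
      ring
    change _ = szego (toL2 (F η))
    rw [e1, szego_sub, szego_smul, szego_sub, szego_eq_self hf.mem_hardy, szego_eq_self hk.mem_hardy]
    rfl
  rw [he]
  change ‖szego (toL2 (F η))‖ ≤ _
  refine (norm_szego_le _).trans (le_of_eq ?_)
  rw [toL2_of_memLp (hm η hη), Lp.norm_toLp]

theorem shiftAdj_kernel {b : ℂ} (hb : b.im < 0) {η : ℝ} (hη : 0 < η) :
    shiftAdj η (RatPlus.kernel hb).toHardy =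
      Complex.exp (-(Complex.I * η * b)) • (RatPlus.kernel hb).toHardy := by
  ext1
  set c : ℝ := -(η / (2 * Real.pi)) with hc
  obtain ⟨hm, hF⟩ := fourier_modulated_kernel hb c
  set φ : ℝ → ℂ := fun x => Complex.exp (2 * Real.pi * Complex.I * c * (x - b)) * kernel b x with hφ
  have h1 : szego (toL2 φ) = toL2 (kernel b) := by
    have h2 : (𝓕 (szego (toL2 φ)) : L2) = 𝓕 (toL2 (kernel b)) := by
      refine Lp.ext ?_
      filter_upwards [fourier_szego (toL2 φ), hF, fourier_kernel hb, ae_ne_zero] with ξ h3 h4 h5 h6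
      rw [h3, h4, h5]
      rcases lt_or_gt_of_ne h6 with h7 | h7
      · simp [szegoSymbol, not_le.2 h7, not_lt.2 h7.le]
      · have h8 : c < ξ := lt_trans (by rw [hc]; simp; positivity) h7
        simp [szegoSymbol, h7.le, h7, h8]
    have := congrArg (fun g : L2 => (𝓕⁻ g : L2)) h2
    simpa only [FourierTransform.fourierInv_fourier_eq] using this
  change szego (toL2 (fun x : ℝ => Complex.exp (-(Complex.I * η * x)) * (toL2 (kernel b) : L2) x)) =
    Complex.exp (-(Complex.I * η * b)) • toL2 (kernel b)
  rw [← h1, ← szego_smul, ← toL2_smul _ hm, h1]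
  congr 1
  refine toL2_congr ?_
  filter_upwards [coeFn_toL2 (memLp_kernel hb.ne)] with x hx
  rw [hx, hφ]
  simp only
  rw [← mul_assoc, ← Complex.exp_add]
  congr 2
  rw [hc]
  have : (Real.pi : ℂ) ≠ 0 := by simp [Real.pi_ne_zero]
  push_cast
  field_simp
  ring

/-- The kernels are eigenvectors of `G`. -/
theorem isGenerator_kernel {b : ℂ} (hb : b.im < 0) :
    IsGenerator (RatPlus.kernel hb).toHardy (b • (RatPlus.kernel hb).toHardy) := by
  have h := (tendsto_exp_quotient b).smul_const (RatPlus.kernel hb).toHardy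
  refine Tendsto.congr' ?_ h
  filter_upwards [self_mem_nhdsWithin] with η hη
  rw [shiftAdj_kernel hb hη, mul_smul, sub_smul, one_smul]

/-- `G f = x f - c`, where `c` is the limit of `x f(x)` at infinity. -/
theorem isGenerator_ratPlus {f k : ℝ → ℂ} {c : ℂ} (hf : RatPlus f) (hk : RatPlus k)
    (h : ∀ x : ℝ, x * f x = k x + c) : IsGenerator hf.toHardy hk.toHardy := by
  have hb : (-Complex.I).im < 0 := by simp
  have hK := RatPlus.kernel hb
  have h1 := isGenerator_of_mul_eq (hf.sub (hK.smul c)) (hk.sub (hK.smul (c * -Complex.I)))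
    (fun x => by
      have := ofReal_sub_ne_zero hb.ne x
      simp only [kernel]
      field_simp
      linear_combination (x + Complex.I) * h x)
  have h2 := h1.add ((isGenerator_kernel hb).smul c)
  have e1 : (hf.sub (hK.smul c)).toHardy + c • hK.toHardy = hf.toHardy := by
    ext1
    change toL2 (fun x => f x - c * kernel (-Complex.I) x) + c • toL2 (kernel (-Complex.I)) = toL2 f
    rw [toL2_sub hf.memLp (hK.smul c).memLp, toL2_smul c hK.memLp]
    abel
  have e2 : (hk.sub (hK.smul (c * -Complex.I))).toHardy + c • ((-Complex.I) • hK.toHardy) =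
      hk.toHardy := by
    ext1
    change toL2 (fun x => k x - c * -Complex.I * kernel (-Complex.I) x) +
      c • (-Complex.I) • toL2 (kernel (-Complex.I)) = toL2 k
    rw [toL2_sub hk.memLp (hK.smul _).memLp, toL2_smul _ hK.memLp, smul_smul]
    abel
  rwa [e1, e2] at h2

theorem genG_apply_eq {f g : hardy} (h : IsGenerator f g) (hf : f ∈ genG.domain) :
    genG ⟨f, hf⟩ = g :=
  tendsto_nhds_unique (Classical.choose_spec hf) h

theorem mem_genG_domain {f g : hardy} (h : IsGenerator f g) : f ∈ genG.domain := ⟨g, h⟩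

theorem genGApply_eq {f g : hardy} (h : IsGenerator f g) : genGApply f = g := by
  rw [genGApply, dif_pos (mem_genG_domain h), genG_apply_eq h]

theorem isResolvent_iff {z : ℂ} {f g : hardy} : IsResolvent z f g ↔ IsGenerator g (f + z • g) := by
  constructor
  · rintro ⟨h, e⟩
    have h1 : IsGenerator g (genG ⟨g, h⟩) := Classical.choose_spec h
    rwa [← e, sub_add_cancel]
  · intro h
    exact ⟨mem_genG_domain h, by rw [genG_apply_eq h]; abel⟩

/-- The weak form of `G f = x f - c`. -/
theorem IsGenerator.pairing_eq {f g : hardy} (h : IsGenerator f g) {m : ℝ → ℂ} (hm : RatPlus m)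
    (hxm : MemLp (fun x : ℝ => (x : ℂ) * m x) 2 volume) :
    pairing (g : L2) m = pairing (f : L2) (fun x => x * m x) := by
  have h1 : Tendsto (fun η : ℝ => inner ℂ (toL2 m)
      (((Complex.I / η : ℂ) • (shiftAdj η f - f) : hardy) : L2)) (𝓝[>] 0)
      (𝓝 (inner ℂ (toL2 m) (g : L2))) :=
    ((continuous_const.inner continuous_id).tendsto _).comp
      ((continuous_subtype_val.tendsto _).comp h)
  rw [inner_toL2_left _ hm.memLp] at h1
  refine tendsto_nhds_unique h1 ?_
  have h2 : ∀ η : ℝ, inner ℂ (toL2 m) (((Complex.I / η : ℂ) • (shiftAdj η f - f) : hardy) : L2) =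
      ∫ x : ℝ, Complex.I / η * (Complex.exp (-(Complex.I * η * x)) - 1) * ((f : L2) x *
        (starRingEnd ℂ) (m x)) := by
    intro η
    have m1 := memLp_exp_mul η (f : L2)
    change inner ℂ (toL2 m) ((Complex.I / η : ℂ) • (szego (toL2 fun x : ℝ =>
      Complex.exp (-(Complex.I * η * x)) * (f : L2) x) - (f : L2))) = _
    rw [inner_smul_right, inner_sub_right, inner_szego hm.mem_hardy, inner_toL2 m1 hm.memLp,
      inner_toL2_left _ hm.memLp, pairing, pairing, ← integral_sub (integrable_mul_conj m1 hm.memLp)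
      (integrable_mul_conj (Lp.memLp _) hm.memLp), ← integral_const_mul]
    congr 1
    funext x
    ring
  simp_rw [h2]
  have hint : Integrable fun x : ℝ => (f : L2) x * (starRingEnd ℂ) ((x : ℂ) * m x) :=
    integrable_mul_conj (Lp.memLp _) hxm
  refine tendsto_integral_filter_of_dominated_convergence
    (fun x : ℝ => ‖(f : L2) x * (starRingEnd ℂ) ((x : ℂ) * m x)‖) ?_ ?_ hint.norm ?_
  · refine Eventually.of_forall fun η => ?_
    exact (Continuous.aestronglyMeasurable (by fun_prop)).mul
      (integrable_mul_conj (Lp.memLp _) hm.memLp).1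
  · filter_upwards [self_mem_nhdsWithin] with η hη
    refine ae_of_all _ fun x => ?_
    have hη' : 0 < |η| := abs_pos.2 (ne_of_gt hη)
    have h3 : ‖Complex.I / η * (Complex.exp (-(Complex.I * η * x)) - 1)‖ ≤ |x| := by
      rw [norm_mul, norm_div, Complex.norm_I, Complex.norm_real, Real.norm_eq_abs]
      calc 1 / |η| * _ ≤ 1 / |η| * (|η| * |x|) := by
            gcongr; exact norm_exp_neg_I_sub_one_le η x
        _ = |x| := by field_simp
    rw [norm_mul]
    calc _ ≤ |x| * _ := mul_le_mul_of_nonneg_right h3 (norm_nonneg _)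
      _ = _ := by simp; ring
  · refine ae_of_all _ fun x => ?_
    have := (tendsto_exp_quotient x).mul_const ((f : L2) x * (starRingEnd ℂ) (m x))
    convert this using 2
    simp
    ring

/-- `G` has no eigenvalue in the closed upper half-plane. -/
theorem IsGenerator.eq_zero {g : hardy} {z : ℂ} (hz : 0 ≤ z.im) (h : IsGenerator g (z • g)) :
    g = 0 := by
  refine Subtype.ext (eq_zero_of_inner_kernel g.2 one_pos fun b hb => ?_)
  have hb' : b.im < 0 := by rw [hb]; norm_num
  rw [inner_toL2_left _ (memLp_kernel hb'.ne)]
  -- the test functions `k_b k_{b'}` with `b' = conj z - iε`, for which `(x - conj z) k_b k_{b'}`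
  -- converges to `k_b`
  set b' : ℝ → ℂ := fun ε => (starRingEnd ℂ) z - ε * Complex.I with hb'def
  have hbε : ∀ ε : ℝ, 0 < ε → (b' ε).im < 0 := fun ε hε => by
    simp [hb'def]; linarith
  have h1 : ∀ ε : ℝ, 0 < ε →
      ∫ x, (g : L2) x * (starRingEnd ℂ) (kernel b x) *
        (((x : ℂ) - z) * kernel ((starRingEnd ℂ) (b' ε)) x) = 0 := by
    intro ε hε
    have hm : RatPlus fun x => kernel (b' ε) x * kernel b x :=
      (RatPlus.kernel (hbε ε hε)).mul_kernel hb'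
    obtain ⟨C, hC⟩ := (RatPlus.kernel hb').bounded
    have hx : ∀ x : ℝ, (x : ℂ) * (kernel (b' ε) x * kernel b x) =
        kernel b x + b' ε * (kernel (b' ε) x * kernel b x) := fun x => by
      have := ofReal_sub_ne_zero (hbε ε hε).ne x
      simp only [kernel]
      field_simp
      ring
    have hxm : MemLp (fun x : ℝ => (x : ℂ) * (kernel (b' ε) x * kernel b x)) 2 volume := by
      rw [funext hx]
      exact ((RatPlus.kernel hb').add (hm.smul _)).memLp
    have h2 := h.pairing_eq hm hxm
    have h3 : pairing ((z • g : hardy) : L2) (fun x => kernel (b' ε) x * kernel b x) =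
        z * pairing (g : L2) (fun x => kernel (b' ε) x * kernel b x) := by
      rw [← inner_toL2_left _ hm.memLp, ← inner_toL2_left _ hm.memLp, Submodule.coe_smul,
        inner_smul_right]
    rw [h3, pairing, pairing, ← integral_const_mul, ← sub_eq_zero, ← integral_sub
      ((integrable_mul_conj (Lp.memLp _) hm.memLp).const_mul z)
      (integrable_mul_conj (Lp.memLp _) hxm)] at h2
    rw [← neg_eq_zero, ← integral_neg, ← h2]
    congr 1
    funext x
    simp only [map_mul, conj_kernel, Complex.conj_ofReal]
    ring
  have h4 : Tendsto (fun ε : ℝ => ∫ x, (g : L2) x * (starRingEnd ℂ) (kernel b x) *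
      (((x : ℂ) - z) * kernel ((starRingEnd ℂ) (b' ε)) x)) (𝓝[>] 0)
      (𝓝 (∫ x, (g : L2) x * (starRingEnd ℂ) (kernel b x))) := by
    have hi := integrable_mul_conj (Lp.memLp (g : L2)) (memLp_kernel hb'.ne)
    have hcε : ∀ ε, (starRingEnd ℂ) (b' ε) = z + ε * Complex.I := fun ε => by simp [hb'def]
    refine tendsto_integral_filter_of_dominated_convergence _ ?_ ?_ hi.norm ?_
    · filter_upwards [self_mem_nhdsWithin] with ε hε
      refine hi.1.mul (Continuous.aestronglyMeasurable ?_)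
      exact (by fun_prop : Continuous fun x : ℝ => (x : ℂ) - z).mul
        (continuous_kernel (by simpa using (hbε ε hε).ne))
    · filter_upwards [self_mem_nhdsWithin] with ε hε
      refine ae_of_all _ fun x => ?_
      rw [norm_mul]
      refine mul_le_of_le_one_right (norm_nonneg _) ?_
      have hε' : 0 < ε := hε
      rw [hcε, kernel, norm_mul, norm_inv]
      refine mul_inv_le_one_of_le₀ ?_ (norm_nonneg _)
      rw [Complex.norm_def, Complex.norm_def]
      refine Real.sqrt_le_sqrt ?_
      simp [Complex.normSq_apply]
      nlinarith
    · have : ∀ᵐ x : ℝ, x ≠ z.re := by simp [ae_iff]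
      filter_upwards [this] with x hx
      have hne : (x : ℂ) - z ≠ 0 := fun h0 => hx (by
        have := congrArg Complex.re h0
        simp at this
        linarith)
      have h5 : ContinuousAt (fun ε : ℝ => ((x : ℂ) - z) * kernel (z + ε * Complex.I) x) 0 := by
        refine continuousAt_const.mul (ContinuousAt.inv₀ (by fun_prop) ?_)
        simpa using hne
      have h6 := h5.tendsto.mono_left (nhdsWithin_le_nhds (s := Set.Ioi 0))
      have h7 := h6.const_mul ((g : L2) x * (starRingEnd ℂ) (kernel b x))
      simp only [hcε]
      convert h7 using 2
      simp [kernel, mul_inv_cancel₀ hne]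
  refine tendsto_nhds_unique (h4.congr' ?_) tendsto_const_nhds |>.trans rfl
  filter_upwards [self_mem_nhdsWithin] with ε hε using h1 ε hε

theorem IsResolvent.unique {z : ℂ} (hz : 0 ≤ z.im) {f g g' : hardy} (h : IsResolvent z f g)
    (h' : IsResolvent z f g') : g = g' := by
  rw [isResolvent_iff] at h h'
  have h1 := h.add (h'.smul (-1))
  have h2 : IsGenerator (g - g') (z • (g - g')) := by
    convert h1 using 1
    · simp [sub_eq_add_neg]
    · simp only [smul_add, smul_sub, neg_smul, one_smul]
      abel
  exact sub_eq_zero.1 (h2.eq_zero hz)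

/-! ### Quotients of polynomials -/

/-- A monic polynomial with all its roots in the lower half-plane. -/
def LowerRooted (Q : ℂ[X]) : Prop := Q.Monic ∧ ∀ z : ℂ, Q.IsRoot z → z.im < 0

/-- The polynomial with the conjugate coefficients. -/
def conjPoly (Q : ℂ[X]) : ℂ[X] := Q.map (starRingEnd ℂ)

theorem degree_C_mul_le' (c : ℂ) (P : ℂ[X]) : (C c * P).degree ≤ P.degree := by
  rw [← smul_eq_C_mul]
  exact degree_smul_le c P

theorem eval_conjPoly (Q : ℂ[X]) (x : ℝ) :
    (conjPoly Q).eval (x : ℂ) = (starRingEnd ℂ) (Q.eval (x : ℂ)) := by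
  have := Polynomial.eval_map_apply (f := starRingEnd ℂ) (p := Q) (x : ℂ)
  rw [Complex.conj_ofReal] at this
  exact this

theorem degree_conjPoly (Q : ℂ[X]) : (conjPoly Q).degree = Q.degree := Polynomial.degree_map _ _

theorem poly_eq_of_eval_real {P Q : ℂ[X]} (h : ∀ x : ℝ, P.eval (x : ℂ) = Q.eval (x : ℂ)) : P = Q := by
  refine Polynomial.eq_of_infinite_eval_eq P Q ?_
  refine Set.Infinite.mono (s := Set.range ((↑) : ℝ → ℂ)) ?_
    (Set.infinite_range_of_injective Complex.ofReal_injective)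
  rintro _ ⟨x, rfl⟩
  exact h x

namespace LowerRooted

theorem eval_ne_zero {Q : ℂ[X]} (hQ : LowerRooted Q) {z : ℂ} (hz : 0 ≤ z.im) : Q.eval z ≠ 0 :=
  fun h => absurd (hQ.2 z h) (not_lt.2 hz)

theorem eval_real_ne_zero {Q : ℂ[X]} (hQ : LowerRooted Q) (x : ℝ) : Q.eval (x : ℂ) ≠ 0 :=
  hQ.eval_ne_zero (by simp)

theorem conj_eval_real_ne_zero {Q : ℂ[X]} (hQ : LowerRooted Q) (x : ℝ) :
    (conjPoly Q).eval (x : ℂ) ≠ 0 := by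
  rw [eval_conjPoly]
  simpa using hQ.eval_real_ne_zero x

theorem mul {Q R : ℂ[X]} (hQ : LowerRooted Q) (hR : LowerRooted R) : LowerRooted (Q * R) := by
  refine ⟨hQ.1.mul hR.1, fun z hz => ?_⟩
  rcases Polynomial.root_mul.1 hz with h | h
  · exact hQ.2 z h
  · exact hR.2 z h

theorem X_sub_C {b : ℂ} (hb : b.im < 0) : LowerRooted (X - C b) := by
  refine ⟨monic_X_sub_C b, fun z hz => ?_⟩
  rw [Polynomial.root_X_sub_C] at hz
  rwa [← hz]

theorem exists_factor {Q : ℂ[X]} (hQ : LowerRooted Q) {n : ℕ} (hn : Q.natDegree = n + 1) :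
    ∃ (b : ℂ) (R : ℂ[X]), b.im < 0 ∧ LowerRooted R ∧ R.natDegree = n ∧ Q = (X - C b) * R := by
  obtain ⟨b, hb⟩ := IsAlgClosed.exists_root Q (by
    rw [Polynomial.degree_eq_natDegree hQ.1.ne_zero, hn]
    exact_mod_cast Nat.succ_ne_zero n)
  obtain ⟨R, rfl⟩ := Polynomial.dvd_iff_isRoot.2 hb
  have hR : R.Monic := (monic_X_sub_C b).of_mul_monic_left hQ.1
  refine ⟨b, R, hQ.2 b hb, ⟨hR, fun z hz => hQ.2 z ?_⟩, ?_, rfl⟩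
  · exact Polynomial.root_mul.2 (Or.inr hz)
  · rw [(monic_X_sub_C b).natDegree_mul hR, natDegree_X_sub_C] at hn
    omega

end LowerRooted

theorem RatPlus.one_div {n : ℕ} : ∀ {Q : ℂ[X]}, LowerRooted Q → Q.natDegree = n + 1 →
    RatPlus fun x => 1 / Q.eval (x : ℂ) := by
  induction n with
  | zero =>
    intro Q hQ hn
    obtain ⟨b, R, hb, hR, hRn, rfl⟩ := hQ.exists_factor hn
    have : R = 1 := hR.1.natDegree_eq_zero.1 hRn
    subst this
    exact (RatPlus.kernel hb).congr fun x => by simp [BenjaminOno.kernel]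
  | succ n ih =>
    intro Q hQ hn
    obtain ⟨b, R, hb, hR, hRn, rfl⟩ := hQ.exists_factor hn
    exact ((ih hR hRn).mul_kernel hb).congr fun x => by simp [BenjaminOno.kernel]

theorem RatPlus.of_poly_aux {n : ℕ} : ∀ {P Q : ℂ[X]}, LowerRooted Q → Q.natDegree = n →
    P.degree < Q.degree → RatPlus fun x => P.eval (x : ℂ) / Q.eval (x : ℂ) := by
  induction n with
  | zero =>
    intro P Q hQ hn hd
    have : Q = 1 := hQ.1.natDegree_eq_zero.1 hn
    subst this
    rw [degree_one, Nat.WithBot.lt_zero_iff, degree_eq_bot] at hd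
    subst hd
    simpa using RatPlus.zero
  | succ n ih =>
    intro P Q hQ hn hd
    have h1 := RatPlus.one_div hQ hn
    obtain ⟨b, R, hb, hR, hRn, rfl⟩ := hQ.exists_factor hn
    have hP := Polynomial.modByMonic_add_div P (X - C b)
    rw [Polynomial.modByMonic_X_sub_C_eq_C_eval] at hP
    have hd' : (P /ₘ (X - C b)).degree < R.degree := by
      rw [degree_eq_natDegree hR.1.ne_zero, hRn]
      by_cases h0 : P = 0
      · simp [h0]
      by_cases h3 : P.natDegree = 0
      · have : P /ₘ (X - C b) = 0 := by
          rw [divByMonic_eq_zero_iff (monic_X_sub_C b), degree_X_sub_C]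
          exact degree_le_natDegree.trans_lt (by rw [h3]; exact_mod_cast Nat.zero_lt_one)
        simp [this]
      · have h2 : P.natDegree < n + 1 := by
          rw [← hn]; exact natDegree_lt_natDegree h0 hd
        refine lt_of_le_of_lt (degree_le_natDegree) ?_
        rw [natDegree_divByMonic _ (monic_X_sub_C b), natDegree_X_sub_C]
        exact_mod_cast (by omega : P.natDegree - 1 < n)
    refine ((ih hR hRn hd').add (h1.smul (P.eval b))).congr fun x => ?_
    have e := congrArg (Polynomial.eval (x : ℂ)) hP
    simp only [eval_add, eval_C, eval_mul, eval_sub, eval_X] at e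
    have e1 := hR.eval_real_ne_zero x
    have e2 := ofReal_sub_ne_zero hb.ne x
    simp only [eval_mul, eval_sub, eval_X, eval_C]
    field_simp
    linear_combination -e

theorem RatPlus.of_poly {P Q : ℂ[X]} (hQ : LowerRooted Q) (h : P.degree < Q.degree) :
    RatPlus fun x => P.eval (x : ℂ) / Q.eval (x : ℂ) :=
  RatPlus.of_poly_aux hQ rfl h

theorem RatMinus.of_poly {P Q : ℂ[X]} (hQ : LowerRooted Q) (h : P.degree < Q.degree) :
    RatMinus fun x => P.eval (x : ℂ) / (conjPoly Q).eval (x : ℂ) :=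
  (RatPlus.of_poly hQ (P := conjPoly P) (by rwa [degree_conjPoly])).congr fun x => by
    simp [eval_conjPoly]

theorem RatPlus.exists_poly {f : ℝ → ℂ} (hf : RatPlus f) : ∃ P Q : ℂ[X], LowerRooted Q ∧
    P.degree < Q.degree ∧ ∀ x : ℝ, f x = P.eval (x : ℂ) / Q.eval (x : ℂ) := by
  induction hf with
  | @kernel b hb =>
    exact ⟨1, X - C b, .X_sub_C hb, by simp, fun x => by simp [BenjaminOno.kernel]⟩
  | add _ _ h1 h2 =>
    obtain ⟨P, Q, hQ, hd, h⟩ := h1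
    obtain ⟨P', Q', hQ', hd', h'⟩ := h2
    refine ⟨P * Q' + P' * Q, Q * Q', hQ.mul hQ', ?_, fun x => ?_⟩
    · rw [degree_mul]
      refine (degree_add_le _ _).trans_lt (max_lt ?_ ?_)
      · rw [degree_mul]
        exact WithBot.add_lt_add_right (degree_ne_bot.2 hQ'.1.ne_zero) hd
      · rw [degree_mul, add_comm]
        exact WithBot.add_lt_add_left (degree_ne_bot.2 hQ.1.ne_zero) hd'
    · have e1 := hQ.eval_real_ne_zero x
      have e2 := hQ'.eval_real_ne_zero x
      simp only [h, h', eval_add, eval_mul]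
      field_simp
  | smul c _ h1 =>
    obtain ⟨P, Q, hQ, hd, h⟩ := h1
    refine ⟨C c * P, Q, hQ, (degree_C_mul_le' c P).trans_lt hd, fun x => ?_⟩
    simp only [h, eval_mul, eval_C]
    ring
  | @mul_kernel b hb f _ h1 =>
    obtain ⟨P, Q, hQ, hd, h⟩ := h1
    refine ⟨P, Q * (X - C b), hQ.mul (.X_sub_C hb), hd.trans_le ?_, fun x => ?_⟩
    · rw [degree_mul, degree_X_sub_C, degree_eq_natDegree hQ.1.ne_zero]
      exact_mod_cast Nat.le_succ _
    · simp only [h, eval_mul, eval_sub, eval_X, eval_C, BenjaminOno.kernel]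
      rw [div_mul_eq_div_div, div_eq_mul_inv _ ((x : ℂ) - b)]

/-- The value at `a` of the holomorphic extension of `P / Q`. -/
theorem hardyEval_of_poly {P Q : ℂ[X]} (hQ : LowerRooted Q) (h : P.degree < Q.degree) {a : ℂ}
    (ha : 0 < a.im) :
    hardyEval (toL2 fun x : ℝ => P.eval (x : ℂ) / Q.eval (x : ℂ)) a = P.eval a / Q.eval a := by
  have hQa := hQ.eval_ne_zero ha.le
  obtain ⟨K, hK⟩ := Polynomial.dvd_iff_isRoot.2
    (show (P - C (P.eval a / Q.eval a) * Q).IsRoot a by simp [hQa])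
  have hd : K.degree < Q.degree := by
    have h1 : (P - C (P.eval a / Q.eval a) * Q).degree ≤ Q.degree :=
      (degree_sub_le _ _).trans (max_le h.le (degree_C_mul_le' _ _))
    rw [hK, degree_mul, degree_X_sub_C] at h1
    by_cases hK0 : K = 0
    · rw [hK0, degree_zero]
      exact bot_lt_iff_ne_bot.2 (degree_ne_bot.2 hQ.1.ne_zero)
    · rw [degree_eq_natDegree hK0, degree_eq_natDegree hQ.1.ne_zero] at h1 ⊢
      have : 1 + K.natDegree ≤ Q.natDegree := by exact_mod_cast h1
      exact_mod_cast (by omega : K.natDegree < Q.natDegree)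
  refine hardyEval_eq_of_sub (RatPlus.of_poly hQ h) (RatPlus.of_poly hQ hd) ha fun x => ?_
  have e := congrArg (Polynomial.eval (x : ℂ)) hK
  simp only [eval_mul, eval_sub, eval_X, eval_C] at e
  have e1 := hQ.eval_real_ne_zero x
  field_simp at e ⊢
  linear_combination e

/-! ### The model space of a polynomial -/

/-- The finite Blaschke product `conj(Q) / Q` on the real line. -/
def blaschke (Q : ℂ[X]) (x : ℝ) : ℂ := (conjPoly Q).eval (x : ℂ) / Q.eval (x : ℂ)

theorem LowerRooted.blaschke_sub_one {Q : ℂ[X]} (hQ : LowerRooted Q) :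
    RatPlus fun x => blaschke Q x - 1 := by
  have hd : (conjPoly Q - Q).degree < Q.degree := by
    have := degree_sub_lt_left (degree_conjPoly Q) ((Polynomial.map_ne_zero_iff
      (starRingEnd ℂ).injective).2 hQ.1.ne_zero) (by
      rw [hQ.1.leadingCoeff, conjPoly, (hQ.1.map _).leadingCoeff])
    rwa [degree_conjPoly] at this
  refine (RatPlus.of_poly hQ hd).congr fun x => ?_
  have := hQ.eval_real_ne_zero x
  simp only [blaschke, eval_sub]
  field_simp

theorem LowerRooted.blaschke_mul_conj {Q : ℂ[X]} (hQ : LowerRooted Q) (x : ℝ) :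
    blaschke Q x * (starRingEnd ℂ) (blaschke Q x) = 1 := by
  have h1 := hQ.eval_real_ne_zero x
  have h2 := hQ.conj_eval_real_ne_zero x
  rw [eval_conjPoly] at h2
  simp only [blaschke, eval_conjPoly, map_div₀, Complex.conj_conj]
  field_simp

theorem LowerRooted.conj_blaschke_sub_one {Q : ℂ[X]} (hQ : LowerRooted Q) :
    RatMinus fun x => (starRingEnd ℂ) (blaschke Q x) - 1 :=
  hQ.blaschke_sub_one.congr fun x => by simp

/-- `f` is a rational function in the model space `L²₊ ∩ (Θ L²₊)^⊥`, `Θ = conj(Q) / Q`. These are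
the quotients `P / Q` with `deg P < deg Q`. -/
def ModelMem (Q : ℂ[X]) (f : ℝ → ℂ) : Prop :=
  RatPlus f ∧ ∃ m, RatMinus m ∧ ∀ x, f x = blaschke Q x * m x

theorem modelMem_of_poly {P Q : ℂ[X]} (hQ : LowerRooted Q) (h : P.degree < Q.degree) :
    ModelMem Q fun x => P.eval (x : ℂ) / Q.eval (x : ℂ) := by
  refine ⟨RatPlus.of_poly hQ h, _, RatMinus.of_poly hQ h, fun x => ?_⟩
  have h1 := hQ.eval_real_ne_zero x
  have h2 := hQ.conj_eval_real_ne_zero x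
  rw [blaschke]
  field_simp

theorem ModelMem.exists_poly {Q : ℂ[X]} (hQ : LowerRooted Q) {f : ℝ → ℂ} (hf : ModelMem Q f) :
    ∃ P : ℂ[X], P.degree < Q.degree ∧ ∀ x : ℝ, f x = P.eval (x : ℂ) / Q.eval (x : ℂ) := by
  obtain ⟨hf, m, hm, hfm⟩ := hf
  obtain ⟨P₁, Q₁, hQ₁, hd₁, h₁⟩ := hf.exists_poly
  obtain ⟨P₂, Q₂, hQ₂, hd₂, h₂⟩ := RatPlus.exists_poly hm
  have key : P₁ * Q * conjPoly Q₂ = conjPoly Q * conjPoly P₂ * Q₁ := by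
    refine poly_eq_of_eval_real fun x => ?_
    have e1 := hQ₁.eval_real_ne_zero x
    have e2 := hQ₂.conj_eval_real_ne_zero x
    have e3 := hQ.eval_real_ne_zero x
    have e4 : m x = (conjPoly P₂).eval (x : ℂ) / (conjPoly Q₂).eval (x : ℂ) := by
      have := congrArg (starRingEnd ℂ) (h₂ x)
      simpa [eval_conjPoly] using this
    have e5 := hfm x
    rw [h₁, e4, blaschke] at e5
    simp only [eval_mul]
    field_simp at e5
    linear_combination e5
  have hcop : IsCoprime Q₁ (conjPoly Q₂) := by
    rw [Polynomial.isCoprime_iff_aeval_ne_zero_of_isAlgClosed ℂ ℂ]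
    intro z
    by_cases hz : 0 ≤ z.im
    · left
      simpa using hQ₁.eval_ne_zero hz
    · right
      have h3 : Q₂.eval ((starRingEnd ℂ) z) ≠ 0 := hQ₂.eval_ne_zero (by
        simp only [Complex.conj_im]; linarith)
      have h4 := Polynomial.eval_map_apply (f := starRingEnd ℂ) (p := Q₂) ((starRingEnd ℂ) z)
      rw [Complex.conj_conj] at h4
      rw [← Polynomial.coe_aeval_eq_eval] at h4
      rw [conjPoly, h4]
      simpa using h3
  have hdvd : Q₁ ∣ P₁ * Q := hcop.dvd_of_dvd_mul_right ⟨_, key.trans (mul_comm _ _)⟩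
  obtain ⟨P, hP⟩ := hdvd
  refine ⟨P, ?_, fun x => ?_⟩
  · by_contra hlt
    have h3 := congrArg Polynomial.degree hP
    rw [degree_mul, degree_mul] at h3
    have h4 : P₁.degree + Q.degree < Q₁.degree + P.degree :=
      (WithBot.add_lt_add_right (degree_ne_bot.2 hQ.1.ne_zero) hd₁).trans_le
        (add_le_add le_rfl (not_lt.1 hlt))
    exact absurd h3 h4.ne
  · have e1 := hQ₁.eval_real_ne_zero x
    have e3 := hQ.eval_real_ne_zero x
    have e := congrArg (Polynomial.eval (x : ℂ)) hP
    simp only [eval_mul] at e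
    rw [h₁]
    field_simp
    linear_combination e

namespace ModelMem

variable {Q : ℂ[X]} {f g k : ℝ → ℂ}

theorem congr (hf : ModelMem Q f) (h : ∀ x, g x = f x) : ModelMem Q g := by rwa [funext h]

theorem add (hf : ModelMem Q f) (hg : ModelMem Q g) : ModelMem Q fun x => f x + g x := by
  obtain ⟨hf, m, hm, h⟩ := hf
  obtain ⟨hg, m', hm', h'⟩ := hg
  exact ⟨hf.add hg, _, hm.add hm', fun x => by simp only [h, h']; ring⟩

theorem smul (c : ℂ) (hf : ModelMem Q f) : ModelMem Q fun x => c * f x := by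
  obtain ⟨hf, m, hm, h⟩ := hf
  exact ⟨hf.smul c, _, hm.smul c, fun x => by simp only [h]; ring⟩

/-- For `f = Θ m` in the model space, `f` and `m` have the same leading coefficient at infinity. -/
theorem exists_const (hQ : LowerRooted Q) (hf : ModelMem Q f) {c : ℂ} (hk : RatPlus k)
    (h : ∀ x : ℝ, x * f x = k x + c) :
    ∃ m l, RatMinus m ∧ RatMinus l ∧ (∀ x, f x = blaschke Q x * m x) ∧ ∀ x : ℝ, x * m x = l x + c := by
  obtain ⟨hf, m, hm, hfm⟩ := hf
  obtain ⟨c', l, hl, h1⟩ := hm.exists_const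
  have h2 : ∀ x, k x + c = (blaschke Q x - 1 + 1) * (l x + c') := fun x => by
    rw [← h, ← h1, hfm]; ring
  have t1 : Tendsto (fun x => k x + c) atTop (𝓝 (0 + c)) := hk.tendsto_zero.add_const c
  have t2 : Tendsto (fun x => k x + c) atTop (𝓝 ((0 + 1) * (0 + c'))) := by
    rw [funext h2]
    exact (hQ.blaschke_sub_one.tendsto_zero.add_const 1).mul (hl.tendsto_zero.add_const c')
  have := tendsto_nhds_unique t1 t2
  simp at this
  subst this
  exact ⟨m, l, hm, hl, hfm, h1⟩

/-- The model space is stable under `G`. -/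
theorem mul_sub_const (hQ : LowerRooted Q) (hf : ModelMem Q f) {c : ℂ} (hk : RatPlus k)
    (h : ∀ x : ℝ, x * f x = k x + c) : ModelMem Q k := by
  obtain ⟨m, l, hm, hl, hfm, h1⟩ := hf.exists_const hQ hk h
  refine ⟨hk, _, hl.add (hQ.conj_blaschke_sub_one.smul (-c)), fun x => ?_⟩
  have h2 := hQ.blaschke_mul_conj x
  linear_combination -h x + x * hfm x + blaschke Q x * h1 x + c * h2

/-- The pairing with `1 - Θ` reads off the leading coefficient at infinity. -/
theorem pairing_one_sub (hQ : LowerRooted Q) (hf : ModelMem Q f) {c : ℂ} (hk : RatPlus k)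
    (h : ∀ x : ℝ, x * f x = k x + c) :
    pairing f (fun x => 1 - blaschke Q x) = -(2 * Real.pi * Complex.I) * c := by
  obtain ⟨m, l, hm, hl, hfm, h1⟩ := hf.exists_const hQ hk h
  rw [← integral_add_ratMinus hf.1 hk hm.neg hl.neg h (fun x => by linear_combination -h1 x)]
  refine integral_congr_ae (ae_of_all _ fun x => ?_)
  have h2 := hQ.blaschke_mul_conj x
  simp only [map_sub, map_one]
  linear_combination -(starRingEnd ℂ) (blaschke Q x) * hfm x - m x * h2

end ModelMem

/-! ### Solitons and their polynomials -/

/-- The rational function `i Q' / Q`. -/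
def logDerivFn (Q : ℂ[X]) (x : ℝ) : ℂ :=
  Complex.I * (Polynomial.derivative Q).eval (x : ℂ) / Q.eval (x : ℂ)

/-- `Q` is a monic polynomial of degree `N`, with its roots in the lower half-plane, such that
`u = w + conj w` for `w = i Q' / Q`. -/
structure IsSolitonPoly (N : ℕ) (u : ℝ → ℝ) (Q : ℂ[X]) : Prop where
  lower : LowerRooted Q
  natDegree_eq : Q.natDegree = N
  eq : ∀ x, (u x : ℂ) = logDerivFn Q x + (starRingEnd ℂ) (logDerivFn Q x)

theorem logDerivFn_eq (Q : ℂ[X]) (x : ℝ) : logDerivFn Q x =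
    (C Complex.I * Polynomial.derivative Q).eval (x : ℂ) / Q.eval (x : ℂ) := by
  simp [logDerivFn]

theorem LowerRooted.degree_logDeriv {Q : ℂ[X]} (hQ : LowerRooted Q) :
    (C Complex.I * Polynomial.derivative Q).degree < Q.degree :=
  (degree_C_mul_le' _ _).trans_lt (degree_derivative_lt hQ.1.ne_zero)

theorem LowerRooted.modelMem_logDerivFn {Q : ℂ[X]} (hQ : LowerRooted Q) :
    ModelMem Q (logDerivFn Q) :=
  (modelMem_of_poly hQ hQ.degree_logDeriv).congr (logDerivFn_eq Q)

theorem LowerRooted.ratPlus_logDerivFn {Q : ℂ[X]} (hQ : LowerRooted Q) :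
    RatPlus (logDerivFn Q) := hQ.modelMem_logDerivFn.1

theorem IsSolitonPoly.isRealPartOf {N : ℕ} {u : ℝ → ℝ} {Q : ℂ[X]} (h : IsSolitonPoly N u Q) :
    IsRealPartOf u (logDerivFn Q) := ⟨h.lower.ratPlus_logDerivFn, h.eq⟩

theorem eval_derivative_prod {ι : Type*} (s : Finset ι) (b : ι → ℂ) (z : ℂ)
    (hz : ∀ i ∈ s, z - b i ≠ 0) : (derivative (∏ i ∈ s, (X - C (b i)))).eval z =
      (∏ i ∈ s, (X - C (b i))).eval z * ∑ i ∈ s, (z - b i)⁻¹ := by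
  classical
  induction s using Finset.induction_on with
  | empty => simp
  | insert i s hi ih =>
    rw [Finset.prod_insert hi, Finset.sum_insert hi, derivative_mul, eval_add, eval_mul, eval_mul,
      ih fun j hj => hz j (by simp [hj]), eval_mul]
    have := hz i (by simp)
    simp only [derivative_sub, derivative_X, derivative_C, sub_zero, eval_one, eval_sub, eval_X, eval_C]
    field_simp

/-- The polynomial with the roots `x_j - i / c_j`. -/
theorem exists_isSolitonPoly {N : ℕ} {u : ℝ → ℝ} (hu : u ∈ solitons N) :
    ∃ Q, IsSolitonPoly N u Q := by
  obtain ⟨c, y, hc, hu⟩ := hu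
  set b : Fin N → ℂ := fun j => y j - Complex.I / c j with hb
  have him : ∀ j, (b j).im < 0 := by
    intro j
    have h1 : b j = y j - ((1 / c j : ℝ) : ℂ) * Complex.I := by simp [hb]; ring
    rw [h1]
    simpa using hc j
  set Q : ℂ[X] := ∏ j, (X - C (b j)) with hQ
  have hlow : LowerRooted Q := by
    refine ⟨monic_prod_of_monic _ _ fun j _ => monic_X_sub_C _, fun z hz => ?_⟩
    rw [hQ, IsRoot.def, eval_prod, Finset.prod_eq_zero_iff] at hz
    obtain ⟨j, _, hj⟩ := hz
    simp only [eval_sub, eval_X, eval_C] at hj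
    rw [sub_eq_zero.1 hj]
    exact him j
  refine ⟨Q, hlow, ?_, fun x => ?_⟩
  · rw [hQ, natDegree_prod_of_monic _ _ fun j _ => monic_X_sub_C _]
    simp
  · have h1 : logDerivFn Q x = ∑ j, Complex.I * ((x : ℂ) - b j)⁻¹ := by
      rw [logDerivFn, hQ, eval_derivative_prod _ _ _ fun j _ => ofReal_sub_ne_zero (him j).ne x,
        ← hQ, ← Finset.mul_sum]
      have := hlow.eval_real_ne_zero x
      field_simp
    rw [h1, map_sum, ← Finset.sum_add_distrib, hu]
    push_cast
    refine Finset.sum_congr rfl fun j _ => ?_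
    have h2 := ofReal_sub_ne_zero (him j).ne x
    have h3 : (x : ℂ) - (starRingEnd ℂ) (b j) ≠ 0 :=
      ofReal_sub_ne_zero (by simpa using (him j).ne) x
    have h4 : (c j : ℂ) ≠ 0 := by exact_mod_cast (hc j).ne'
    have h5 : (1 + (c j * (x - y j)) ^ 2 : ℂ) =
        c j ^ 2 * ((x - b j) * (x - (starRingEnd ℂ) (b j))) := by
      simp only [hb, map_sub, map_div₀, Complex.conj_ofReal, Complex.conj_I]
      field_simp
      linear_combination Complex.I_sq
    simp only [profile, map_mul, map_inv₀, map_sub, Complex.conj_I, Complex.conj_ofReal]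
    push_cast
    rw [h5]
    field_simp
    simp only [hb, map_sub, map_div₀, Complex.conj_ofReal, Complex.conj_I]
    field_simp
    linear_combination 2 * Complex.I_sq

theorem hasDerivAt_poly_div {Q : ℂ[X]} (P : ℂ[X]) {x : ℝ} (hQ : Q.eval (x : ℂ) ≠ 0) :
    HasDerivAt (fun x : ℝ => P.eval (x : ℂ) / Q.eval (x : ℂ))
      (((derivative P).eval (x : ℂ) * Q.eval (x : ℂ) - P.eval (x : ℂ) * (derivative Q).eval (x : ℂ)) /
        Q.eval (x : ℂ) ^ 2) x :=
  ((P.hasDerivAt (x : ℂ)).comp_ofReal).div ((Q.hasDerivAt (x : ℂ)).comp_ofReal) hQ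

theorem derivative_conjPoly (Q : ℂ[X]) : derivative (conjPoly Q) = conjPoly (derivative Q) :=
  Polynomial.derivative_map Q (starRingEnd ℂ)

/-- `Θ' = i u Θ`, the identity that conjugates `L_u` on `Θ L²₊` to `D`. -/
theorem IsSolitonPoly.hasDerivAt_blaschke {N : ℕ} {u : ℝ → ℝ} {Q : ℂ[X]} (h : IsSolitonPoly N u Q)
    (x : ℝ) : HasDerivAt (blaschke Q) (Complex.I * u x * blaschke Q x) x := by
  refine (hasDerivAt_poly_div (conjPoly Q) (h.lower.eval_real_ne_zero x)).congr_deriv ?_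
  have h1 := h.lower.eval_real_ne_zero x
  have h2 := h.lower.conj_eval_real_ne_zero x
  rw [h.eq, blaschke, derivative_conjPoly, eval_conjPoly (derivative Q)]
  rw [eval_conjPoly] at h2 ⊢
  simp only [logDerivFn, map_div₀, map_mul, Complex.conj_I]
  field_simp
  linear_combination (-(starRingEnd ℂ) (Q.eval (x : ℂ)) * (derivative Q).eval (x : ℂ) +
    Q.eval (x : ℂ) * (starRingEnd ℂ) ((derivative Q).eval (x : ℂ))) * Complex.I_sq

/-- The model space is stable under `L_u`. -/
theorem ModelMem.laxRel {N : ℕ} {u : ℝ → ℝ} {Q : ℂ[X]} (h : IsSolitonPoly N u Q) {f g β : ℝ → ℂ}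
    (hf : ModelMem Q f) (hL : LaxRel u f g β) : ModelMem Q g := by
  obtain ⟨hf, m, hm, hfm⟩ := hf
  refine ⟨hL.right, _, ((hm.deriv.smul (-Complex.I)).add hL.rem).add
    (hL.rem.mul h.lower.conj_blaschke_sub_one), fun x => ?_⟩
  have h1 : HasDerivAt f (Complex.I * u x * blaschke Q x * m x + blaschke Q x * deriv m x) x := by
    rw [funext hfm]
    exact (h.hasDerivAt_blaschke x).mul (hm.hasDerivAt x)
  have h2 := h.lower.blaschke_mul_conj x
  rw [hL.eq, h1.deriv, hfm]
  linear_combination -β x * h2 - (u x * blaschke Q x * m x) * Complex.I_sq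

/-- The model space `L²₊ ∩ (Θ L²₊)^⊥` of `Θ = conj(Q) / Q`. -/
def modelSpace (Q : ℂ[X]) : Submodule ℂ hardy where
  carrier := {h | ∃ f, ModelMem Q f ∧ (h : L2) = toL2 f}
  add_mem' := by
    rintro a b ⟨f, hf, h⟩ ⟨f', hf', h'⟩
    refine ⟨_, hf.add hf', ?_⟩
    rw [toL2_add hf.1.memLp hf'.1.memLp, Submodule.coe_add, h, h']
  zero_mem' := ⟨fun _ => 0, ⟨RatPlus.zero, fun _ => 0, RatMinus.zero, fun x => by simp⟩, by
    rw [toL2_of_memLp RatPlus.zero.memLp]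
    exact (MemLp.toLp_zero _).symm⟩
  smul_mem' := by
    rintro c a ⟨f, hf, h⟩
    exact ⟨_, hf.smul c, by rw [toL2_smul c hf.1.memLp, Submodule.coe_smul, h]⟩

theorem RatPlus.eq_of_toL2_eq {f g : ℝ → ℂ} (hf : RatPlus f) (hg : RatPlus g)
    (h : toL2 f = toL2 g) : f = g := by
  have h1 := coeFn_toL2 hf.memLp
  rw [h] at h1
  exact hf.eq_of_ae_eq hg (h1.symm.trans (coeFn_toL2 hg.memLp))

/-- The parametrisation `P ↦ P / Q` of the model space by polynomials. -/
def modelParam (Q : ℂ[X]) (hQ : LowerRooted Q) : degreeLT ℂ Q.natDegree →ₗ[ℂ] hardy where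
  toFun P := (RatPlus.of_poly hQ (P := P) (by
    rw [degree_eq_natDegree hQ.1.ne_zero]; exact mem_degreeLT.1 P.2)).toHardy
  map_add' P P' := by
    ext1
    have h1 : ∀ P : degreeLT ℂ Q.natDegree, (P : ℂ[X]).degree < Q.degree := fun P => by
      rw [degree_eq_natDegree hQ.1.ne_zero]; exact mem_degreeLT.1 P.2
    simp only [Submodule.coe_add, RatPlus.coe_toHardy]
    rw [← toL2_add (RatPlus.of_poly hQ (h1 P)).memLp (RatPlus.of_poly hQ (h1 P')).memLp]
    congr 1
    funext x
    rw [eval_add, add_div]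
  map_smul' c P := by
    ext1
    have h1 : ∀ P : degreeLT ℂ Q.natDegree, (P : ℂ[X]).degree < Q.degree := fun P => by
      rw [degree_eq_natDegree hQ.1.ne_zero]; exact mem_degreeLT.1 P.2
    simp only [Submodule.coe_smul, RatPlus.coe_toHardy, RingHom.id_apply]
    rw [← toL2_smul c (RatPlus.of_poly hQ (h1 P)).memLp]
    congr 1
    funext x
    rw [eval_smul, smul_eq_mul, mul_div_assoc]

theorem modelParam_injective {Q : ℂ[X]} (hQ : LowerRooted Q) :
    Function.Injective (modelParam Q hQ) := by
  intro P P' h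
  have h1 : ∀ P : degreeLT ℂ Q.natDegree, (P : ℂ[X]).degree < Q.degree := fun P => by
    rw [degree_eq_natDegree hQ.1.ne_zero]; exact mem_degreeLT.1 P.2
  have h2 := RatPlus.eq_of_toL2_eq (RatPlus.of_poly hQ (h1 P)) (RatPlus.of_poly hQ (h1 P'))
    (congrArg Subtype.val h)
  refine Subtype.ext (poly_eq_of_eval_real fun x => ?_)
  have h3 := congrFun h2 x
  exact (div_left_inj' (hQ.eval_real_ne_zero x)).1 h3

theorem range_modelParam {Q : ℂ[X]} (hQ : LowerRooted Q) :
    LinearMap.range (modelParam Q hQ) = modelSpace Q := by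
  refine le_antisymm ?_ ?_
  · rintro _ ⟨P, rfl⟩
    exact ⟨_, modelMem_of_poly hQ (by
      rw [degree_eq_natDegree hQ.1.ne_zero]; exact mem_degreeLT.1 P.2), rfl⟩
  · rintro h ⟨f, hf, e⟩
    obtain ⟨P, hP, hfP⟩ := hf.exists_poly hQ
    refine ⟨⟨P, mem_degreeLT.2 (by rwa [← degree_eq_natDegree hQ.1.ne_zero])⟩, ?_⟩
    ext1
    rw [e, funext hfP]
    rfl

instance instFiniteDegreeLT (n : ℕ) : FiniteDimensional ℂ (degreeLT ℂ n) :=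
  (degreeLTEquiv ℂ n).symm.finiteDimensional

theorem finiteDimensional_modelSpace {Q : ℂ[X]} (hQ : LowerRooted Q) :
    FiniteDimensional ℂ (modelSpace Q) := by
  rw [← range_modelParam hQ]
  infer_instance

theorem finrank_modelSpace {Q : ℂ[X]} (hQ : LowerRooted Q) :
    Module.finrank ℂ (modelSpace Q) = Q.natDegree := by
  rw [← range_modelParam hQ, LinearMap.finrank_range_of_inj (modelParam_injective hQ),
    (degreeLTEquiv ℂ Q.natDegree).finrank_eq]
  simp

/-! ### Eigenvectors of `L_u` -/

theorem mem_laxEigenspace {u : L2} {lam : ℝ} {φ : hardy} : φ ∈ laxEigenspace u lam ↔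
    ∃ h : φ ∈ sobolevOne, laxOp u ⟨φ, h⟩ = (lam : ℂ) • φ := by
  simp only [laxEigenspace, Submodule.mem_map, LinearMap.mem_ker]
  constructor
  · rintro ⟨v, hv, rfl⟩
    refine ⟨v.2, ?_⟩
    have : laxOp u v - (lam : ℂ) • (v : hardy) = 0 := hv
    exact sub_eq_zero.1 this
  · rintro ⟨h, e⟩
    refine ⟨⟨φ, h⟩, ?_, rfl⟩
    change laxOp u ⟨φ, h⟩ - (lam : ℂ) • φ = 0
    rw [e, sub_self]

theorem pairing_multiplier {φ : hardy} (hφ : φ ∈ sobolevOne) {q : ℝ → ℂ} (hq : RatPlus q) :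
    inner ℂ (toL2 q) (multiplier (fun ξ : ℝ => ((2 * Real.pi * ξ : ℝ) : ℂ)) (φ : L2)) =
      pairing (φ : L2) (fun x => -Complex.I * deriv q x) := by
  rw [inner_fourier, ← inner_toL2_left _ (hq.deriv.smul (-Complex.I)).memLp, inner_fourier,
    multiplier, FourierTransform.fourier_fourierInv_eq]
  refine integral_congr_ae ?_
  filter_upwards [coeFn_toL2 hφ, fourier_deriv_ratPlus hq] with ξ h1 h2
  rw [h1, ← h2, map_mul, Complex.conj_ofReal]
  ring

/-- The operator `D` has no eigenvector in `L²₊`, in a weak form in which the eigenvalue equation is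
tested on kernels. -/
theorem eq_zero_of_weak_eigenvector {h : L2} (hh : h ∈ hardy) (lam : ℝ)
    (hw : ∀ b : ℂ, b.im < 0 → pairing h (fun x => -Complex.I * deriv (kernel b) x) =
      lam * pairing h (kernel b)) : h = 0 := by
  have key := ae_eq_zero_of_laplace (m := fun ξ : ℝ => ((2 * Real.pi * ξ - lam : ℝ) : ℂ))
    (by fun_prop) (C := 2 + |lam|) (s := 1) (δ := Real.pi) Real.pi_pos (fun ξ hξ => by
      have e1 : (-(2 * (Real.pi : ℂ) * (1 : ℝ)) * ξ) = ((-(2 * Real.pi) : ℝ) : ℂ) * ξ := by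
        push_cast; ring
      rw [e1, norm_mul, norm_exp_mul_ofReal, Complex.norm_real, Complex.ofReal_re, Real.norm_eq_abs]
      have h1 : |2 * Real.pi * ξ - lam| ≤ 2 * (Real.pi * ξ) + |lam| := by
        refine (abs_sub _ _).trans ?_
        rw [abs_of_pos (by positivity)]
        linarith
      have h2 : Real.pi * ξ + 1 ≤ Real.exp (Real.pi * ξ) := Real.add_one_le_exp _
      have h3 : 1 ≤ Real.exp (Real.pi * ξ) := Real.one_le_exp (by positivity)
      have h4 : |2 * Real.pi * ξ - lam| ≤ (2 + |lam|) * Real.exp (Real.pi * ξ) := by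
        nlinarith [abs_nonneg lam]
      calc _ ≤ (2 + |lam|) * Real.exp (Real.pi * ξ) * Real.exp (-(2 * Real.pi) * ξ) := by gcongr
        _ = _ := by
          rw [mul_assoc, ← Real.exp_add]
          congr 2
          ring) (𝓕 h) (fun x => by
    set a : ℂ := x + (1 : ℝ) * Complex.I with ha
    have hb : ((starRingEnd ℂ) a).im < 0 := by simp [ha]
    have h1 := hw _ hb
    have hk := RatPlus.kernel hb
    rw [← inner_toL2_left _ (hk.deriv.smul (-Complex.I)).memLp, ← inner_toL2_left _ hk.memLp,
      inner_fourier, inner_fourier, pairing, pairing, ← integral_const_mul, ← sub_eq_zero,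
      ← integral_sub (integrable_mul_conj (Lp.memLp _) (Lp.memLp _))
      ((integrable_mul_conj (Lp.memLp _) (Lp.memLp _)).const_mul _)] at h1
    have h2 : ∫ ξ in Set.Ioi (0 : ℝ), (2 * Real.pi * Complex.I) *
        (Complex.exp (2 * Real.pi * Complex.I * a * ξ) *
          (((2 * Real.pi * ξ - lam : ℝ) : ℂ) * (𝓕 h : L2) ξ)) = 0 := by
      rw [← h1, ← integral_indicator measurableSet_Ioi]
      refine integral_congr_ae ?_
      filter_upwards [fourier_kernel hb, fourier_deriv_ratPlus hk] with ξ h3 h4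
      rw [← h4, h3]
      by_cases hξ : ξ ∈ Set.Ioi (0 : ℝ)
      · simp only [Set.indicator_of_mem hξ, map_mul, map_neg, ← Complex.exp_conj,
          Complex.conj_ofReal, Complex.conj_I, Complex.conj_conj, map_ofNat]
        have : -(2 * (Real.pi : ℂ) * -Complex.I * a) * ξ = 2 * Real.pi * Complex.I * a * ξ := by ring
        rw [this]
        push_cast
        ring
      · simp [hξ]
    rw [integral_const_mul] at h2
    exact (mul_eq_zero.1 h2).resolve_left two_pi_I_ne_zero)
  refine eq_zero_of_fourier_pos hh ?_
  have hne : ∀ᵐ ξ : ℝ, ξ ≠ lam / (2 * Real.pi) := by simp [ae_iff]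
  filter_upwards [key, hne] with ξ h1 h2 h3
  refine (mul_eq_zero.1 (h1 h3)).resolve_left fun h0 => h2 ?_
  have h4 : 2 * Real.pi * ξ - lam = 0 := by exact_mod_cast h0
  field_simp
  linarith

theorem LowerRooted.continuous_blaschke {Q : ℂ[X]} (hQ : LowerRooted Q) :
    Continuous (blaschke Q) :=
  (hQ.blaschke_sub_one.continuous.add (continuous_const (y := (1 : ℂ)))).congr fun x => by simp

/-- The eigenvectors of `L_u` are in the model space: on `Θ L²₊` the operator `L_u` is unitarily
equivalent to `D`, which has no eigenvalue. -/
theorem laxEigenspace_le_modelSpace {N : ℕ} {u : ℝ → ℝ} {Q : ℂ[X]} (hu : IsSolitonPoly N u Q)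
    (lam : ℝ) : laxEigenspace (cls u) lam ≤ modelSpace Q := by
  intro φ hφ
  obtain ⟨hs, he⟩ := mem_laxEigenspace.1 hφ
  have he' : laxApply (cls u) (φ : L2) = (lam : ℂ) • (φ : L2) := congrArg Subtype.val he
  have hΘ := hu.lower.blaschke_sub_one
  have hΘ' := hu.lower.conj_blaschke_sub_one
  have hc : Continuous fun x => (starRingEnd ℂ) (blaschke Q x) :=
    Complex.continuous_conj.comp hu.lower.continuous_blaschke
  have hC : ∀ x, ‖(starRingEnd ℂ) (blaschke Q x)‖ ≤ 1 := fun x => by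
    have h1 := hu.lower.blaschke_mul_conj x
    rw [Complex.mul_conj] at h1
    have h2 : Complex.normSq (blaschke Q x) = 1 := by exact_mod_cast h1
    rw [Complex.normSq_eq_norm_sq] at h2
    rw [RCLike.norm_conj]
    nlinarith [norm_nonneg (blaschke Q x)]
  have hmem := memLp_mul_bounded hc hC (Lp.memLp (φ : L2))
  set h : L2 := szego (toL2 fun x => (φ : L2) x * (starRingEnd ℂ) (blaschke Q x)) with hdef
  -- moving `Θ` from the second argument of the pairing to the first one
  have move : ∀ k : ℝ → ℂ, RatPlus k → pairing h k = pairing (φ : L2) fun x => blaschke Q x * k x := by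
    intro k hk
    rw [← inner_toL2_left _ hk.memLp, hdef, inner_szego hk.mem_hardy, inner_toL2 hmem hk.memLp]
    refine integral_congr_ae (ae_of_all _ fun x => ?_)
    simp only [map_mul]
    ring
  have hh0 : h = 0 := by
    refine eq_zero_of_weak_eigenvector (szego_mem_hardy _) lam fun b hb => ?_
    have hk := RatPlus.kernel hb
    have hq : RatPlus fun x => blaschke Q x * kernel b x :=
      (hk.add (hΘ.mul hk)).congr fun x => by ring
    have hd : ∀ x, deriv (fun x => blaschke Q x * kernel b x) x =
        Complex.I * u x * blaschke Q x * kernel b x + blaschke Q x * deriv (kernel b) x := fun x =>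
      ((hu.hasDerivAt_blaschke x).mul (hk.hasDerivAt x)).deriv
    have h1 := congrArg (fun v => inner ℂ (toL2 fun x => blaschke Q x * kernel b x) v) he'
    have m1 : MemLp (fun x => (cls u : L2) x * (φ : L2) x) 2 volume := memLp_mul_of_mem_sobolevOne _ hs
    obtain ⟨D, hD⟩ := hq.bounded
    have m2 : MemLp (fun x => (u x : ℂ) * (blaschke Q x * kernel b x)) 2 volume :=
      memLp_mul_bounded hq.continuous hD hu.isRealPartOf.memLp
    simp only [laxApply, inner_sub_right, inner_smul_right] at h1
    rw [pairing_multiplier hs hq, inner_szego hq.mem_hardy, inner_toL2 m1 hq.memLp,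
      inner_toL2_left _ hq.memLp, ← move _ hk] at h1
    have h2 : pairing (fun x => (cls u : L2) x * (φ : L2) x) (fun x => blaschke Q x * kernel b x) =
        pairing (φ : L2) (fun x => (u x : ℂ) * (blaschke Q x * kernel b x)) := by
      refine integral_congr_ae ?_
      filter_upwards [hu.isRealPartOf.cls_ae] with x hx
      rw [hx, map_mul _ (u x : ℂ), Complex.conj_ofReal]
      ring
    rw [← h1, h2, move _ (hk.deriv.smul (-Complex.I)), pairing, pairing, pairing, ← integral_sub
      (integrable_mul_conj (Lp.memLp _) (hq.deriv.smul (-Complex.I)).memLp)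
      (integrable_mul_conj (Lp.memLp _) m2)]
    refine integral_congr_ae (ae_of_all _ fun x => ?_)
    simp only [hd, ← mul_sub, ← map_sub]
    congr 2
    linear_combination u x * blaschke Q x * kernel b x * Complex.I_sq
  obtain ⟨p, q, hp, hq, hpq⟩ := exists_mul_ratMinus φ.2 hΘ'
  have e1 : toL2 (fun x => (φ : L2) x * (starRingEnd ℂ) (blaschke Q x)) = ((φ : L2) + p) + toL2 q := by
    rw [← toL2_coe ((φ : L2) + p), ← toL2_add (Lp.memLp _) hq.memLp]
    refine toL2_congr ?_
    filter_upwards [hpq, Lp.coeFn_add (φ : L2) p] with x h1 h2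
    rw [h2, Pi.add_apply]
    linear_combination h1
  have e2 : (φ : L2) + p = 0 := by
    rw [← hh0, hdef]
    exact (eq_szego_of_add hq.mem_hardyOrthogonal (hardy.add_mem φ.2 hp) e1).symm
  obtain ⟨p', q', hp', hq', hpq'⟩ := hΘ.mul_ratMinus hq
  have e3 : (φ : L2) =ᵐ[volume] fun x => blaschke Q x * q x := by
    have h3 := Lp.coeFn_add (φ : L2) p
    rw [e2] at h3
    filter_upwards [hpq, h3, Lp.coeFn_zero ℂ 2 (volume : Measure ℝ)] with x h1 h2 h4
    rw [h4, Pi.add_apply, Pi.zero_apply] at h2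
    linear_combination -(φ : L2) x * hu.lower.blaschke_mul_conj x + blaschke Q x * (h1 - h2)
  have e4 : (φ : L2) = toL2 p' + toL2 (fun x => q x + q' x) := by
    rw [← toL2_add hp'.memLp (hq.add hq').memLp, ← toL2_coe (φ : L2)]
    refine toL2_congr (e3.trans (ae_of_all _ fun x => ?_))
    linear_combination hpq' x
  have e5 : (φ : L2) = toL2 p' := by
    rw [← szego_eq_self φ.2]
    exact eq_szego_of_add (hq.add hq').mem_hardyOrthogonal hp'.mem_hardy e4
  refine ⟨p', ⟨hp', q, hq, ?_⟩, e5⟩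
  have hcont : Continuous fun x => blaschke Q x * q x :=
    hu.lower.continuous_blaschke.mul hq.continuous
  refine congrFun ((hp'.continuous.ae_eq_iff_eq volume hcont).1 ?_)
  refine (coeFn_toL2 hp'.memLp).symm.trans ?_
  rw [← e5]
  exact e3

/-! ### Spectral data -/

theorem RatPlus.toHardy_mem_modelSpace {Q : ℂ[X]} {f : ℝ → ℂ} (hf : RatPlus f)
    (hm : ModelMem Q f) : hf.toHardy ∈ modelSpace Q := ⟨f, hm, rfl⟩

section Model

variable {N : ℕ} {u : ℝ → ℝ} {Q : ℂ[X]}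

theorem IsSolitonPoly.exists_of_mem_modelSpace (hu : IsSolitonPoly N u Q) {v : hardy}
    (hv : v ∈ modelSpace Q) : ∃ f g β, ∃ h : LaxRel u f g β, ModelMem Q f ∧ ModelMem Q g ∧
      v = h.left.toHardy := by
  obtain ⟨f, hf, e⟩ := hv
  obtain ⟨g, β, h⟩ := hu.isRealPartOf.exists_laxRel hf.1
  exact ⟨f, g, β, h, hf, hf.laxRel hu h, Subtype.ext e⟩

theorem IsSolitonPoly.modelSpace_le_sobolevOne (hu : IsSolitonPoly N u Q) :
    modelSpace Q ≤ sobolevOne := fun v hv => by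
  obtain ⟨f, g, β, h, -, -, rfl⟩ := hu.exists_of_mem_modelSpace hv
  exact h.left.toHardy_mem_sobolevOne

/-- The restriction of `L_u` to the model space. -/
def laxModel (hu : IsSolitonPoly N u Q) : modelSpace Q →ₗ[ℂ] modelSpace Q :=
  ((laxOp (cls u)).toFun ∘ₗ Submodule.inclusion
    (show modelSpace Q ≤ (laxOp (cls u)).domain from hu.modelSpace_le_sobolevOne)).codRestrict
    (modelSpace Q) (fun v => by
      obtain ⟨f, g, β, h, -, hg, hv⟩ := hu.exists_of_mem_modelSpace v.2
      have h1 := h.laxOp_eq hu.isRealPartOf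
      rw [LinearMap.comp_apply, show Submodule.inclusion _ v = (⟨h.left.toHardy,
        h.left.toHardy_mem_sobolevOne⟩ : (laxOp (cls u)).domain) from Subtype.ext hv]
      change laxOp (cls u) ⟨h.left.toHardy, h.left.toHardy_mem_sobolevOne⟩ ∈ modelSpace Q
      rw [h1]
      exact h.right.toHardy_mem_modelSpace hg)

theorem coe_laxModel (hu : IsSolitonPoly N u Q) {f g β : ℝ → ℂ} (h : LaxRel u f g β)
    (v : modelSpace Q) (hv : (v : hardy) = h.left.toHardy) :
    (laxModel hu v : hardy) = h.right.toHardy := by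
  rw [← h.laxOp_eq hu.isRealPartOf]
  exact congrArg (laxOp (cls u)).toFun (Subtype.ext hv)

theorem isSymmetric_laxModel (hu : IsSolitonPoly N u Q) (v v' : modelSpace Q) :
    inner ℂ (laxModel hu v : hardy) (v' : hardy) = inner ℂ (v : hardy) (laxModel hu v' : hardy) := by
  obtain ⟨f, g, β, h, -, -, hv⟩ := hu.exists_of_mem_modelSpace v.2
  obtain ⟨f', g', β', h', -, -, hv'⟩ := hu.exists_of_mem_modelSpace v'.2
  change inner ℂ (((laxModel hu v : modelSpace Q) : hardy) : L2) ((v' : hardy) : L2) =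
    inner ℂ ((v : hardy) : L2) (((laxModel hu v' : modelSpace Q) : hardy) : L2)
  rw [coe_laxModel hu h v hv, coe_laxModel hu h' v' hv', hv, hv']
  simp only [RatPlus.coe_toHardy]
  rw [inner_toL2 h'.left.memLp h.right.memLp, inner_toL2 h'.right.memLp h.left.memLp]
  exact (h'.symm hu.isRealPartOf h).symm

theorem mem_laxEigenspace_toHardy {f g β : ℝ → ℂ} {w : ℝ → ℂ} (hw : IsRealPartOf u w)
    (h : LaxRel u f g β) {lam : ℝ} :
    h.left.toHardy ∈ laxEigenspace (cls u) lam ↔ ∀ x, g x = lam * f x := by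
  rw [mem_laxEigenspace]
  constructor
  · rintro ⟨hs, e⟩
    rw [h.laxOp_eq hw] at e
    have e1 := congrArg Subtype.val e
    simp only [Submodule.coe_smul, RatPlus.coe_toHardy] at e1
    rw [← toL2_smul _ h.left.memLp] at e1
    exact congrFun (h.right.eq_of_toL2_eq (h.left.smul _) e1)
  · intro e
    refine ⟨h.left.toHardy_mem_sobolevOne, ?_⟩
    rw [h.laxOp_eq hw]
    refine Subtype.ext ?_
    simp only [Submodule.coe_smul, RatPlus.coe_toHardy]
    rw [← toL2_smul _ h.left.memLp]
    exact congrArg toL2 (funext e)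

/-- `f` is a rational eigenfunction of `L_u`, and `x f = k + c`. -/
structure EigenFn (u : ℝ → ℝ) (lam : ℝ) (f k : ℝ → ℂ) (c : ℂ) : Prop where
  lax : ∃ β, LaxRel u f (fun x => lam * f x) β
  gen : RatPlus k
  eq : ∀ x : ℝ, x * f x = k x + c

namespace EigenFn

variable {w f k f' k' : ℝ → ℂ} {c c' : ℂ} {lam mu : ℝ}

theorem ratPlus (h : EigenFn u lam f k c) : RatPlus f := h.lax.choose_spec.left

theorem integral_eq (hw : IsRealPartOf u w) (h : EigenFn u lam f k c) :
    ∫ x, (u x : ℂ) * f x = 2 * Real.pi * Complex.I * (lam * c) := by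
  obtain ⟨β, hl⟩ := h.lax
  exact hl.integral_mul_eq hw (h.gen.smul lam) fun x => by linear_combination (lam : ℂ) * h.eq x

theorem pairing_realPart (hw : IsRealPartOf u w) (h : EigenFn u lam f k c) :
    pairing f w = 2 * Real.pi * Complex.I * (lam * c) := by
  have h1 := h.ratPlus.integral_mul hw.1
  have h2 : ∫ x, (u x : ℂ) * f x = (∫ x, f x * w x) + pairing f w := by
    rw [pairing, ← integral_add (integrable_mul_of_memLp h.ratPlus.memLp hw.1.memLp)
      (integrable_mul_conj h.ratPlus.memLp hw.1.memLp)]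
    congr 1
    funext x
    rw [hw.2]
    ring
  rw [← h.integral_eq hw, h2, h1, zero_add]

/-- The matrix elements of `G` between eigenfunctions, from the commutation relation
`[L_u, G] f = -i f + c(f) Π u`. -/
theorem sub_mul_pairing (hw : IsRealPartOf u w) (h : EigenFn u lam f k c)
    (h' : EigenFn u mu f' k' c') : (lam - mu) * pairing k f' =
      Complex.I * pairing f f' + 2 * Real.pi * Complex.I * (mu * (c * (starRingEnd ℂ) c')) := by
  obtain ⟨β, hl⟩ := h.lax
  obtain ⟨β', hl'⟩ := h'.lax
  obtain ⟨γ, hk⟩ := hl.commutator hw h.gen h.eq (h.gen.smul lam)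
    (c' := lam * c) fun x => by linear_combination (lam : ℂ) * h.eq x
  have h1 := hk.symm hw hl'
  have h2 : pairing (fun x => lam * k x + -Complex.I * f x + c * w x) f' =
      lam * pairing k f' + -Complex.I * pairing f f' + c * pairing w f' := by
    have e1 := pairing_comb_left 1 c ((h.gen.smul lam).add (h.ratPlus.smul (-Complex.I))).memLp
      hw.1.memLp h'.ratPlus.memLp
    have e2 := pairing_comb_left lam (-Complex.I) h.gen.memLp h.ratPlus.memLp h'.ratPlus.memLp
    simp only [one_mul] at e1
    rw [e1, e2]
  have h3 : pairing k (fun x => mu * f' x) = mu * pairing k f' := by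
    have := pairing_comb_right mu 0 h'.ratPlus.memLp h'.ratPlus.memLp h.gen.memLp
    simpa using this
  rw [h2, h3, ← pairing_conj f' w, h'.pairing_realPart hw] at h1
  simp only [map_mul, Complex.conj_ofReal, Complex.conj_I, map_ofNat] at h1
  linear_combination h1

/-- The identity `‖f‖² = -2π λ |c|²`, from which the eigenvalues are negative and simple. -/
theorem pairing_self (hw : IsRealPartOf u w) (h : EigenFn u lam f k c) :
    pairing f f = -(2 * Real.pi) * (lam * (c * (starRingEnd ℂ) c)) := by
  have h1 := h.sub_mul_pairing hw h
  have : Complex.I * (pairing f f + 2 * Real.pi * (lam * (c * (starRingEnd ℂ) c))) = 0 := by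
    linear_combination -h1
  linear_combination (mul_eq_zero.1 this).resolve_left Complex.I_ne_zero

theorem eq_zero (hw : IsRealPartOf u w) (h : EigenFn u lam f k 0) : ∀ x, f x = 0 :=
  h.ratPlus.eq_zero_of_pairing_self (by rw [h.pairing_self hw]; simp)

theorem comb (a b : ℂ) (h : EigenFn u lam f k c) (h' : EigenFn u lam f' k' c') :
    EigenFn u lam (fun x => a * f x + b * f' x) (fun x => a * k x + b * k' x) (a * c + b * c') := by
  obtain ⟨β, hl⟩ := h.lax
  obtain ⟨β', hl'⟩ := h'.lax
  have h1 := hl.comb a b hl'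
  have e : (fun x => a * (lam * f x) + b * (lam * f' x)) =
      fun x => lam * (a * f x + b * f' x) := by
    funext x
    ring
  rw [e] at h1
  exact ⟨⟨_, h1⟩, (h.gen.smul a).add (h'.gen.smul b), fun x => by
    linear_combination a * h.eq x + b * h'.eq x⟩

/-- The eigenvalues are simple. -/
theorem mul_eq_mul (hw : IsRealPartOf u w) (h : EigenFn u lam f k c)
    (h' : EigenFn u lam f' k' c') (x : ℝ) : c' * f x = c * f' x := by
  have h1 := h.comb c' (-c) h'
  have h2 : c' * c + -c * c' = 0 := by ring
  rw [h2] at h1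
  linear_combination h1.eq_zero hw x

theorem pairing_eq_zero (hw : IsRealPartOf u w) (h : EigenFn u lam f k c)
    (h' : EigenFn u mu f' k' c') (hne : lam ≠ mu) : pairing f f' = 0 := by
  obtain ⟨β, hl⟩ := h.lax
  obtain ⟨β', hl'⟩ := h'.lax
  have h1 := hl.symm hw hl'
  have h2 := pairing_comb_right mu 0 h'.ratPlus.memLp h'.ratPlus.memLp h.ratPlus.memLp
  have h3 := pairing_comb_left lam 0 h.ratPlus.memLp h.ratPlus.memLp h'.ratPlus.memLp
  simp only [zero_mul, map_zero, add_zero, Complex.conj_ofReal] at h2 h3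
  rw [h2, h3] at h1
  have h4 : ((lam - mu : ℝ) : ℂ) * pairing f f' = 0 := by push_cast; linear_combination h1
  exact (mul_eq_zero.1 h4).resolve_left (by exact_mod_cast sub_ne_zero.2 hne)

theorem neg_of_ne_zero (hw : IsRealPartOf u w) (h : EigenFn u lam f k c)
    (hf : pairing f f = 1) : lam < 0 ∧ 2 * Real.pi * |lam| * Complex.normSq c = 1 := by
  have h1 := h.pairing_self hw
  rw [hf, Complex.mul_conj] at h1
  have h2 : (1 : ℝ) = -(2 * Real.pi) * (lam * Complex.normSq c) := by exact_mod_cast h1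
  have h3 : lam < 0 := by
    by_contra! h0
    have := Complex.normSq_nonneg c
    have := Real.pi_pos
    have : 0 ≤ Real.pi * (lam * Complex.normSq c) := by positivity
    linarith
  exact ⟨h3, by rw [abs_of_neg h3]; linarith⟩

end EigenFn

theorem IsSolitonPoly.exists_eigenFn (hu : IsSolitonPoly N u Q) {lam : ℝ} {v : hardy}
    (hv : v ∈ laxEigenspace (cls u) lam) : ∃ f k c, ∃ h : EigenFn u lam f k c, ModelMem Q f ∧
      v = h.ratPlus.toHardy := by
  obtain ⟨f, g, β, h, hf, hg, rfl⟩ :=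
    hu.exists_of_mem_modelSpace (laxEigenspace_le_modelSpace hu lam hv)
  have h1 := funext ((mem_laxEigenspace_toHardy hu.isRealPartOf h).1 hv)
  obtain ⟨c, k, hk, hc⟩ := h.left.exists_const
  exact ⟨f, k, c, ⟨⟨β, h1 ▸ h⟩, hk, hc⟩, hf, rfl⟩

theorem EigenFn.mem_laxEigenspace {w f k : ℝ → ℂ} {c : ℂ} {lam : ℝ} (hw : IsRealPartOf u w)
    (h : EigenFn u lam f k c) : h.ratPlus.toHardy ∈ laxEigenspace (cls u) lam := by
  obtain ⟨β, hl⟩ := h.lax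
  exact (mem_laxEigenspace_toHardy hw hl).2 fun x => rfl

theorem RatPlus.norm_toHardy_sq {f : ℝ → ℂ} (hf : RatPlus f) :
    ((‖hf.toHardy‖ ^ 2 : ℝ) : ℂ) = pairing f f := by
  rw [← inner_toL2 hf.memLp hf.memLp, ← hf.coe_toHardy, ← Submodule.coe_inner,
    inner_self_eq_norm_sq_to_K]
  simp

theorem EigenFn.integral_coe {w f k : ℝ → ℂ} {c : ℂ} {lam : ℝ} (hw : IsRealPartOf u w)
    (h : EigenFn u lam f k c) :
    ∫ x, (u x : ℂ) * (h.ratPlus.toHardy : L2) x = 2 * Real.pi * Complex.I * (lam * c) := by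
  rw [← h.integral_eq hw]
  refine integral_congr_ae ?_
  filter_upwards [coeFn_toL2 h.ratPlus.memLp] with x hx
  rw [RatPlus.coe_toHardy, hx]

theorem inner_toHardy {f g : ℝ → ℂ} (hf : RatPlus f) (hg : RatPlus g) :
    inner ℂ hg.toHardy hf.toHardy = pairing f g := inner_toL2 hf.memLp hg.memLp

theorem toHardy_congr {f g : ℝ → ℂ} (hf : RatPlus f) (hg : RatPlus g) (h : ∀ x, f x = g x) :
    hf.toHardy = hg.toHardy := Subtype.ext (congrArg toL2 (funext h))

theorem toHardy_smul (a : ℂ) {f : ℝ → ℂ} (hf : RatPlus f) :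
    (hf.smul a).toHardy = a • hf.toHardy := Subtype.ext (toL2_smul a hf.memLp)

theorem toHardy_sum {ι : Type*} (s : Finset ι) {f : ι → ℝ → ℂ} (a : ι → ℂ)
    (hf : ∀ i, RatPlus (f i)) :
    (RatPlus.sum s (f := fun i x => a i * f i x) fun i _ => (hf i).smul (a i)).toHardy =
      ∑ i ∈ s, a i • (hf i).toHardy := by
  classical
  induction s using Finset.induction_on with
  | empty =>
    refine Subtype.ext ?_
    simp only [RatPlus.coe_toHardy, Finset.sum_empty]
    rw [toL2_of_memLp RatPlus.zero.memLp]
    exact MemLp.toLp_zero _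
  | insert i s hi ih =>
    rw [Finset.sum_insert hi, ← ih, ← toHardy_smul]
    refine Subtype.ext ?_
    simp only [RatPlus.coe_toHardy, Finset.sum_insert hi]
    exact toL2_add ((hf i).smul (a i)).memLp (RatPlus.sum s fun j _ => (hf j).smul (a j)).memLp

theorem laxModel_apply_eq_iff (hu : IsSolitonPoly N u Q) (v : modelSpace Q) (lam : ℝ) :
    laxModel hu v = (lam : ℂ) • v ↔ (v : hardy) ∈ laxEigenspace (cls u) lam := by
  obtain ⟨f, g, β, h, -, -, hv⟩ := hu.exists_of_mem_modelSpace v.2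
  rw [hv, mem_laxEigenspace_toHardy hu.isRealPartOf h, Subtype.ext_iff, coe_laxModel hu h v hv,
    Submodule.coe_smul, hv, ← toHardy_smul]
  constructor
  · intro e
    exact congrFun (h.right.eq_of_toL2_eq (h.left.smul _) (congrArg Subtype.val e))
  · exact toHardy_congr _ _

/-- The spectral theorem for a symmetric operator on a finite-dimensional subspace, with the
eigenvalues in increasing order. -/
theorem exists_monotone_eigenvectors {E : Type*} [NormedAddCommGroup E] [InnerProductSpace ℂ E]
    (W : Submodule ℂ E) [FiniteDimensional ℂ W] {T : W →ₗ[ℂ] W}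
    (hT : ∀ v v' : W, inner ℂ (T v : E) (v' : E) = inner ℂ (v : E) (T v' : E))
    (hn : Module.finrank ℂ W = N) :
    ∃ (lam : Fin N → ℝ) (e : Fin N → W), Monotone lam ∧ Orthonormal ℂ (fun j => (e j : E)) ∧
      (∀ j, T (e j) = (lam j : ℂ) • e j) ∧ ∀ μ : ℝ, ∀ v, v ≠ 0 → T v = (μ : ℂ) • v → ∃ j, lam j = μ := by
  have hT : T.IsSymmetric := fun v v' => hT v v'
  refine ⟨fun j => hT.eigenvalues hn j.rev, fun j => hT.eigenvectorBasis hn j.rev,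
    fun i j hij => hT.eigenvalues_antitone hn (Fin.rev_le_rev.2 hij),
    ((hT.eigenvectorBasis hn).orthonormal.comp _ Fin.rev_injective).comp_linearIsometry W.subtypeₗᵢ,
    fun j => hT.apply_eigenvectorBasis hn j.rev, fun μ v hv0 hv => ?_⟩
  obtain ⟨i, hi⟩ := hT.exists_eigenvalues_eq hn (Module.End.hasEigenvalue_of_hasEigenvector
    ⟨Module.End.mem_eigenspace_iff.2 hv, hv0⟩)
  refine ⟨i.rev, ?_⟩
  simp only [Fin.rev_rev]
  exact Complex.ofReal_injective hi

theorem exists_orthonormal_eigenvectors (hu : IsSolitonPoly N u Q) :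
    ∃ (lam : Fin N → ℝ) (e : Fin N → hardy), Monotone lam ∧ Orthonormal ℂ e ∧
      (∀ j, e j ∈ laxEigenspace (cls u) (lam j)) ∧
      ∀ μ : ℝ, laxEigenspace (cls u) μ ≠ ⊥ → ∃ j, lam j = μ := by
  have := finiteDimensional_modelSpace hu.lower
  obtain ⟨lam, e, hmono, horth, he, hall⟩ := exists_monotone_eigenvectors (modelSpace Q)
    (isSymmetric_laxModel hu) ((finrank_modelSpace hu.lower).trans hu.natDegree_eq)
  refine ⟨lam, fun j => e j, hmono, horth,
    fun j => (laxModel_apply_eq_iff hu _ _).1 (he j), fun μ hμ => ?_⟩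
  obtain ⟨v, hv, hv0⟩ := Submodule.exists_mem_ne_zero_of_ne_bot hμ
  have hm := laxEigenspace_le_modelSpace hu μ hv
  exact hall μ ⟨v, hm⟩ (fun h0 => hv0 (congrArg Subtype.val h0))
    ((laxModel_apply_eq_iff hu ⟨v, hm⟩ μ).2 hv)

theorem EigenFn.const_ne_zero {w f k : ℝ → ℂ} {c : ℂ} {lam : ℝ} (hw : IsRealPartOf u w)
    (h : EigenFn u lam f k c) (hf : pairing f f = 1) : c ≠ 0 := by
  rintro rfl
  have := h.pairing_self hw
  rw [hf] at this
  simp at this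

theorem exists_isSpectralData (hu : IsSolitonPoly N u Q) : ∃ p, IsSpectralData N u p := by
  obtain ⟨lam, e, hmono, horth, hmem, hall⟩ := exists_orthonormal_eigenvectors hu
  have hw := hu.isRealPartOf
  choose f k c hef hmod he using fun j => hu.exists_eigenFn (hmem j)
  have hpair : ∀ i j, pairing (f i) (f j) = if j = i then 1 else 0 := fun i j => by
    rw [← inner_toHardy (hef i).ratPlus (hef j).ratPlus, ← he, ← he, orthonormal_iff_ite.1 horth]
  have hself : ∀ j, pairing (f j) (f j) = 1 := fun j => by rw [hpair, if_pos rfl]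
  have hneg := fun j => ((hef j).neg_of_ne_zero hw (hself j))
  have hc := fun j => (hef j).const_ne_zero hw (hself j)
  have hinj : Function.Injective lam := by
    intro i j hij
    by_contra hne
    have h1 := fun x => (hef i).mul_eq_mul hw (hij ▸ hef j) x
    have h2 := pairing_comb_left (c j) (-c i) (hef i).ratPlus.memLp (hef j).ratPlus.memLp
      (hef i).ratPlus.memLp
    have h3 : (fun x => c j * f i x + -c i * f j x) = fun _ => 0 := by
      funext x
      linear_combination h1 x
    rw [h3, hself, hpair j i, if_neg hne] at h2
    refine hc j ?_
    simpa [pairing] using h2.symm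
  have hlamC : ∀ j, (lam j : ℂ) ≠ 0 := fun j => by exact_mod_cast (hneg j).1.ne
  -- the phase which makes the integral of `u φ_j` positive
  set a : Fin N → ℂ := fun j =>
    (Real.sqrt (2 * Real.pi * |lam j|) : ℂ) / (2 * Real.pi * Complex.I * (lam j * c j)) with ha
  have hpi : (Real.pi : ℂ) ≠ 0 := by exact_mod_cast Real.pi_ne_zero
  have ha1 : ∀ j, ‖a j‖ = 1 := fun j => by
    have h1 := (hneg j).2
    have h2 : 0 ≤ 2 * Real.pi * |lam j| := by positivity
    have h3 : 0 < |lam j| := abs_pos.2 (hneg j).1.ne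
    have h4 : 0 < ‖c j‖ := norm_pos_iff.2 (hc j)
    rw [Complex.normSq_eq_norm_sq] at h1
    have h5 : Real.sqrt (2 * Real.pi * |lam j|) * ‖c j‖ = 1 := by
      rw [← Real.sqrt_sq h4.le, ← Real.sqrt_mul h2, h1, Real.sqrt_one]
    have h6 := Real.mul_self_sqrt h2
    simp only [ha, norm_div, norm_mul, Complex.norm_real, Complex.norm_I, Real.norm_eq_abs,
      Complex.norm_two, mul_one]
    rw [abs_of_pos Real.pi_pos, abs_of_nonneg (Real.sqrt_nonneg _), div_eq_one_iff_eq (by positivity)]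
    linear_combination ‖c j‖ * h6 - Real.sqrt (2 * Real.pi * |lam j|) * h5
  refine ⟨(lam, fun j => a j • e j), hmono.strictMono_of_injective hinj,
    fun μ => ⟨hall μ, ?_⟩, fun j => (hneg j).1, fun j => le_antisymm ?_ ?_, fun j => ?_, fun j => ?_⟩
  · rintro ⟨j, rfl⟩ h0
    have h1 := hmem j
    rw [h0, Submodule.mem_bot] at h1
    exact horth.ne_zero j h1
  · intro v hv
    obtain ⟨g, l, d, hg, -, rfl⟩ := hu.exists_eigenFn hv
    refine Submodule.mem_span_singleton.2 ⟨d / (a j * c j), ?_⟩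
    have ha0 : a j ≠ 0 := norm_ne_zero_iff.1 (by rw [ha1]; exact one_ne_zero)
    have := hc j
    simp only
    rw [smul_smul, he, ← toHardy_smul]
    refine toHardy_congr _ _ fun x => ?_
    have h1 := hg.mul_eq_mul hw (hef j) x
    field_simp
    linear_combination -h1
  · exact (Submodule.span_singleton_le_iff_mem _ _).2 (Submodule.smul_mem _ _ (hmem j))
  · simp only [norm_smul, ha1, one_mul]
    exact horth.1 j
  · have h1 := (hef j).integral_coe hw
    have h2 : ∫ x, (u x : ℂ) * ((a j • e j : hardy) : L2) x =
        a j * ∫ x, (u x : ℂ) * ((hef j).ratPlus.toHardy : L2) x := by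
      rw [← integral_const_mul, he]
      refine integral_congr_ae ?_
      filter_upwards [Lp.coeFn_smul (a j) ((hef j).ratPlus.toHardy : L2)] with x hx
      rw [Submodule.coe_smul, hx, Pi.smul_apply, smul_eq_mul]
      ring
    simp only
    rw [h2, h1, ha]
    have := hc j
    have := hlamC j
    have := Complex.I_ne_zero
    field_simp

theorem IsSpectralData.unique {p p' : (Fin N → ℝ) × (Fin N → hardy)} (h : IsSpectralData N u p)
    (h' : IsSpectralData N u p') : p = p' := by
  have h1 : p.1 = p'.1 := by
    refine (h.strictMono.range_inj h'.strictMono).1 ?_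
    ext μ
    exact (h.eigenvalue_iff μ).symm.trans (h'.eigenvalue_iff μ)
  refine Prod.ext h1 (funext fun j => ?_)
  have h2 : p.2 j ∈ Submodule.span ℂ {p'.2 j} := by
    rw [← h'.eigenspace_eq, ← h1, h.eigenspace_eq]
    exact Submodule.mem_span_singleton_self _
  obtain ⟨a, ha⟩ := Submodule.mem_span_singleton.1 h2
  have h3 := h.integral_eq j
  have h4 : ∫ x, (u x : ℂ) * (p.2 j : L2) x = a * ∫ x, (u x : ℂ) * (p'.2 j : L2) x := by
    rw [← integral_const_mul, ← ha]
    refine integral_congr_ae ?_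
    filter_upwards [Lp.coeFn_smul a (p'.2 j : L2)] with x hx
    rw [Submodule.coe_smul, hx, Pi.smul_apply, smul_eq_mul]
    ring
  rw [h4, h'.integral_eq, h1] at h3
  have h5 : (Real.sqrt (2 * Real.pi * |p'.1 j|) : ℂ) ≠ 0 := by
    have := Real.pi_pos
    have : 0 < |p'.1 j| := abs_pos.2 (h'.neg j).ne
    exact_mod_cast (Real.sqrt_pos.2 (by positivity)).ne'
  have h6 : a = 1 := mul_right_cancel₀ h5 (by rw [h3, one_mul])
  rw [← ha, h6, one_smul]

/-- Rational representatives `f j` of the eigenfunctions of the spectral data, with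
`x f j = k j + c j`. -/
structure EigenBasis (u : ℝ → ℝ) (Q : ℂ[X]) (lam : Fin N → ℝ) (f k : Fin N → ℝ → ℂ) (c : Fin N → ℂ) :
    Prop where
  strictMono : StrictMono lam
  neg : ∀ j, lam j < 0
  eigen : ∀ j, EigenFn u (lam j) (f j) (k j) (c j)
  mem : ∀ j, ModelMem Q (f j)
  const : ∀ j, c j = Complex.I / (Real.sqrt (2 * Real.pi * |lam j|) : ℂ)
  pairing_self : ∀ j, pairing (f j) (f j) = 1
  exists_sum : ∀ g, ModelMem Q g → ∃ a : Fin N → ℂ, ∀ x, g x = ∑ j, a j * f j x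

theorem IsSpectralData.exists_eigenBasis (hu : IsSolitonPoly N u Q)
    {p : (Fin N → ℝ) × (Fin N → hardy)} (h : IsSpectralData N u p) :
    ∃ f k c, ∃ hb : EigenBasis u Q p.1 f k c, ∀ j, p.2 j = (hb.eigen j).ratPlus.toHardy := by
  have hw := hu.isRealPartOf
  have hmem : ∀ j, p.2 j ∈ laxEigenspace (cls u) (p.1 j) := fun j => by
    rw [h.eigenspace_eq]
    exact Submodule.mem_span_singleton_self _
  choose f k c hef hmod he using fun j => hu.exists_eigenFn (hmem j)
  have hself : ∀ j, pairing (f j) (f j) = 1 := fun j => by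
    rw [← (hef j).ratPlus.norm_toHardy_sq, ← he, h.norm_eq]
    simp
  refine ⟨f, k, c, ⟨h.strictMono, h.neg, hef, hmod, fun j => ?_, hself, fun g hg => ?_⟩, he⟩
  · have h1 := (hef j).integral_coe hw
    have h2 := h.integral_eq j
    rw [he] at h2
    rw [h2] at h1
    have h3 : 0 ≤ 2 * Real.pi * |p.1 j| := by have := Real.pi_pos; positivity
    have h4 : 0 < Real.sqrt (2 * Real.pi * |p.1 j|) := by
      have := Real.pi_pos
      have : 0 < |p.1 j| := abs_pos.2 (h.neg j).ne
      exact Real.sqrt_pos.2 (by positivity)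
    have h5 := Real.mul_self_sqrt h3
    set s := Real.sqrt (2 * Real.pi * |p.1 j|)
    rw [abs_of_neg (h.neg j)] at h5
    have h6 : ((s * s : ℝ) : ℂ) = ((2 * Real.pi * -p.1 j : ℝ) : ℂ) := congrArg _ h5
    push_cast at h6
    have h7 : (s : ℂ) ≠ 0 := by exact_mod_cast h4.ne'
    rw [eq_div_iff h7]
    refine mul_left_cancel₀ h7 ?_
    linear_combination c j * h6 - Complex.I * h1 - (2 * Real.pi * p.1 j * c j) * Complex.I_sq
  · have := finiteDimensional_modelSpace hu.lower
    have hn : Module.finrank ℂ (modelSpace Q) = N :=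
      (finrank_modelSpace hu.lower).trans hu.natDegree_eq
    set b : Fin N → modelSpace Q := fun j =>
      ⟨(hef j).ratPlus.toHardy, (hef j).ratPlus.toHardy_mem_modelSpace (hmod j)⟩ with hb
    have horth : Orthonormal ℂ b := by
      refine orthonormal_iff_ite.2 fun i j => ?_
      change inner ℂ (hef i).ratPlus.toHardy (hef j).ratPlus.toHardy = _
      rw [inner_toHardy]
      by_cases hij : i = j
      · rw [if_pos hij, hij, hself]
      · rw [if_neg hij, (hef j).pairing_eq_zero hw (hef i)
          (h.strictMono.injective.ne fun h0 => hij h0.symm)]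
    have hspan := horth.linearIndependent.span_eq_top_of_card_eq_finrank' (by simp [hn])
    have h1 : (⟨hg.1.toHardy, hg.1.toHardy_mem_modelSpace hg⟩ : modelSpace Q) ∈
        Submodule.span ℂ (Set.range b) := by rw [hspan]; trivial
    obtain ⟨a, ha⟩ := (Submodule.mem_span_range_iff_exists_fun ℂ).1 h1
    refine ⟨a, ?_⟩
    have hs := RatPlus.sum Finset.univ (f := fun j x => a j * f j x)
      fun j _ => (hef j).ratPlus.smul (a j)
    refine congrFun (hg.1.eq_of_toL2_eq hs ?_)
    have h2 := congrArg Subtype.val ha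
    rw [Submodule.coe_sum] at h2
    have h3 := (toHardy_sum Finset.univ a fun j => (hef j).ratPlus).trans h2
    exact congrArg Subtype.val h3.symm

theorem EigenBasis.pairing_eq {lam : Fin N → ℝ} {f k : Fin N → ℝ → ℂ} {c : Fin N → ℂ}
    (hu : IsSolitonPoly N u Q) (hb : EigenBasis u Q lam f k c) (i j : Fin N) :
    pairing (f i) (f j) = if i = j then 1 else 0 := by
  by_cases hij : i = j
  · rw [if_pos hij, hij, hb.pairing_self]
  · rw [if_neg hij, (hb.eigen i).pairing_eq_zero hu.isRealPartOf (hb.eigen j)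
      (hb.strictMono.injective.ne hij)]

/-- The pure point subspace of `L_u` is the model space. -/
theorem IsSolitonPoly.purePoint_eq (hu : IsSolitonPoly N u Q) : purePoint (cls u) = modelSpace Q := by
  have := finiteDimensional_modelSpace hu.lower
  refine le_antisymm ?_ fun v hv => ?_
  · exact Submodule.topologicalClosure_minimal _ (iSup_le fun lam => laxEigenspace_le_modelSpace hu lam)
      (Submodule.closed_of_finiteDimensional _)
  · refine Submodule.le_topologicalClosure _ ?_
    obtain ⟨p, hp⟩ := exists_isSpectralData hu
    obtain ⟨f, k, c, hb, he⟩ := hp.exists_eigenBasis hu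
    obtain ⟨g, hg, hv⟩ := hv
    obtain ⟨a, ha⟩ := hb.exists_sum g hg
    have h1 : v = ∑ j, a j • (hb.eigen j).ratPlus.toHardy := by
      rw [← toHardy_sum]
      exact Subtype.ext (hv.trans (congrArg toL2 (funext ha)))
    rw [h1]
    exact Submodule.sum_mem _ fun j _ => Submodule.smul_mem _ _
      (Submodule.mem_iSup_of_mem (p.1 j) ((hb.eigen j).mem_laxEigenspace hu.isRealPartOf))

end Model

/-! ### The polynomial `Q_u` -/

/-- A proper rational function `P / Q` with vanishing derivative is zero. -/
theorem LowerRooted.eq_zero_of_derivative_mul_eq {P Q : ℂ[X]} (hQ : LowerRooted Q)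
    (hd : P.degree < Q.degree) (h : derivative P * Q = P * derivative Q) : P = 0 := by
  have hf := RatPlus.of_poly hQ hd
  have h1 : ∀ x : ℝ, deriv (fun x : ℝ => P.eval (x : ℂ) / Q.eval (x : ℂ)) x = 0 := fun x => by
    rw [(hasDerivAt_poly_div P (hQ.eval_real_ne_zero x)).deriv, ← eval_mul, ← eval_mul, h,
      sub_self, zero_div]
  have h2 : ∀ x : ℝ, P.eval (x : ℂ) / Q.eval (x : ℂ) = P.eval ((0 : ℝ) : ℂ) / Q.eval ((0 : ℝ) : ℂ) :=
    fun x => is_const_of_deriv_eq_zero hf.differentiable h1 x 0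
  have h3 := hf.tendsto_zero
  have h4 : P.eval ((0 : ℝ) : ℂ) / Q.eval ((0 : ℝ) : ℂ) = 0 :=
    tendsto_nhds_unique (tendsto_const_nhds.congr fun x => (h2 x).symm) h3
  refine poly_eq_of_eval_real fun x => ?_
  rw [eval_zero]
  exact ((div_eq_zero_iff.1 ((h2 x).trans h4)).resolve_right (hQ.eval_real_ne_zero x))

/-- The logarithmic derivative determines the polynomial: `(Q - Q') / Q'` has vanishing
derivative. -/
theorem LowerRooted.eq_of_logDerivFn_eq {Q Q' : ℂ[X]} (hQ : LowerRooted Q) (hQ' : LowerRooted Q')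
    (hd : Q.natDegree = Q'.natDegree) (h : ∀ x, logDerivFn Q x = logDerivFn Q' x) : Q = Q' := by
  by_contra hne
  have h1 : derivative Q * Q' = Q * derivative Q' := by
    refine poly_eq_of_eval_real fun x => ?_
    have h2 := h x
    rw [logDerivFn, logDerivFn, div_eq_div_iff (hQ.eval_real_ne_zero x) (hQ'.eval_real_ne_zero x)]
      at h2
    rw [eval_mul, eval_mul]
    refine mul_left_cancel₀ Complex.I_ne_zero ?_
    linear_combination h2
  have hdeg : (Q - Q').degree < Q'.degree := by
    have h3 : Q.degree = Q'.degree := by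
      rw [degree_eq_natDegree hQ.1.ne_zero, degree_eq_natDegree hQ'.1.ne_zero, hd]
    rw [← h3]
    exact degree_sub_lt_left h3 hQ.1.ne_zero (by rw [hQ.1.leadingCoeff, hQ'.1.leadingCoeff])
  refine hne (sub_eq_zero.1 (hQ'.eq_zero_of_derivative_mul_eq hdeg ?_))
  rw [derivative_sub]
  linear_combination h1

section Model

variable {N : ℕ} {u : ℝ → ℝ} {Q : ℂ[X]}

theorem IsSolitonPoly.isCharPoly (hu : IsSolitonPoly N u Q) : IsCharPoly N u Q := by
  refine ⟨hu.lower.1, hu.natDegree_eq, hu.lower.2, ?_⟩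
  rw [hu.isRealPartOf.szego_cls]
  exact coeFn_toL2 hu.isRealPartOf.1.memLp

theorem IsCharPoly.eq_of_isSolitonPoly {Q' : ℂ[X]} (h : IsCharPoly N u Q') (hu : IsSolitonPoly N u Q) :
    Q' = Q := by
  have h1 : LowerRooted Q' := ⟨h.1, h.2.2.1⟩
  refine h1.eq_of_logDerivFn_eq hu.lower (h.2.1.trans hu.natDegree_eq.symm) (congrFun ?_)
  refine h1.ratPlus_logDerivFn.eq_of_ae_eq hu.lower.ratPlus_logDerivFn ?_
  exact h.2.2.2.symm.trans hu.isCharPoly.2.2.2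

theorem existsUnique_isCharPoly (hu : u ∈ solitons N) : ∃! Q, IsCharPoly N u Q := by
  obtain ⟨Q, hQ⟩ := exists_isSolitonPoly hu
  exact ⟨Q, hQ.isCharPoly, fun Q' h => h.eq_of_isSolitonPoly hQ⟩

theorem isSolitonPoly_charPoly (hu : u ∈ solitons N) : IsSolitonPoly N u (charPoly N u) := by
  obtain ⟨Q, hQ⟩ := exists_isSolitonPoly hu
  have h1 : IsCharPoly N u (charPoly N u) := Classical.epsilon_spec ⟨Q, hQ.isCharPoly⟩
  rwa [h1.eq_of_isSolitonPoly hQ]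

theorem isSpectralData_spectralData (hu : u ∈ solitons N) :
    IsSpectralData N u (spectralData N u) :=
  Classical.epsilon_spec (exists_isSpectralData (isSolitonPoly_charPoly hu))

theorem oneSubInner_eq (N : ℕ) (u : ℝ → ℝ) :
    oneSubInner N u = fun x => 1 - blaschke (charPoly N u) x := rfl

theorem memLp_oneSubInner (hu : u ∈ solitons N) : MemLp (oneSubInner N u) 2 volume := by
  refine ((isSolitonPoly_charPoly hu).lower.blaschke_sub_one.neg.congr fun x => ?_).memLp
  rw [oneSubInner_eq]
  ring

/-! ### The resolvent of `G` on the model space -/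

/-- The resolvent of `G` on the model space: `(G - z)⁻¹ f = (f - f(z)) / (x - z)`. -/
theorem ModelMem.exists_resolvent (hQ : LowerRooted Q) {f : ℝ → ℂ} (hf : ModelMem Q f) {z : ℂ}
    (hz : 0 ≤ z.im) : ∃ (h : ℝ → ℂ) (c : ℂ), ModelMem Q h ∧ (∀ x : ℝ, x * h x = (f x + z * h x) + c) ∧
      (0 < z.im → hardyEval (toL2 f) z = -c) ∧ ∀ x : ℝ, z = x → f x = -c := by
  obtain ⟨P, hP, hfP⟩ := hf.exists_poly hQ
  have hQz := hQ.eval_ne_zero hz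
  set c : ℂ := -(P.eval z / Q.eval z) with hc
  set A : ℂ[X] := P + C c * Q with hA
  have hroot : A.IsRoot z := by
    simp only [hA, hc, IsRoot.def, eval_add, eval_mul, eval_C]
    field_simp
    ring
  set S : ℂ[X] := A /ₘ (X - C z) with hS
  have hAS : (X - C z) * S = A := mul_divByMonic_eq_iff_isRoot.2 hroot
  have hdA : A.degree ≤ Q.degree :=
    (degree_add_le _ _).trans (max_le hP.le (degree_C_mul_le' _ _))
  have hdS : S.degree < Q.degree := by
    by_cases hA0 : A = 0
    · rw [hS, hA0, zero_divByMonic, degree_zero]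
      exact bot_lt_iff_ne_bot.2 fun h => hQ.1.ne_zero (degree_eq_bot.1 h)
    · exact (degree_divByMonic_lt A (X - C z) hA0 (by rw [degree_X_sub_C]; exact one_pos)).trans_le hdA
  refine ⟨_, c, modelMem_of_poly hQ hdS, fun x => ?_, fun hz' => ?_, fun x hx => ?_⟩
  · have h1 := congrArg (eval (x : ℂ)) hAS
    simp only [hA, eval_mul, eval_sub, eval_X, eval_C, eval_add] at h1
    have := hQ.eval_real_ne_zero x
    rw [hfP]
    field_simp
    linear_combination h1
  · rw [funext hfP, hardyEval_of_poly hQ hP hz', hc, neg_neg]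
  · rw [hfP, hc, neg_neg, hx]

theorem isResolvent_of_mul_eq {f h : ℝ → ℂ} {z c : ℂ} (hf : RatPlus f) (hh : RatPlus h)
    (e : ∀ x : ℝ, x * h x = (f x + z * h x) + c) : IsResolvent z hf.toHardy hh.toHardy := by
  rw [isResolvent_iff]
  convert isGenerator_ratPlus hh (hf.add (hh.smul z)) e using 1
  refine Subtype.ext ?_
  simp only [Submodule.coe_add, Submodule.coe_smul, RatPlus.coe_toHardy]
  rw [toL2_add hf.memLp (hh.smul z).memLp, toL2_smul z hh.memLp]

theorem pairing_coe_eq {f : ℝ → ℂ} (hf : RatPlus f) (g : ℝ → ℂ) :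
    pairing (hf.toHardy : L2) g = pairing f g := by
  refine integral_congr_ae ?_
  filter_upwards [coeFn_toL2 hf.memLp] with x hx
  rw [RatPlus.coe_toHardy, hx]

theorem pairing_coe_coe {f g : ℝ → ℂ} (hf : RatPlus f) (hg : RatPlus g) :
    pairing (hf.toHardy : L2) (hg.toHardy : L2) = pairing f g := by
  rw [← inner_eq_pairing, ← Submodule.coe_inner, inner_toHardy]

theorem existsUnique_isResolvent (hu : u ∈ solitons N) {f : hardy} (hf : f ∈ purePoint (cls u))
    {z : ℂ} (hz : 0 ≤ z.im) : ∃! g : hardy, IsResolvent z f g := by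
  have hQ := isSolitonPoly_charPoly hu
  rw [hQ.purePoint_eq] at hf
  obtain ⟨f₀, hf₀, e⟩ := hf
  obtain ⟨h, c, hh, hc, -, -⟩ := hf₀.exists_resolvent hQ.lower hz
  have h1 : f = hf₀.1.toHardy := Subtype.ext e
  have h2 := isResolvent_of_mul_eq hf₀.1 hh.1 hc
  rw [h1]
  exact ⟨_, h2, fun g hg => hg.unique hz h2⟩

theorem IsResolvent.mem_purePoint (hu : u ∈ solitons N) {f : ℝ → ℂ} (hf : ModelMem (charPoly N u) f)
    {z : ℂ} (hz : 0 ≤ z.im) {g : hardy} (hg : IsResolvent z hf.1.toHardy g) :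
    g ∈ purePoint (cls u) ∧ ∃ (h : ℝ → ℂ) (c : ℂ), ModelMem (charPoly N u) h ∧
      (∀ x : ℝ, x * h x = (f x + z * h x) + c) ∧
      1 / (2 * Real.pi * Complex.I) * pairing (g : L2) (oneSubInner N u) = -c ∧
      (0 < z.im → hardyEval (toL2 f) z = -c) ∧ ∀ x : ℝ, z = x → f x = -c := by
  have hQ := isSolitonPoly_charPoly hu
  obtain ⟨h, c, hh, hc, h1, h2⟩ := hf.exists_resolvent hQ.lower hz
  obtain rfl := hg.unique hz (isResolvent_of_mul_eq hf.1 hh.1 hc)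
  rw [hQ.purePoint_eq]
  refine ⟨⟨h, hh, rfl⟩, h, c, hh, hc, ?_, h1, h2⟩
  rw [pairing_coe_eq hh.1, oneSubInner_eq,
    hh.pairing_one_sub hQ.lower (hf.1.add (hh.1.smul z)) hc]
  have := two_pi_I_ne_zero
  field_simp

theorem genG_purePoint (hu : u ∈ solitons N) {f : hardy} (hf : f ∈ purePoint (cls u)) :
    f ∈ genG.domain ∧ genGApply f ∈ purePoint (cls u) := by
  have hQ := isSolitonPoly_charPoly hu
  rw [hQ.purePoint_eq] at hf ⊢
  obtain ⟨f₀, hf₀, e⟩ := hf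
  obtain ⟨c, k, hk, hc⟩ := hf₀.1.exists_const
  obtain rfl : f = hf₀.1.toHardy := Subtype.ext e
  have h1 := isGenerator_ratPlus hf₀.1 hk hc
  refine ⟨mem_genG_domain h1, ?_⟩
  rw [genGApply_eq h1]
  exact ⟨k, hf₀.mul_sub_const hQ.lower hk hc, rfl⟩

/-! ### Matrices in the basis of eigenfunctions -/

namespace EigenBasis

variable {lam : Fin N → ℝ} {f k : Fin N → ℝ → ℂ} {c : Fin N → ℂ}

theorem pairing_sum (hu : IsSolitonPoly N u Q) (hb : EigenBasis u Q lam f k c) (a : Fin N → ℂ)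
    (i : Fin N) : pairing (fun x => ∑ j, a j * f j x) (f i) = a i := by
  have h1 : ∀ s : Finset (Fin N), pairing (fun x => ∑ j ∈ s, a j * f j x) (f i) =
      ∑ j ∈ s, a j * pairing (f j) (f i) := by
    intro s
    simp only [pairing, ← integral_const_mul]
    rw [← integral_finsetSum s fun j _ => (integrable_mul_conj (hb.eigen j).ratPlus.memLp
      (hb.eigen i).ratPlus.memLp).const_mul _]
    congr 1
    funext x
    rw [Finset.sum_mul]
    exact Finset.sum_congr rfl fun j _ => by ring
  rw [h1]
  simp [hb.pairing_eq hu]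

theorem gen_eq_sum (hu : IsSolitonPoly N u Q) (hb : EigenBasis u Q lam f k c) (j : Fin N) (x : ℝ) :
    k j x = ∑ i, pairing (k j) (f i) * f i x := by
  obtain ⟨a, ha⟩ := hb.exists_sum _
    ((hb.mem j).mul_sub_const hu.lower (hb.eigen j).gen (hb.eigen j).eq)
  rw [ha]
  refine Finset.sum_congr rfl fun i _ => ?_
  rw [funext ha, hb.pairing_sum hu]

/-- The coordinates of `Π u` in the basis of eigenfunctions are `√(2π) √|λ_j|`. -/
theorem realPart_eq_sum (hu : IsSolitonPoly N u Q) (hb : EigenBasis u Q lam f k c) (x : ℝ) :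
    logDerivFn Q x = ∑ i, (Real.sqrt (2 * Real.pi) * Real.sqrt |lam i| : ℂ) * f i x := by
  obtain ⟨a, ha⟩ := hb.exists_sum _ hu.lower.modelMem_logDerivFn
  rw [ha]
  refine Finset.sum_congr rfl fun i _ => ?_
  have h1 : a i = pairing (logDerivFn Q) (f i) := by rw [funext ha, hb.pairing_sum hu]
  rw [h1, ← pairing_conj, (hb.eigen i).pairing_realPart hu.isRealPartOf, hb.const]
  have h2 : 0 < 2 * Real.pi * |lam i| := by
    have := Real.pi_pos
    have : 0 < |lam i| := abs_pos.2 (hb.neg i).ne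
    positivity
  have h3 := Real.mul_self_sqrt h2.le
  have h4 := (Real.sqrt_pos.2 h2).ne'
  have h5 := Real.sqrt_mul (x := 2 * Real.pi) (by have := Real.pi_pos; positivity) |lam i|
  have e : 2 * Real.pi * Complex.I * (lam i * (Complex.I / (Real.sqrt (2 * Real.pi * |lam i|) : ℂ))) =
      (Real.sqrt (2 * Real.pi * |lam i|) : ℂ) := by
    have h6 : (Real.sqrt (2 * Real.pi * |lam i|) : ℂ) ≠ 0 := by exact_mod_cast h4
    have h7 := congrArg (fun y : ℝ => (y : ℂ)) h3
    simp only [abs_of_neg (hb.neg i)] at h6 h7 ⊢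
    rw [← mul_div_assoc, ← mul_div_assoc, div_eq_iff h6]
    push_cast at h7
    linear_combination (2 * Real.pi * lam i) * Complex.I_sq - h7
  rw [e, Complex.conj_ofReal, h5]
  push_cast
  ring

theorem sum_injective (hu : IsSolitonPoly N u Q) (hb : EigenBasis u Q lam f k c) {a b : Fin N → ℂ}
    (h : ∀ x, ∑ j, a j * f j x = ∑ j, b j * f j x) : a = b := by
  funext i
  rw [← hb.pairing_sum hu a i, ← hb.pairing_sum hu b i, funext h]

/-- The matrix of `G + 2 τ L_u - x₀` in the basis of eigenfunctions. -/
def pencil (lam : Fin N → ℝ) (f k : Fin N → ℝ → ℂ) (x₀ τ : ℝ) : Matrix (Fin N) (Fin N) ℂ :=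
  Matrix.of (fun i j => pairing (k j) (f i)) - Matrix.scalar (Fin N) (x₀ : ℂ) +
    Matrix.diagonal fun j => 2 * (τ : ℂ) * lam j

theorem pencil_mulVec (hu : IsSolitonPoly N u Q) (hb : EigenBasis u Q lam f k c) (x₀ τ : ℝ)
    (a : Fin N → ℂ) (x : ℝ) : (∑ j, a j * k j x) - x₀ * (∑ j, a j * f j x) +
      2 * τ * (∑ j, lam j * (a j * f j x)) = ∑ i, (pencil lam f k x₀ τ).mulVec a i * f i x := by
  have h1 : ∑ j, a j * k j x = ∑ i, (Matrix.of (fun i j => pairing (k j) (f i))).mulVec a i * f i x := by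
    simp only [Matrix.mulVec, dotProduct, Matrix.of_apply, Finset.sum_mul]
    rw [Finset.sum_comm]
    refine Finset.sum_congr rfl fun j _ => ?_
    rw [hb.gen_eq_sum hu, Finset.mul_sum]
    exact Finset.sum_congr rfl fun i _ => by ring
  rw [h1, Finset.mul_sum, Finset.mul_sum, ← Finset.sum_sub_distrib, ← Finset.sum_add_distrib]
  refine Finset.sum_congr rfl fun i _ => ?_
  simp only [pencil, Matrix.add_mulVec, Matrix.sub_mulVec, Pi.add_apply, Pi.sub_apply,
    Matrix.mulVec_diagonal, Matrix.scalar_apply]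
  ring

theorem exists_laxRel_sum (hb : EigenBasis u Q lam f k c)
    (a : Fin N → ℂ) : ∃ β, LaxRel u (fun x => ∑ j, a j * f j x)
      (fun x => ∑ j, lam j * (a j * f j x)) β := by
  choose β hβ using fun j => (hb.eigen j).lax
  have h0 : LaxRel u (fun _ => 0) (fun _ => 0) (fun _ => 0) :=
    ⟨RatPlus.zero, RatPlus.zero, RatMinus.zero, fun x => by simp⟩
  suffices h : ∀ s : Finset (Fin N), ∃ β, LaxRel u (fun x => ∑ j ∈ s, a j * f j x)
      (fun x => ∑ j ∈ s, lam j * (a j * f j x)) β from h _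
  intro s
  induction s using Finset.induction_on with
  | empty => exact ⟨_, by simpa using h0⟩
  | insert i s hi ih =>
    obtain ⟨γ, hγ⟩ := ih
    have h1 := (hβ i).comb (a i) 1 hγ
    refine ⟨fun x => a i * β i x + 1 * γ x, ?_⟩
    simp only [Finset.sum_insert hi]
    convert h1 using 2
    · ring
    · ring

theorem isUnit_pencil (hu : IsSolitonPoly N u Q) (hb : EigenBasis u Q lam f k c) (x₀ τ : ℝ) :
    IsUnit (pencil lam f k x₀ τ) := by
  rw [← Matrix.mulVec_injective_iff_isUnit]
  refine (injective_iff_map_eq_zero (Matrix.mulVecLin _)).2 fun a ha => ?_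
  obtain ⟨β, hβ⟩ := hb.exists_laxRel_sum a
  refine hb.sum_injective hu fun x => ?_
  have h1 : ∀ x : ℝ, (x - x₀) * (∑ j, a j * f j x) - (∑ j, a j * c j) +
      2 * τ * (∑ j, lam j * (a j * f j x)) = 0 := by
    intro x
    have h2 := hb.pencil_mulVec hu x₀ τ a x
    rw [Matrix.mulVecLin_apply] at ha
    rw [ha] at h2
    simp only [Pi.zero_apply, zero_mul, Finset.sum_const_zero] at h2
    have h3 : x * (∑ j, a j * f j x) = (∑ j, a j * k j x) + ∑ j, a j * c j := by
      rw [Finset.mul_sum, ← Finset.sum_add_distrib]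
      exact Finset.sum_congr rfl fun j _ => by linear_combination a j * (hb.eigen j).eq x
    linear_combination h2 + h3
  have h4 := (hβ.eq_zero_of_pencil hu.isRealPartOf τ x₀ h1).1 x
  simpa using h4

theorem const_eq_matPair (hu : IsSolitonPoly N u Q) (hb : EigenBasis u Q lam f k c) (x₀ τ : ℝ)
    {h g β : ℝ → ℂ} {d : ℂ} (hh : ModelMem Q h) (hg : LaxRel u h g β)
    (hd : ∃ l, RatPlus l ∧ ∀ x : ℝ, x * h x = l x + d)
    (he : ∀ x : ℝ, (x - x₀) * h x - d + 2 * τ * g x = logDerivFn Q x) :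
    d = Complex.I * matPair (pencil lam f k x₀ τ) (fun j => (Real.sqrt |lam j| : ℂ))
      (fun j => ((Real.sqrt |lam j|)⁻¹ : ℂ)) := by
  obtain ⟨a, ha⟩ := hb.exists_sum h hh
  obtain ⟨γ, hγ⟩ := hb.exists_laxRel_sum a
  rw [← funext ha] at hγ
  have hga := hg.unique hγ
  have h3 : ∀ x : ℝ, x * h x = (∑ j, a j * k j x) + ∑ j, a j * c j := fun x => by
    rw [ha, Finset.mul_sum, ← Finset.sum_add_distrib]
    exact Finset.sum_congr rfl fun j _ => by linear_combination a j * (hb.eigen j).eq x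
  obtain ⟨l, hl, hld⟩ := hd
  have hdc : d = ∑ j, a j * c j := by
    refine RatPlus.const_unique hl (RatPlus.sum Finset.univ (f := fun j x => a j * k j x)
      fun j _ => (hb.eigen j).gen.smul (a j)) fun x => ?_
    rw [← hld, h3]
  have h2pi : (Real.sqrt (2 * Real.pi) : ℂ) ≠ 0 := by
    have := Real.pi_pos
    exact_mod_cast (Real.sqrt_pos.2 (by positivity : 0 < 2 * Real.pi)).ne'
  have hB : (pencil lam f k x₀ τ).mulVec a =
      (Real.sqrt (2 * Real.pi) : ℂ) • fun j => (Real.sqrt |lam j| : ℂ) := by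
    refine hb.sum_injective hu fun x => ?_
    rw [← hb.pencil_mulVec hu x₀ τ a x]
    simp only [Pi.smul_apply, smul_eq_mul]
    rw [← hb.realPart_eq_sum hu, ← he, ← ha, hga, hdc]
    linear_combination -h3 x
  have hinv : a = (Real.sqrt (2 * Real.pi) : ℂ) •
      (pencil lam f k x₀ τ)⁻¹.mulVec fun j => (Real.sqrt |lam j| : ℂ) := by
    have hu' := (Matrix.isUnit_iff_isUnit_det _).1 (hb.isUnit_pencil hu x₀ τ)
    rw [← Matrix.mulVec_smul, ← hB, Matrix.mulVec_mulVec, Matrix.nonsing_inv_mul _ hu',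
      Matrix.one_mulVec]
  rw [hdc, matPair, dotProduct, Finset.mul_sum]
  refine Finset.sum_congr rfl fun j _ => ?_
  rw [hb.const, Real.sqrt_mul (by have := Real.pi_pos; positivity), congrFun hinv j]
  simp only [Pi.smul_apply, smul_eq_mul, Pi.star_apply, Complex.star_def, map_inv₀,
    Complex.conj_ofReal]
  push_cast
  field_simp

end EigenBasis

end Model

/-! ### The inversion formula for multi-solitons -/

section Soliton

variable {N : ℕ} {u : ℝ → ℝ}

/-- Rational representatives of the eigenfunctions of `L_u`, with the matrix `M(u)` of `G`. -/
theorem exists_eigenBasis (hu : u ∈ solitons N) :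
    ∃ f k c, EigenBasis u (charPoly N u) (eigval N u) f k c ∧
      (∀ j, ∫ x, (u x : ℂ) * f j x = (Real.sqrt (2 * Real.pi * |eigval N u j|) : ℂ)) ∧
      (∀ i j, matM N u i j = pairing (k j) (f i)) ∧
      ∀ j, angle N u j = (pairing (k j) (f j)).re := by
  have hQ := isSolitonPoly_charPoly hu
  have hp := isSpectralData_spectralData hu
  obtain ⟨f, k, c, hb, he⟩ := hp.exists_eigenBasis hQ
  have hM : ∀ i j, pairing (genGApply (eigfun N u j) : L2) (eigfun N u i : L2) =
      pairing (k j) (f i) := fun i j => by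
    rw [eigfun, eigfun, he, he, genGApply_eq (isGenerator_ratPlus _ (hb.eigen j).gen (hb.eigen j).eq),
      pairing_coe_coe]
  refine ⟨f, k, c, hb, fun j => ?_, fun i j => hM i j, fun j => ?_⟩
  · rw [(hb.eigen j).integral_eq hQ.isRealPartOf, ← (hb.eigen j).integral_coe hQ.isRealPartOf, ← he]
    exact hp.integral_eq j
  · rw [angle, hM]

theorem EigenBasis.two_pi_mul_const_mul_conj {Q : ℂ[X]} {lam : Fin N → ℝ} {f k : Fin N → ℝ → ℂ}
    {c : Fin N → ℂ} (hb : EigenBasis u Q lam f k c) (i j : Fin N) :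
    2 * Real.pi * (c j * (starRingEnd ℂ) (c i)) =
      1 / (Real.sqrt |lam i| * Real.sqrt |lam j| : ℂ) := by
  have h0 := Real.pi_pos
  have h1 : ∀ j, (Real.sqrt |lam j| : ℂ) ≠ 0 := fun j => by
    have : 0 < |lam j| := abs_pos.2 (hb.neg j).ne
    exact_mod_cast (Real.sqrt_pos.2 this).ne'
  have h2 : (Real.sqrt (2 * Real.pi) : ℂ) ≠ 0 := by
    exact_mod_cast (Real.sqrt_pos.2 (by positivity : 0 < 2 * Real.pi)).ne'
  have h3 : (Real.sqrt (2 * Real.pi) : ℂ) * Real.sqrt (2 * Real.pi) = 2 * Real.pi := by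
    have := Real.mul_self_sqrt (by positivity : 0 ≤ 2 * Real.pi)
    exact_mod_cast congrArg (fun y : ℝ => (y : ℂ)) this
  rw [hb.const, hb.const, Real.sqrt_mul (by positivity) |lam i|,
    Real.sqrt_mul (by positivity) |lam j|, map_div₀,
    Complex.conj_I, Complex.conj_ofReal]
  have := h1 i
  have := h1 j
  push_cast
  rw [← h3]
  field_simp
  linear_combination -Complex.I_sq

theorem matM_apply (hu : u ∈ solitons N) (k j : Fin N) : matM N u k j =
    if j = k then (angle N u j : ℂ) - Complex.I / (2 * |eigval N u j| : ℝ)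
    else Complex.I / (eigval N u k - eigval N u j : ℝ) *
      (Real.sqrt (|eigval N u k| / |eigval N u j|) : ℂ) := by
  have hQ := isSolitonPoly_charPoly hu
  obtain ⟨f, l, c, hb, -, hM, hγ⟩ := exists_eigenBasis hu
  have habs : ∀ j, 0 < |eigval N u j| := fun j => abs_pos.2 (hb.neg j).ne
  have hs : ∀ j, (Real.sqrt |eigval N u j| : ℂ) ≠ 0 := fun j => by
    exact_mod_cast (Real.sqrt_pos.2 (habs j)).ne'
  have hss : ∀ j, (Real.sqrt |eigval N u j| : ℂ) * Real.sqrt |eigval N u j| = -eigval N u j :=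
    fun j => by
      have := Real.mul_self_sqrt (habs j).le
      rw [abs_of_neg (hb.neg j)] at this ⊢
      exact_mod_cast congrArg (fun y : ℝ => (y : ℂ)) this
  have hc := hb.two_pi_mul_const_mul_conj k j
  rw [hM]
  split_ifs with hjk
  · subst hjk
    have h1 := pairing_mul_sub_pairing_mul (hb.eigen j).ratPlus (hb.eigen j).gen (hb.eigen j).ratPlus
      (hb.eigen j).gen (hb.eigen j).eq (hb.eigen j).eq
    rw [← pairing_conj (l j) (f j), Complex.sub_conj] at h1
    have h2 : (pairing (l j) (f j)).im = -(1 / (2 * |eigval N u j|)) := by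
      have h4 : eigval N u j ≠ 0 := (hb.neg j).ne
      rw [hss] at hc
      have h5 : 2 * (pairing (l j) (f j)).im = -(1 / -eigval N u j) := by
        refine Complex.ofReal_injective (mul_right_cancel₀ Complex.I_ne_zero ?_)
        push_cast at h1 ⊢
        rw [← hc]
        linear_combination h1
      rw [abs_of_neg (hb.neg j)]
      field_simp at h5 ⊢
      linear_combination h5
    rw [hγ]
    conv_lhs => rw [← Complex.re_add_im (pairing (l j) (f j)), h2]
    push_cast
    ring
  · have h1 := (hb.eigen j).sub_mul_pairing hQ.isRealPartOf (hb.eigen k)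
    rw [hb.pairing_eq hQ, if_neg hjk] at h1
    have h2 : ((eigval N u k - eigval N u j : ℝ) : ℂ) ≠ 0 := by
      exact_mod_cast sub_ne_zero.2 (hb.strictMono.injective.ne (Ne.symm hjk))
    rw [Real.sqrt_div (abs_nonneg _), div_mul_eq_mul_div, eq_div_iff h2]
    have h3 := hs j
    have h4 := hs k
    have e : pairing (l j) (f k) * ((eigval N u k - eigval N u j : ℝ) : ℂ) =
        -(Complex.I * eigval N u k *
          (1 / (Real.sqrt |eigval N u k| * Real.sqrt |eigval N u j| : ℂ))) := by
      rw [← hc]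
      push_cast
      linear_combination -h1
    rw [e]
    push_cast
    field_simp
    linear_combination -hss k

theorem pencil_eq {f k : Fin N → ℝ → ℂ} (hM : ∀ i j, matM N u i j = pairing (k j) (f i)) (x₀ τ : ℝ) :
    EigenBasis.pencil (eigval N u) f k x₀ τ = matM N u - Matrix.scalar (Fin N) (x₀ : ℂ) +
      Matrix.diagonal fun j => 2 * (τ : ℂ) * eigval N u j := by
  rw [EigenBasis.pencil]
  congr 2
  ext i j
  rw [hM, Matrix.of_apply]

theorem isUnit_pencil (hu : u ∈ solitons N) (x₀ τ : ℝ) :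
    IsUnit (matM N u - Matrix.scalar (Fin N) (x₀ : ℂ) +
      Matrix.diagonal fun j => 2 * (τ : ℂ) * eigval N u j) := by
  obtain ⟨f, l, c, hb, -, hM, -⟩ := exists_eigenBasis hu
  rw [← pencil_eq hM]
  exact hb.isUnit_pencil (isSolitonPoly_charPoly hu) x₀ τ

/-- If `h` is in the model space and `(G + 2 τ L_u - x₀) h = Π u`, then the limit of `x h(x)` at
infinity is expressed by the matrix of `G + 2 τ L_u - x₀`. -/
theorem const_eq_matPair (hu : u ∈ solitons N) (x₀ τ : ℝ) {h g β : ℝ → ℂ} {d : ℂ}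
    (hh : ModelMem (charPoly N u) h) (hg : LaxRel u h g β)
    (hd : ∃ l, RatPlus l ∧ ∀ x : ℝ, x * h x = l x + d)
    (he : ∀ x : ℝ, (x - x₀) * h x - d + 2 * τ * g x = logDerivFn (charPoly N u) x) :
    d = Complex.I * matPair (matM N u - Matrix.scalar (Fin N) (x₀ : ℂ) +
      Matrix.diagonal fun j => 2 * (τ : ℂ) * eigval N u j) (vecX N u) (vecY N u) := by
  obtain ⟨f, l, c, hb, -, hM, -⟩ := exists_eigenBasis hu
  rw [← pencil_eq hM]
  exact hb.const_eq_matPair (isSolitonPoly_charPoly hu) x₀ τ hh hg hd he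

theorem szegoHardy_eq (hu : u ∈ solitons N) : szegoHardy (cls u) =
    (isSolitonPoly_charPoly hu).lower.ratPlus_logDerivFn.toHardy :=
  Subtype.ext (isSolitonPoly_charPoly hu).isRealPartOf.szego_cls

theorem resolvent_szego (hu : u ∈ solitons N) (x : ℝ) {g : hardy}
    (hg : IsResolvent x (szegoHardy (cls u)) g) : g ∈ purePoint (cls u) ∧
      1 / (2 * Real.pi * Complex.I) * pairing (g : L2) (oneSubInner N u) =
        logDerivFn (charPoly N u) x ∧
      logDerivFn (charPoly N u) x = -Complex.I *
        matPair (matM N u - Matrix.scalar (Fin N) (x : ℂ)) (vecX N u) (vecY N u) := by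
  have hQ := isSolitonPoly_charPoly hu
  rw [szegoHardy_eq hu] at hg
  obtain ⟨h1, h, c, hh, hc, h2, -, h3⟩ :=
    IsResolvent.mem_purePoint hu hQ.lower.modelMem_logDerivFn (by simp) hg
  refine ⟨h1, by rw [h2, h3 x rfl], ?_⟩
  obtain ⟨g', β, hL⟩ := hQ.isRealPartOf.exists_laxRel hh.1
  have h4 := const_eq_matPair hu x 0 hh hL
    ⟨_, hQ.lower.ratPlus_logDerivFn.add (hh.1.smul x), hc⟩ fun y => by
      push_cast
      linear_combination hc y
  have h5 : (Matrix.diagonal fun j => 2 * ((0 : ℝ) : ℂ) * eigval N u j) =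
      (0 : Matrix (Fin N) (Fin N) ℂ) := by
    simp
  rw [h5, add_zero] at h4
  rw [h3 x rfl, h4]
  ring

theorem exists_isResolvent_szego (hu : u ∈ solitons N) (x : ℝ) :
    ∃! g : hardy, IsResolvent x (szegoHardy (cls u)) g := by
  have hQ := isSolitonPoly_charPoly hu
  refine existsUnique_isResolvent hu ?_ (by simp)
  rw [hQ.purePoint_eq, szegoHardy_eq hu]
  exact ⟨_, hQ.lower.modelMem_logDerivFn, rfl⟩

theorem logDerivFn_charPoly (hu : u ∈ solitons N) (x : ℝ) : logDerivFn (charPoly N u) x =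
    -Complex.I * matPair (matM N u - Matrix.scalar (Fin N) (x : ℂ)) (vecX N u) (vecY N u) :=
  (resolvent_szego hu x (exists_isResolvent_szego hu x).choose_spec.1).2.2

theorem isUnit_matM_sub (hu : u ∈ solitons N) (x : ℝ) :
    IsUnit (matM N u - Matrix.scalar (Fin N) (x : ℂ)) := by
  simpa using isUnit_pencil hu x 0

theorem hardy_formula (hu : u ∈ solitons N) {f : hardy} (hf : f ∈ purePoint (cls u)) :
    IsHardyExtension (f : L2) (hardyEval (f : L2)) ∧ ∀ z : ℂ, 0 < z.im →
      (∃! g : hardy, IsResolvent z f g) ∧ ∀ g : hardy, IsResolvent z f g →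
        g ∈ purePoint (cls u) ∧ hardyEval (f : L2) z =
          1 / (2 * Real.pi * Complex.I) * pairing (g : L2) (oneSubInner N u) := by
  have hQ := isSolitonPoly_charPoly hu
  have hf' := hf
  rw [hQ.purePoint_eq] at hf'
  obtain ⟨f₀, hf₀, e⟩ := hf'
  obtain rfl : f = hf₀.1.toHardy := Subtype.ext e
  refine ⟨hf₀.1.isHardyExtension,
    fun z hz => ⟨existsUnique_isResolvent hu hf hz.le, fun g hg => ?_⟩⟩
  obtain ⟨h1, h, c, -, -, h2, h3, -⟩ := IsResolvent.mem_purePoint hu hf₀ hz.le hg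
  exact ⟨h1, by rw [h2]; exact h3 hz⟩

theorem actionAngle_mapsTo (N : ℕ) :
    Set.MapsTo (actionAngle N) (solitons N) (actionSet N ×ˢ Set.univ) := fun u hu => by
  obtain ⟨f, l, c, hb, -⟩ := exists_eigenBasis hu
  have := Real.pi_pos
  refine ⟨⟨fun i j hij => ?_, fun j => ?_⟩, trivial⟩
  · exact mul_lt_mul_of_pos_left (hb.strictMono hij) (by positivity)
  · exact mul_neg_of_pos_of_neg (by positivity) (hb.neg j)

/-- The actions and angles determine `M(u)`, `X(u)` and `Y(u)`, hence `u` by the inversion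
formula. -/
theorem actionAngle_injOn (N : ℕ) : Set.InjOn (actionAngle N) (solitons N) := by
  intro u hu v hv h
  have hpi := Real.pi_pos
  have h1 : eigval N u = eigval N v := by
    funext j
    have h2 : action N u j = action N v j := congrFun (congrArg Prod.fst h) j
    exact mul_left_cancel₀ (by positivity : 2 * Real.pi ≠ 0) h2
  have h2 : angle N u = angle N v := congrArg Prod.snd h
  have h3 : matM N u = matM N v := by
    ext k j
    rw [matM_apply hu, matM_apply hv, h1, h2]
  have hX : vecX N u = vecX N v := by funext j; rw [vecX, vecX, h1]
  have hY : vecY N u = vecY N v := by funext j; rw [vecY, vecY, h1]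
  funext x
  have h4 := (isSolitonPoly_charPoly hu).eq x
  rw [logDerivFn_charPoly hu, h3, hX, hY, ← logDerivFn_charPoly hv,
    ← (isSolitonPoly_charPoly hv).eq x] at h4
  exact_mod_cast h4

end Soliton

/-! ### Linear systems depending on a parameter -/

theorem differentiableAt_det {n : Type*} [Fintype n] [DecidableEq n] {M : ℝ → Matrix n n ℂ} {t₀ : ℝ}
    (h : ∀ i j, DifferentiableAt ℝ (fun t => M t i j) t₀) :
    DifferentiableAt ℝ (fun t => (M t).det) t₀ := by
  simp only [Matrix.det_apply]
  exact DifferentiableAt.fun_sum fun σ _ =>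
    (DifferentiableAt.fun_finsetProd fun i _ => h _ _).const_smul _

/-- A family of linear functionals that separates the vectors spans the dual space. -/
theorem span_dual_eq_top {V : Type*} [AddCommGroup V] [Module ℂ V] [FiniteDimensional ℂ V]
    {ι : Type*} (A : ι → Module.Dual ℂ V) (h : ∀ v, (∀ i, A i v = 0) → v = 0) :
    Submodule.span ℂ (Set.range A) = ⊤ := by
  by_contra hne
  obtain ⟨φ, hφ, hle⟩ := Submodule.exists_le_ker_of_lt_top _ (lt_top_iff_ne_top.2 hne)
  obtain ⟨v, rfl⟩ := (Module.evalEquiv ℂ V).surjective φ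
  refine hφ ?_
  have hv : v = 0 := h v fun i => by
    have := hle (Submodule.subset_span ⟨i, rfl⟩)
    simpa using this
  rw [hv, map_zero]

/-- The solution of a linear system whose coefficients are differentiable with respect to a
parameter is differentiable wherever the system determines it. -/
theorem differentiableAt_of_linear_system {V : Type*} [NormedAddCommGroup V] [NormedSpace ℂ V]
    [NormedSpace ℝ V] [IsScalarTower ℝ ℂ V] [FiniteDimensional ℂ V] {ι : Type*}
    {A : ι → ℝ → V →ₗ[ℂ] ℂ} {b : ι → ℝ → ℂ} {q : ℝ → V} {t₀ : ℝ}
    (hA : ∀ i v, DifferentiableAt ℝ (fun t => A i t v) t₀) (hb : ∀ i, DifferentiableAt ℝ (b i) t₀)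
    (h : ∀ i t, A i t (q t) = b i t) (hker : ∀ v, (∀ i, A i t₀ v = 0) → v = 0) :
    DifferentiableAt ℝ q t₀ := by
  classical
  set e := Module.finBasis ℂ V
  have hspan := span_dual_eq_top (fun i => A i t₀) hker
  have hc : ∀ k, ∃ c : ι →₀ ℂ, (c.sum fun i a => a • A i t₀) = e.coord k := fun k =>
    (Finsupp.mem_span_range_iff_exists_finsupp).1 (by rw [hspan]; trivial)
  choose c hc using hc
  -- combinations of the equations, for which the matrix of the system at `t₀` is the identity
  set M : ℝ → Matrix _ _ ℂ := fun t => Matrix.of fun k l => ∑ i ∈ (c k).support, c k i * A i t (e l)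
    with hM
  set d : ℝ → _ → ℂ := fun t k => ∑ i ∈ (c k).support, c k i * b i t with hd
  have hMd : ∀ k l, DifferentiableAt ℝ (fun t => M t k l) t₀ := fun k l =>
    DifferentiableAt.fun_sum fun i _ => (hA i (e l)).const_mul _
  have hdd : ∀ k, DifferentiableAt ℝ (fun t => d t k) t₀ := fun k =>
    DifferentiableAt.fun_sum fun i _ => (hb i).const_mul _
  have hM1 : M t₀ = 1 := by
    ext k l
    have h1 := congrArg (fun φ : Module.Dual ℂ V => φ (e l)) (hc k)
    simp only [Finsupp.sum, LinearMap.sum_apply, LinearMap.smul_apply, smul_eq_mul,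
      Module.Basis.coord_apply, Module.Basis.repr_self] at h1
    change ∑ i ∈ (c k).support, c k i * A i t₀ (e l) = _
    rw [h1, Finsupp.single_apply, Matrix.one_apply]
    simp only [eq_comm]
  have hsys : ∀ t, (M t).mulVec (e.repr (q t)) = d t := by
    intro t
    funext k
    simp only [hM, hd, Matrix.mulVec, dotProduct, Matrix.of_apply, Finset.sum_mul]
    rw [Finset.sum_comm]
    refine Finset.sum_congr rfl fun i _ => ?_
    rw [← h i t]
    conv_rhs => rw [← e.sum_repr (q t), map_sum, Finset.mul_sum]
    refine Finset.sum_congr rfl fun l _ => ?_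
    rw [map_smul, smul_eq_mul]
    ring
  have hcram : ∀ t k, (M t).det * e.repr (q t) k = ((M t).updateCol k (d t)).det := by
    intro t k
    rw [← Matrix.cramer_apply, Matrix.cramer_eq_adjugate_mulVec, ← hsys, Matrix.mulVec_mulVec,
      Matrix.adjugate_mul, Matrix.smul_mulVec, Matrix.one_mulVec]
    rfl
  have hdet := differentiableAt_det hMd
  have hdet0 : ∀ᶠ t in 𝓝 t₀, (M t).det ≠ 0 :=
    hdet.continuousAt.eventually_ne (by rw [hM1, Matrix.det_one]; exact one_ne_zero)
  have hrepr : ∀ k, DifferentiableAt ℝ (fun t => e.repr (q t) k) t₀ := by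
    intro k
    have h1 : DifferentiableAt ℝ (fun t => ((M t).updateCol k (d t)).det / (M t).det) t₀ := by
      refine (differentiableAt_det fun i j => ?_).div hdet hdet0.self_of_nhds
      by_cases hj : j = k
      · subst hj
        simpa using hdd i
      · simpa [Matrix.updateCol_apply, hj] using hMd i j
    refine h1.congr_of_eventuallyEq (hdet0.mono fun t ht => ?_)
    simp only
    rw [← hcram, mul_div_cancel_left₀ _ ht]
  have h2 : q = fun t => ∑ k, e.repr (q t) k • e k := funext fun t => (e.sum_repr (q t)).symm
  rw [h2]
  exact DifferentiableAt.fun_sum fun k _ => (hrepr k).smul_const (e k)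

/-! ### Polynomials depending on a parameter -/

/-- The polynomial of degree less than `n` with given coefficients, as a linear map. -/
def polyOf {n : ℕ} : (Fin n → ℂ) →ₗ[ℂ] ℂ[X] where
  toFun a := ∑ j, C (a j) * X ^ (j : ℕ)
  map_add' a b := by
    rw [← Finset.sum_add_distrib]
    exact Finset.sum_congr rfl fun j _ => by rw [Pi.add_apply, C_add, add_mul]
  map_smul' r a := by
    rw [RingHom.id_apply, Finset.smul_sum]
    exact Finset.sum_congr rfl fun j _ => by
      rw [Pi.smul_apply, smul_eq_mul, C_mul, smul_eq_C_mul, mul_assoc]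

theorem polyOf_apply {n : ℕ} (a : Fin n → ℂ) : polyOf a = ∑ j, C (a j) * X ^ (j : ℕ) := rfl

theorem degree_polyOf_lt {n : ℕ} (a : Fin n → ℂ) : (polyOf a).degree < n := by
  rw [polyOf_apply]
  refine (degree_sum_le _ _).trans_lt ((Finset.sup_lt_iff (by exact_mod_cast WithBot.bot_lt_coe n)).2
    fun j _ => ?_)
  refine (degree_C_mul_X_pow_le _ _).trans_lt ?_
  exact_mod_cast j.2

theorem polyOf_coeff {n : ℕ} {P : ℂ[X]} (hP : P.degree < n) :
    polyOf (fun j : Fin n => P.coeff j) = P := by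
  rcases Nat.eq_zero_or_pos n with rfl | hn
  · have : P = 0 := degree_eq_bot.1 (Nat.WithBot.lt_zero_iff.1 (by exact_mod_cast hP))
    rw [this, polyOf_apply]
    simp
  rw [polyOf_apply, Fin.sum_univ_eq_sum_range (fun j => C (P.coeff j) * X ^ j) n]
  refine (P.as_sum_range_C_mul_X_pow' ?_).symm
  by_cases h0 : P = 0
  · simpa [h0] using hn
  · exact (natDegree_lt_iff_degree_lt h0).2 hP

theorem polyOf_eq_zero {n : ℕ} {a : Fin n → ℂ} (h : polyOf a = 0) : a = 0 := by
  funext j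
  have h1 := congrArg (fun P : ℂ[X] => P.coeff (j : ℕ)) h
  simp only [polyOf_apply, finsetSum_coeff, coeff_C_mul, coeff_X_pow, coeff_zero] at h1
  rw [Finset.sum_eq_single j (fun i _ hij => by
    rw [if_neg fun h => hij (Fin.ext h.symm), mul_zero]) (by simp)] at h1
  simpa using h1

/-- The polynomial `P t` is differentiable at `t₀` with respect to the parameter, with derivative
`P'`, in the sense that every linear functional of it is. -/
def HasPolyDeriv (P : ℝ → ℂ[X]) (P' : ℂ[X]) (t₀ : ℝ) : Prop :=
  ∀ φ : ℂ[X] →ₗ[ℂ] ℂ, HasDerivAt (fun t => φ (P t)) (φ P') t₀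

namespace HasPolyDeriv

variable {P Q : ℝ → ℂ[X]} {P' Q' : ℂ[X]} {t₀ : ℝ}

theorem eval (h : HasPolyDeriv P P' t₀) (z : ℂ) :
    HasDerivAt (fun t => (P t).eval z) (P'.eval z) t₀ := h (Polynomial.leval z)

theorem map (h : HasPolyDeriv P P' t₀) (ψ : ℂ[X] →ₗ[ℂ] ℂ[X]) :
    HasPolyDeriv (fun t => ψ (P t)) (ψ P') t₀ := fun φ => h (φ.comp ψ)

theorem map_derivative (h : HasPolyDeriv P P' t₀) :
    HasPolyDeriv (fun t => derivative (P t)) (derivative P') t₀ := h.map _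

theorem conj (h : HasPolyDeriv P P' t₀) :
    HasPolyDeriv (fun t => conjPoly (P t)) (conjPoly P') t₀ := fun φ => by
  let ψ : ℂ[X] →ₗ[ℂ] ℂ :=
    { toFun := fun R => (starRingEnd ℂ) (φ (conjPoly R))
      map_add' := fun R S => by simp [conjPoly]
      map_smul' := fun a R => by simp [conjPoly] }
  have hψ : ∀ R, φ (conjPoly R) = star (ψ R) := fun R => (Complex.conj_conj _).symm
  simp only [hψ]
  exact (h ψ).star

theorem add_const (h : HasPolyDeriv P P' t₀) (R : ℂ[X]) :
    HasPolyDeriv (fun t => R + P t) P' t₀ := fun φ => by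
  simp only [map_add]
  exact (h φ).const_add _

theorem hasDerivAt_div (hP : HasPolyDeriv P P' t₀) (hQ : HasPolyDeriv Q Q' t₀) {z : ℂ}
    (hz : (Q t₀).eval z ≠ 0) : HasDerivAt (fun t => (P t).eval z / (Q t).eval z)
      ((P' * Q t₀ - P t₀ * Q').eval z / (Q t₀ * Q t₀).eval z) t₀ := by
  refine ((hP.eval z).div (hQ.eval z) hz).congr_deriv ?_
  simp only [eval_sub, eval_mul, pow_two]

end HasPolyDeriv

theorem hasDerivAt_linearMap {V : Type*} [NormedAddCommGroup V] [NormedSpace ℂ V]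
    [NormedSpace ℝ V] [IsScalarTower ℝ ℂ V] [FiniteDimensional ℂ V] (φ : V →ₗ[ℂ] ℂ)
    {p : ℝ → V} {p' : V} {t₀ : ℝ} (h : HasDerivAt p p' t₀) : HasDerivAt (fun t => φ (p t)) (φ p') t₀ :=
  ((φ.toContinuousLinearMap.restrictScalars ℝ).hasFDerivAt (x := p t₀)).comp_hasDerivAt t₀ h

theorem hasPolyDeriv_polyOf {n : ℕ} {p : ℝ → Fin n → ℂ} {p' : Fin n → ℂ} {t₀ : ℝ}
    (h : HasDerivAt p p' t₀) : HasPolyDeriv (fun t => polyOf (p t)) (polyOf p') t₀ := fun φ =>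
  hasDerivAt_linearMap (φ.comp polyOf) h

theorem degree_wronskian_lt {P P' Q Q' : ℂ[X]} (hQ : Q ≠ 0) (hP : P.degree < Q.degree)
    (hP' : P'.degree < Q.degree) (hQ' : Q'.degree < Q.degree) :
    (P' * Q - P * Q').degree < (Q * Q).degree := by
  have h0 : Q.degree ≠ ⊥ := fun h => hQ (degree_eq_bot.1 h)
  refine (degree_sub_le _ _).trans_lt (max_lt ?_ ?_)
  · rw [degree_mul, degree_mul]
    exact WithBot.add_lt_add_right h0 hP'
  · rw [degree_mul, degree_mul]
    exact (add_le_add_right hQ'.le _).trans_lt (WithBot.add_lt_add_right h0 hP)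

/-- The family `F t` of functions on the line is differentiable at `t₀` with respect to the
parameter, pointwise and together with its derivatives in space, and its time derivative `F'` is
in `RatPlus`. -/
structure HasTimeDeriv (F : ℝ → ℝ → ℂ) (F' : ℝ → ℂ) (t₀ : ℝ) : Prop where
  ratPlus : RatPlus F'
  eval : ∀ x, HasDerivAt (fun t => F t x) (F' x) t₀
  deriv : ∀ x, HasDerivAt (fun t => deriv (F t) x) (deriv F' x) t₀

theorem HasPolyDeriv.hasTimeDeriv {P Q : ℝ → ℂ[X]} {P' Q' : ℂ[X]} {t₀ : ℝ}
    (hP : HasPolyDeriv P P' t₀) (hQ : HasPolyDeriv Q Q' t₀) (hl : ∀ t, LowerRooted (Q t))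
    (hd : (P' * Q t₀ - P t₀ * Q').degree < (Q t₀ * Q t₀).degree) :
    HasTimeDeriv (fun t x => (P t).eval (x : ℂ) / (Q t).eval (x : ℂ))
      (fun x => (P' * Q t₀ - P t₀ * Q').eval (x : ℂ) / (Q t₀ * Q t₀).eval (x : ℂ)) t₀ := by
  refine ⟨RatPlus.of_poly ((hl t₀).mul (hl t₀)) hd,
    fun x => hP.hasDerivAt_div hQ ((hl t₀).eval_real_ne_zero x), fun x => ?_⟩
  have h0 := (hl t₀).eval_real_ne_zero x
  have h1 : (fun t => _root_.deriv (fun x : ℝ => (P t).eval (x : ℂ) / (Q t).eval (x : ℂ)) x) =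
      fun t => ((derivative (P t)).eval (x : ℂ) * (Q t).eval (x : ℂ) -
        (P t).eval (x : ℂ) * (derivative (Q t)).eval (x : ℂ)) / (Q t).eval (x : ℂ) ^ 2 := by
    funext t
    exact (hasDerivAt_poly_div (P t) ((hl t).eval_real_ne_zero x)).deriv
  rw [h1, (hasDerivAt_poly_div _ (((hl t₀).mul (hl t₀)).eval_real_ne_zero x)).deriv]
  have hP1 := hP.eval (x : ℂ)
  have hP2 := hP.map_derivative.eval (x : ℂ)
  have hQ1 := hQ.eval (x : ℂ)
  have hQ2 := hQ.map_derivative.eval (x : ℂ)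
  refine (((hP2.mul hQ1).sub (hP1.mul hQ2)).div (hQ1.pow 2) (pow_ne_zero 2 h0)).congr_deriv ?_
  simp only [derivative_sub, derivative_mul, eval_sub, eval_mul, eval_add, Pi.mul_apply, Pi.sub_apply,
    Pi.pow_apply]
  field_simp
  push_cast
  ring

/-- If `i Q_t' / Q_t` depends differentiably on `t` in the upper half-plane, then so do the
coefficients of `Q_t`. -/
theorem exists_hasPolyDeriv {N : ℕ} {Q : ℝ → ℂ[X]} (hl : ∀ t, LowerRooted (Q t))
    (hN : ∀ t, (Q t).natDegree = N) {t₀ : ℝ} (hF : ∀ a : ℂ, 0 < a.im → DifferentiableAt ℝ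
      (fun t => (C Complex.I * derivative (Q t)).eval a / (Q t).eval a) t₀) :
    ∃ Q' : ℂ[X], Q'.degree < N ∧ HasPolyDeriv Q Q' t₀ := by
  have hsum : ∀ t, Q t = X ^ N + polyOf fun j : Fin N => (Q t).coeff j := fun t => by
    conv_lhs => rw [(hl t).1.as_sum, hN]
    rw [polyOf_apply, Fin.sum_univ_eq_sum_range (fun j => C ((Q t).coeff j) * X ^ j) N]
  have key : DifferentiableAt ℝ (fun t => fun j : Fin N => (Q t).coeff j) t₀ := by
    refine differentiableAt_of_linear_system (ι := {a : ℂ // 0 < a.im})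
      (A := fun a t => (Polynomial.leval (a : ℂ)).comp
          ((C Complex.I • (derivative.comp polyOf : (Fin N → ℂ) →ₗ[ℂ] ℂ[X])))
        - ((C Complex.I * derivative (Q t)).eval (a : ℂ) / (Q t).eval (a : ℂ)) •
          (Polynomial.leval (a : ℂ)).comp polyOf)
      (b := fun a t => ((C Complex.I * derivative (Q t)).eval (a : ℂ) / (Q t).eval (a : ℂ)) *
        (X ^ N : ℂ[X]).eval (a : ℂ) - (C Complex.I * derivative (X ^ N : ℂ[X])).eval (a : ℂ))
      (fun a v => ?_) (fun a => ?_) (fun a t => ?_) fun v hv => ?_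
    · exact (differentiableAt_const _).sub ((hF a a.2).mul_const _)
    · exact ((hF a a.2).mul_const _).sub (differentiableAt_const _)
    · have h1 := (hl t).eval_ne_zero a.2.le
      have h2 := hsum t
      set p := polyOf fun j : Fin N => (Q t).coeff j
      have h3 : p = Q t - X ^ N := by rw [h2]; ring
      change (C Complex.I • derivative p).eval (a : ℂ) - _ * p.eval (a : ℂ) = _
      rw [h3]
      simp only [smul_eq_mul, derivative_sub, eval_mul, eval_sub, eval_C]
      field_simp
      ring
    · have h1 : ∀ a : ℂ, 0 < a.im → (derivative (polyOf v) * Q t₀).eval a =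
          (polyOf v * derivative (Q t₀)).eval a := fun a ha => by
        have h2 := hv ⟨a, ha⟩
        change (C Complex.I • derivative (polyOf v)).eval a - _ * (polyOf v).eval a = 0 at h2
        have h3 := (hl t₀).eval_ne_zero ha.le
        simp only [smul_eq_mul, eval_mul, eval_C] at h2 ⊢
        field_simp at h2
        refine mul_left_cancel₀ Complex.I_ne_zero ?_
        linear_combination h2
      have h2 : derivative (polyOf v) * Q t₀ = polyOf v * derivative (Q t₀) := by
        refine eq_of_infinite_eval_eq _ _ (Set.Infinite.mono (s := Set.range fun x : ℝ =>
          (x : ℂ) + Complex.I) ?_ (Set.infinite_range_of_injective fun x y h => ?_))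
        · rintro _ ⟨x, rfl⟩
          exact h1 _ (by simp)
        · exact Complex.ofReal_injective (add_right_cancel h)
      refine polyOf_eq_zero ((hl t₀).eq_zero_of_derivative_mul_eq ?_ h2)
      rw [degree_eq_natDegree (hl t₀).1.ne_zero, hN]
      exact degree_polyOf_lt v
  have h1 := (hasPolyDeriv_polyOf key.hasDerivAt).add_const (X ^ N)
  rw [← funext hsum] at h1
  exact ⟨_, degree_polyOf_lt _, h1⟩

/-! ### The Benjamin-Ono equation for rational functions -/

theorem measurable_sign : Measurable Real.sign := by
  unfold Real.sign
  exact Measurable.ite measurableSet_Iio measurable_const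
    (Measurable.ite measurableSet_Ioi measurable_const measurable_const)

theorem fourier_hilbert (f : L2) :
    (𝓕 (hilbert f) : L2) =ᵐ[volume] fun ξ => -Complex.I * (Real.sign ξ : ℂ) * (𝓕 f : L2) ξ := by
  rw [hilbert, multiplier, FourierTransform.fourier_fourierInv_eq]
  refine coeFn_toL2 ((Lp.memLp (𝓕 f : L2)).of_le ?_ (ae_of_all _ fun ξ => ?_))
  · exact (((Complex.measurable_ofReal.comp measurable_sign).const_mul _).aestronglyMeasurable).mul
      (Lp.memLp _).1
  · rw [norm_mul]
    refine mul_le_of_le_one_left (norm_nonneg _) ?_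
    rcases Real.sign_apply_eq ξ with h | h | h <;> simp [h]

theorem szego_hilbert (f : L2) : szego (hilbert f) = -Complex.I • szego f := by
  rw [← szego_smul, szego, multiplier, szego, multiplier]
  congr 1
  refine toL2_congr ?_
  rw [FourierTransform.fourier_smul]
  filter_upwards [fourier_hilbert f, Lp.coeFn_smul (-Complex.I) (𝓕 f : L2), ae_ne_zero] with ξ h1 h2 h3
  rw [h1, h2, Pi.smul_apply, smul_eq_mul]
  rcases lt_or_gt_of_ne h3 with h | h
  · simp [szegoSymbol, h]
  · simp [szegoSymbol, h.le, Real.sign_of_pos h]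

namespace IsRealPartOf

variable {u : ℝ → ℝ} {w : ℝ → ℂ}

theorem eq_re (h : IsRealPartOf u w) (x : ℝ) : u x = 2 * (w x).re := by
  have := h.2 x
  rw [Complex.add_conj] at this
  exact_mod_cast this

theorem hasDerivAt (h : IsRealPartOf u w) (x : ℝ) : HasDerivAt u (2 * (deriv w x).re) x := by
  have h1 : u = fun x => 2 * (w x).re := funext h.eq_re
  rw [h1]
  exact ((Complex.reCLM.hasFDerivAt.comp_hasDerivAt x (h.1.hasDerivAt x))).const_mul 2

theorem deriv (h : IsRealPartOf u w) : IsRealPartOf (deriv u) (deriv w) :=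
  ⟨h.1.deriv, fun x => by rw [(h.hasDerivAt x).deriv, Complex.add_conj]⟩

/-- The square of `u = w + conj w` is again of this form: `u² = (w² + 2 r) + conj (w² + 2 r)`, where
`r = Π |w|²`. -/
theorem exists_sq (h : IsRealPartOf u w) : ∃ r, RatPlus r ∧
    (∀ x, w x * (starRingEnd ℂ) (w x) = r x + (starRingEnd ℂ) (r x)) ∧
    IsRealPartOf (fun x => u x ^ 2) fun x => w x * w x + 2 * r x := by
  obtain ⟨p, q, hp, hq, hpq⟩ := h.1.mul_ratMinus (RatMinus.of_conj h.1)
  have h1 : ∀ x, p x - (starRingEnd ℂ) (q x) = 0 := by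
    refine eq_zero_of_ratPlus_of_ratMinus (hp.sub hq.conj)
      (((RatMinus.of_conj hp).sub hq).congr fun x => ?_)
    have h2 := congrArg (starRingEnd ℂ) (hpq x)
    simp only [map_mul, map_add, Complex.conj_conj] at h2
    linear_combination h2 - hpq x
  have h2 : ∀ x, w x * (starRingEnd ℂ) (w x) = p x + (starRingEnd ℂ) (p x) := fun x => by
    have h3 := congrArg (starRingEnd ℂ) (h1 x)
    simp only [map_sub, Complex.conj_conj, map_zero] at h3
    rw [hpq]
    linear_combination -h3
  refine ⟨p, hp, h2, (h.1.mul h.1).add (hp.smul 2), fun x => ?_⟩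
  push_cast
  rw [h.2]
  simp only [map_add, map_mul, map_ofNat]
  linear_combination 2 * h2 x

end IsRealPartOf

/-- The projection of the Benjamin-Ono equation to the Hardy space. -/
theorem IsSolitonSolution.hasDerivAt_szego {N : ℕ} {u : ℝ → ℝ → ℝ} (h : IsSolitonSolution N u)
    {t : ℝ} {w r : ℝ → ℂ} (hw : IsRealPartOf (u t) w) (hr : RatPlus r)
    (hsq : IsRealPartOf (fun x => u t x ^ 2) fun x => w x * w x + 2 * r x) :
    HasDerivAt (fun s => szego (cls (u s))) (toL2 fun x =>
      -Complex.I * deriv (deriv w) x - (2 * w x * deriv w x + 2 * deriv r x)) t := by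
  have h1 := (szegoCLM.restrictScalars ℝ).hasFDerivAt.comp_hasDerivAt t (h.2 t)
  refine h1.congr_deriv ?_
  change szego (_ - _) = _
  have h2 : iteratedDeriv 2 (u t) = deriv (deriv (u t)) := by
    rw [iteratedDeriv_succ, iteratedDeriv_one]
  rw [szego_sub, szego_hilbert, h2, hw.deriv.deriv.szego_cls, hsq.deriv.szego_cls,
    ← toL2_smul _ hw.1.deriv.deriv.memLp,
    ← toL2_sub (hw.1.deriv.deriv.smul _).memLp hsq.1.deriv.memLp]
  congr 1
  funext x
  have h3 : HasDerivAt (fun x => w x * w x + 2 * r x)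
      ((deriv w x * w x + w x * deriv w x) + 2 * deriv r x) x :=
    ((hw.1.hasDerivAt x).mul (hw.1.hasDerivAt x)).add ((hr.hasDerivAt x).const_mul 2)
  rw [h3.deriv]
  ring

theorem hardyEval_eq_inner (f : L2) {a : ℂ} (ha : 0 < a.im) : hardyEval f a =
    (2 * Real.pi * Complex.I)⁻¹ * inner ℂ (toL2 (kernel ((starRingEnd ℂ) a))) f := by
  have hb : ((starRingEnd ℂ) a).im < 0 := by simpa using ha
  rw [inner_toL2_left _ (memLp_kernel hb.ne), (pairing_kernel ha).2,
    inv_mul_cancel_left₀ two_pi_I_ne_zero]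

theorem hasDerivAt_hardyEval {F : ℝ → L2} {F' : L2} {t : ℝ} (h : HasDerivAt F F' t) {a : ℂ}
    (ha : 0 < a.im) : HasDerivAt (fun s => hardyEval (F s) a) (hardyEval F' a) t := by
  simp only [hardyEval_eq_inner _ ha]
  exact ((((innerSL ℂ (toL2 (kernel ((starRingEnd ℂ) a)))).restrictScalars ℝ).hasFDerivAt
    (x := F t)).comp_hasDerivAt t h).const_mul _

theorem RatPlus.eq_of_hardyEval_eq {f g : ℝ → ℂ} (hf : RatPlus f) (hg : RatPlus g)
    (h : ∀ a : ℂ, 0 < a.im → hardyEval (toL2 f) a = hardyEval (toL2 g) a) : f = g := by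
  refine hf.eq_of_toL2_eq hg (sub_eq_zero.1 (eq_zero_of_hardyEval
    (hardy.sub_mem hf.mem_hardy hg.mem_hardy) one_pos fun x => ?_))
  have ha : 0 < ((x : ℂ) + ((1 : ℝ) : ℂ) * Complex.I).im := by simp
  have h1 := h _ ha
  rw [hardyEval_eq_inner _ ha] at h1 ⊢
  rw [hardyEval_eq_inner _ ha] at h1
  rw [inner_sub_right, mul_sub, h1, sub_self]

section Flow

variable {N : ℕ} {u : ℝ → ℝ → ℝ}

/-- The polynomial `Q_{u(t)}` depends differentiably on `t`, and `w = i Q' / Q` satisfies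
`∂_t w = -i w'' - 2 w w' - 2 r'` pointwise, where `|w|² = r + conj r`. -/
theorem IsSolitonSolution.hasTimeDeriv (h : IsSolitonSolution N u) {t : ℝ} {r : ℝ → ℂ}
    (hr : RatPlus r) (hsq : IsRealPartOf (fun x => u t x ^ 2) fun x =>
      logDerivFn (charPoly N (u t)) x * logDerivFn (charPoly N (u t)) x + 2 * r x) :
    ∃ Q' : ℂ[X], Q'.degree < N ∧ HasPolyDeriv (fun s => charPoly N (u s)) Q' t ∧
      HasTimeDeriv (fun s => logDerivFn (charPoly N (u s))) (fun x =>
        -Complex.I * deriv (deriv (logDerivFn (charPoly N (u t)))) x -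
          (2 * logDerivFn (charPoly N (u t)) x * deriv (logDerivFn (charPoly N (u t))) x +
            2 * deriv r x)) t := by
  have hQ := fun s => isSolitonPoly_charPoly (h.1 s)
  set Q := fun s => charPoly N (u s) with hQdef
  have hl : ∀ s, LowerRooted (Q s) := fun s => (hQ s).lower
  have hW := (hQ t).isRealPartOf.1
  set W := fun x => -Complex.I * deriv (deriv (logDerivFn (Q t))) x -
          (2 * logDerivFn (Q t) x * deriv (logDerivFn (Q t)) x + 2 * deriv r x) with hWdef
  have hWr : RatPlus W := ((hW.deriv.deriv.smul (-Complex.I)).sub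
    (((hW.smul 2).mul hW.deriv).add (hr.deriv.smul 2)))
  have h1 := h.hasDerivAt_szego (hQ t).isRealPartOf hr hsq
  have hF : ∀ a : ℂ, 0 < a.im → HasDerivAt
      (fun s => (C Complex.I * derivative (Q s)).eval a / (Q s).eval a) (hardyEval (toL2 W) a) t := by
    intro a ha
    refine (hasDerivAt_hardyEval h1 ha).congr_of_eventuallyEq (Eventually.of_forall fun s => ?_)
    simp only
    rw [(hQ s).isRealPartOf.szego_cls, ← hardyEval_of_poly (hl s) (hl s).degree_logDeriv ha,
      ← funext (logDerivFn_eq (Q s))]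
  obtain ⟨Q', hQ', hd⟩ := exists_hasPolyDeriv hl (fun s => (hQ s).natDegree_eq)
    fun a ha => (hF a ha).differentiableAt
  have hdP := (hd.map_derivative).map (C Complex.I • LinearMap.id)
  have hdeg : (Q t).degree = N := by rw [degree_eq_natDegree (hl t).1.ne_zero, (hQ t).natDegree_eq]
  have hlt : (C Complex.I * derivative Q' * Q t - C Complex.I * derivative (Q t) * Q').degree <
      (Q t * Q t).degree := by
    refine degree_wronskian_lt (hl t).1.ne_zero (hl t).degree_logDeriv ?_ (by rwa [hdeg])
    rw [hdeg]
    exact ((degree_C_mul_le' _ _).trans degree_derivative_le).trans_lt hQ'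
  have hT := hdP.hasTimeDeriv hd hl hlt
  refine ⟨Q', hQ', hd, ?_⟩
  have e1 : (fun s => logDerivFn (Q s)) = fun s (x : ℝ) =>
      ((C Complex.I • LinearMap.id : ℂ[X] →ₗ[ℂ] ℂ[X]) (derivative (Q s))).eval (x : ℂ) / (Q s).eval (x : ℂ) :=
    funext fun s => funext (logDerivFn_eq (Q s))
  have e2 : (fun x : ℝ => (C Complex.I * derivative Q' * Q t -
      C Complex.I * derivative (Q t) * Q').eval (x : ℂ) / (Q t * Q t).eval (x : ℂ)) = W := by
    refine hT.ratPlus.eq_of_hardyEval_eq hWr fun a ha => ?_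
    refine (hardyEval_of_poly ((hl t).mul (hl t)) hlt ha).trans ?_
    exact (hdP.hasDerivAt_div hd ((hl t).eval_ne_zero ha.le)).unique (hF a ha)
  rw [e1]
  convert hT using 1
  exact e2.symm

end Flow

/-! ### The rational solution of the pencil equation -/

section Pencil

variable {N : ℕ} {u : ℝ → ℝ} {Q : ℂ[X]}

/-- The correction `(1 - Π)(u f)` is the conjugate of an element of the model space, that is, a
quotient with denominator `conj(Q)`. -/
theorem ModelMem.conj_rem (hu : IsSolitonPoly N u Q) {f g β : ℝ → ℂ} (hf : ModelMem Q f)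
    (hL : LaxRel u f g β) : ModelMem Q fun x => (starRingEnd ℂ) (β x) := by
  have hΘ := hu.lower.blaschke_sub_one
  have hΘ' : ∀ x, deriv (fun x => blaschke Q x - 1) x = Complex.I * u x * blaschke Q x := fun x =>
    ((hu.hasDerivAt_blaschke x).sub_const 1).deriv
  refine ⟨hL.rem, fun x => (starRingEnd ℂ) (blaschke Q x * β x), ?_, fun x => ?_⟩
  · refine RatMinus.of_conj (((hL.right.add (hΘ.mul hL.right)).add
      ((hf.1.deriv.add (hΘ.mul hf.1.deriv)).smul Complex.I)).sub
      ((hΘ.deriv.mul hf.1).smul Complex.I) |>.congr fun x => ?_)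
    rw [hΘ', hL.eq]
    linear_combination (u x * blaschke Q x * f x) * Complex.I_sq
  · simp only [map_mul]
    rw [← mul_assoc, hu.lower.blaschke_mul_conj, one_mul]

/-- The relation `L_u (P / Q) = S / Q`, with the correction term `B / conj(Q)`, as a polynomial
identity. -/
theorem IsSolitonPoly.laxRel_iff (hu : IsSolitonPoly N u Q) {P S B : ℂ[X]} (hP : P.degree < Q.degree)
    (hS : S.degree < Q.degree) (hB : B.degree < Q.degree) :
    LaxRel u (fun x => P.eval (x : ℂ) / Q.eval (x : ℂ)) (fun x => S.eval (x : ℂ) / Q.eval (x : ℂ))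
      (fun x => B.eval (x : ℂ) / (conjPoly Q).eval (x : ℂ)) ↔
    ∀ x : ℝ, S.eval (x : ℂ) * (conjPoly Q).eval (x : ℂ) +
      Complex.I * (derivative P).eval (x : ℂ) * (conjPoly Q).eval (x : ℂ) -
      Complex.I * (derivative (conjPoly Q)).eval (x : ℂ) * P.eval (x : ℂ) -
      B.eval (x : ℂ) * Q.eval (x : ℂ) = 0 := by
  have key : ∀ x : ℝ, S.eval (x : ℂ) / Q.eval (x : ℂ) -
      (-Complex.I * deriv (fun x : ℝ => P.eval (x : ℂ) / Q.eval (x : ℂ)) x -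
        u x * (P.eval (x : ℂ) / Q.eval (x : ℂ)) + B.eval (x : ℂ) / (conjPoly Q).eval (x : ℂ)) =
      (S.eval (x : ℂ) * (conjPoly Q).eval (x : ℂ) +
      Complex.I * (derivative P).eval (x : ℂ) * (conjPoly Q).eval (x : ℂ) -
      Complex.I * (derivative (conjPoly Q)).eval (x : ℂ) * P.eval (x : ℂ) -
      B.eval (x : ℂ) * Q.eval (x : ℂ)) / (Q.eval (x : ℂ) * (conjPoly Q).eval (x : ℂ)) := by
    intro x
    have h1 := hu.lower.eval_real_ne_zero x
    have h2 := hu.lower.conj_eval_real_ne_zero x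
    rw [(hasDerivAt_poly_div P h1).deriv, hu.eq, derivative_conjPoly,
      eval_conjPoly (derivative Q)]
    have h3 : (starRingEnd ℂ) (logDerivFn Q x) =
        -Complex.I * (starRingEnd ℂ) ((derivative Q).eval (x : ℂ)) / (conjPoly Q).eval (x : ℂ) := by
      rw [eval_conjPoly]
      simp [logDerivFn]
    rw [h3, logDerivFn]
    field_simp
    ring
  have hne : ∀ x : ℝ, Q.eval (x : ℂ) * (conjPoly Q).eval (x : ℂ) ≠ 0 := fun x =>
    mul_ne_zero (hu.lower.eval_real_ne_zero x) (hu.lower.conj_eval_real_ne_zero x)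
  constructor
  · intro h x
    have h1 := key x
    rw [← h.eq x, sub_self] at h1
    exact (div_eq_zero_iff.1 h1.symm).resolve_right (hne x)
  · intro h
    refine ⟨RatPlus.of_poly hu.lower hP, RatPlus.of_poly hu.lower hS, RatMinus.of_poly hu.lower hB,
      fun x => sub_eq_zero.1 ?_⟩
    rw [key x, h x, zero_div]

/-- The equation `(G + 2 τ L_u - x₀) h = Π u` has a solution `h` in the model space; `d` is the
limit of `x h(x)` at infinity and `g = L_u h`. -/
theorem EigenBasis.exists_pencil_solution {lam : Fin N → ℝ} {f k : Fin N → ℝ → ℂ} {c : Fin N → ℂ}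
    (hu : IsSolitonPoly N u Q) (hb : EigenBasis u Q lam f k c) (x₀ τ : ℝ) :
    ∃ h g β l, ∃ d : ℂ, ModelMem Q h ∧ LaxRel u h g β ∧ RatPlus l ∧ (∀ x : ℝ, x * h x = l x + d) ∧
      ∀ x : ℝ, (x - x₀) * h x - d + 2 * τ * g x = logDerivFn Q x := by
  set a := (pencil lam f k x₀ τ)⁻¹.mulVec fun i => (Real.sqrt (2 * Real.pi) * Real.sqrt |lam i| : ℂ)
    with ha
  have hu' := (Matrix.isUnit_iff_isUnit_det _).1 (hb.isUnit_pencil hu x₀ τ)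
  have hB : (pencil lam f k x₀ τ).mulVec a =
      fun i => (Real.sqrt (2 * Real.pi) * Real.sqrt |lam i| : ℂ) := by
    rw [ha, Matrix.mulVec_mulVec, Matrix.mul_nonsing_inv _ hu', Matrix.one_mulVec]
  obtain ⟨β, hβ⟩ := hb.exists_laxRel_sum a
  have hmem : ∀ s : Finset (Fin N), ModelMem Q fun x => ∑ j ∈ s, a j * f j x := by
    intro s
    induction s using Finset.induction_on with
    | empty => simpa using (hu.lower.modelMem_logDerivFn.smul 0)
    | insert i s hi ih =>
      simp only [Finset.sum_insert hi]
      exact ((hb.mem i).smul (a i)).add ih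
  have h3 : ∀ x : ℝ, x * (∑ j, a j * f j x) = (∑ j, a j * k j x) + ∑ j, a j * c j := fun x => by
    rw [Finset.mul_sum, ← Finset.sum_add_distrib]
    exact Finset.sum_congr rfl fun j _ => by linear_combination a j * (hb.eigen j).eq x
  refine ⟨_, _, β, _, ∑ j, a j * c j, hmem _, hβ, RatPlus.sum Finset.univ
    (f := fun j x => a j * k j x) fun j _ => (hb.eigen j).gen.smul (a j), h3, fun x => ?_⟩
  have h4 := hb.pencil_mulVec hu x₀ τ a x
  rw [hB, ← hb.realPart_eq_sum hu] at h4
  linear_combination h3 x + h4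

/-- The solution of `(G + 2 τ L_u - x₀) h = Π u`, where `h`, `L_u h` and the correction `(1 - Π)(u
h)` are written with the denominators `Q_u` and `conj(Q_u)`. -/
theorem exists_pencil_solution (hu : u ∈ solitons N) (x₀ τ : ℝ) :
    ∃ P S B : ℂ[X], ∃ d : ℂ, P.degree < N ∧ S.degree < N ∧ B.degree < N ∧
      LaxRel u (fun x => P.eval (x : ℂ) / (charPoly N u).eval (x : ℂ))
        (fun x => S.eval (x : ℂ) / (charPoly N u).eval (x : ℂ))
        (fun x => B.eval (x : ℂ) / (conjPoly (charPoly N u)).eval (x : ℂ)) ∧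
      (∃ l, RatPlus l ∧ ∀ x : ℝ, x * (P.eval (x : ℂ) / (charPoly N u).eval (x : ℂ)) = l x + d) ∧
      ∀ x : ℝ, (x - x₀) * (P.eval (x : ℂ) / (charPoly N u).eval (x : ℂ)) - d +
        2 * τ * (S.eval (x : ℂ) / (charPoly N u).eval (x : ℂ)) = logDerivFn (charPoly N u) x := by
  have hQ := isSolitonPoly_charPoly hu
  have hdeg : (charPoly N u).degree = N := by
    rw [degree_eq_natDegree hQ.lower.1.ne_zero, hQ.natDegree_eq]
  obtain ⟨f, k, c, hb, -⟩ := exists_eigenBasis hu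
  obtain ⟨h, g, β, l, d, hh, hL, hl, hd, he⟩ := hb.exists_pencil_solution hQ x₀ τ
  obtain ⟨P, hP, hhP⟩ := hh.exists_poly hQ.lower
  obtain ⟨S, hS, hgS⟩ := (hh.laxRel hQ hL).exists_poly hQ.lower
  obtain ⟨B, hB, hβB⟩ := (hh.conj_rem hQ hL).exists_poly hQ.lower
  have e1 : β = fun x : ℝ => (conjPoly B).eval (x : ℂ) / (conjPoly (charPoly N u)).eval (x : ℂ) := by
    funext x
    rw [eval_conjPoly, eval_conjPoly, ← map_div₀, ← hβB, Complex.conj_conj]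
  obtain rfl := funext hhP
  obtain rfl := funext hgS
  rw [e1] at hL
  exact ⟨P, S, conjPoly B, d, by rwa [← hdeg], by rwa [← hdeg], by rwa [degree_conjPoly, ← hdeg], hL,
    ⟨l, hl, hd⟩, he⟩

end Pencil

section Flow

variable {N : ℕ} {u : ℝ → ℝ → ℝ}

/-- The linear functionals in the coefficients of `P`, `S`, `B` and in the constant `c` which
express the equations `(x - x₀) f - c + 2 τ g = i Q' / Q` and `L_u f = g` for `f = P / Q`,
`g = S / Q`. -/
def pencilFunctional {N : ℕ} (Q : ℂ[X]) (x₀ τ : ℝ) : ℝ ⊕ ℝ →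
    ((Fin N → ℂ) × (Fin N → ℂ) × (Fin N → ℂ) × ℂ) →ₗ[ℂ] ℂ
  | .inl x =>
    { toFun := fun v => (x - x₀) * (polyOf v.1).eval (x : ℂ) - v.2.2.2 * Q.eval (x : ℂ) +
        2 * τ * (polyOf v.2.1).eval (x : ℂ)
      map_add' := fun v v' => by
        simp only [Prod.fst_add, Prod.snd_add, map_add, eval_add]
        ring
      map_smul' := fun a v => by
        simp only [Prod.smul_fst, Prod.smul_snd, map_smul, eval_smul, smul_eq_mul, RingHom.id_apply]
        ring }
  | .inr x =>
    { toFun := fun v => (polyOf v.2.1).eval (x : ℂ) * (conjPoly Q).eval (x : ℂ) +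
        Complex.I * (derivative (polyOf v.1)).eval (x : ℂ) * (conjPoly Q).eval (x : ℂ) -
        Complex.I * (derivative (conjPoly Q)).eval (x : ℂ) * (polyOf v.1).eval (x : ℂ) -
        (polyOf v.2.2.1).eval (x : ℂ) * Q.eval (x : ℂ)
      map_add' := fun v v' => by
        simp only [Prod.fst_add, Prod.snd_add, map_add, eval_add]
        ring
      map_smul' := fun a v => by
        simp only [Prod.smul_fst, Prod.smul_snd, map_smul, eval_smul, smul_eq_mul, RingHom.id_apply]
        ring }

theorem pencilFunctional_injective {u : ℝ → ℝ} {Q : ℂ[X]} (hu : IsSolitonPoly N u Q) (x₀ τ : ℝ)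
    {v : (Fin N → ℂ) × (Fin N → ℂ) × (Fin N → ℂ) × ℂ}
    (hv : ∀ i, pencilFunctional Q x₀ τ i v = 0) : v = 0 := by
  have hdeg : Q.degree = N := by
    rw [degree_eq_natDegree hu.lower.1.ne_zero, hu.natDegree_eq]
  obtain ⟨p, s, b, c⟩ := v
  have hL := (hu.laxRel_iff (by rw [hdeg]; exact degree_polyOf_lt p)
    (by rw [hdeg]; exact degree_polyOf_lt s) (by rw [hdeg]; exact degree_polyOf_lt b)).2
      fun x => hv (.inr x)
  have hne := hu.lower.eval_real_ne_zero
  have hne' := hu.lower.conj_eval_real_ne_zero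
  obtain ⟨h1, rfl⟩ := hL.eq_zero_of_pencil hu.isRealPartOf τ x₀ (c := c) fun x => by
    have h2 : (x - x₀) * (polyOf p).eval (x : ℂ) - c * Q.eval (x : ℂ) +
        2 * τ * (polyOf s).eval (x : ℂ) = 0 := hv (.inl x)
    have := hne x
    field_simp
    linear_combination h2
  have h2 := hL.eq_zero h1
  have hp : p = 0 := polyOf_eq_zero (poly_eq_of_eval_real fun x => by
    rw [eval_zero]; exact (div_eq_zero_iff.1 (h1 x)).resolve_right (hne x))
  have hs : s = 0 := polyOf_eq_zero (poly_eq_of_eval_real fun x => by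
    rw [eval_zero]; exact (div_eq_zero_iff.1 (h2 x)).resolve_right (hne x))
  have hb : b = 0 := polyOf_eq_zero (poly_eq_of_eval_real fun x => by
    have h3 : (polyOf s).eval (x : ℂ) * (conjPoly Q).eval (x : ℂ) +
        Complex.I * (derivative (polyOf p)).eval (x : ℂ) * (conjPoly Q).eval (x : ℂ) -
        Complex.I * (derivative (conjPoly Q)).eval (x : ℂ) * (polyOf p).eval (x : ℂ) -
        (polyOf b).eval (x : ℂ) * Q.eval (x : ℂ) = 0 := hv (.inr x)
    rw [hp, hs, map_zero, derivative_zero] at h3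
    simp only [eval_zero, zero_mul, mul_zero, add_zero, sub_zero, zero_sub, neg_eq_zero] at h3
    rw [eval_zero]
    exact (mul_eq_zero.1 h3).resolve_right (hne x))
  rw [hp, hs, hb]
  rfl

theorem IsSolitonSolution.degree_charPoly (h : IsSolitonSolution N u) (t : ℝ) :
    (charPoly N (u t)).degree = N := by
  have hQ := isSolitonPoly_charPoly (h.1 t)
  rw [degree_eq_natDegree hQ.lower.1.ne_zero, hQ.natDegree_eq]

/-- The solution of the pencil equation depends differentiably on `t`: its coefficients are
determined by the linear functionals `pencilFunctional`, which depend differentiably on `t`. -/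
theorem IsSolitonSolution.differentiableAt_pencil (h : IsSolitonSolution N u) (s x₀ : ℝ)
    {P S B : ℝ → ℂ[X]} {c : ℝ → ℂ} (hP : ∀ t, (P t).degree < N) (hS : ∀ t, (S t).degree < N)
    (hB : ∀ t, (B t).degree < N)
    (hL : ∀ t, LaxRel (u t) (fun x => (P t).eval (x : ℂ) / (charPoly N (u t)).eval (x : ℂ))
        (fun x => (S t).eval (x : ℂ) / (charPoly N (u t)).eval (x : ℂ))
        (fun x => (B t).eval (x : ℂ) / (conjPoly (charPoly N (u t))).eval (x : ℂ)))
    (he : ∀ t, ∀ x : ℝ, (x - x₀) * ((P t).eval (x : ℂ) / (charPoly N (u t)).eval (x : ℂ)) - c t +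
        2 * ((t - s : ℝ) : ℂ) * ((S t).eval (x : ℂ) / (charPoly N (u t)).eval (x : ℂ)) =
          logDerivFn (charPoly N (u t)) x) (t : ℝ) :
    DifferentiableAt ℝ (fun t => ((fun j : Fin N => (P t).coeff j),
      (fun j : Fin N => (S t).coeff j), (fun j : Fin N => (B t).coeff j), c t)) t := by
  have hQ := fun s => isSolitonPoly_charPoly (h.1 s)
  have hdeg := h.degree_charPoly
  obtain ⟨r, hr, -, hsq⟩ := (hQ t).isRealPartOf.exists_sq
  obtain ⟨Q', hQ', hd, hw⟩ := h.hasTimeDeriv hr hsq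
  refine differentiableAt_of_linear_system
    (A := fun i t => pencilFunctional (charPoly N (u t)) x₀ (t - s) i)
    (b := fun i t => i.elim (fun x => logDerivFn (charPoly N (u t)) x *
      (charPoly N (u t)).eval (x : ℂ)) fun _ => 0)
    (fun i v => ?_) (fun i => ?_) (fun i t => ?_)
    fun v hv => pencilFunctional_injective (hQ t) x₀ (t - s) hv
  · have hts : DifferentiableAt ℝ (fun t : ℝ => ((t - s : ℝ) : ℂ)) t :=
      (((hasDerivAt_id t).sub_const s).ofReal_comp).differentiableAt
    rcases i with x | x
    · exact ((differentiableAt_const _).sub ((hd.eval (x : ℂ)).differentiableAt.const_mul _)).add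
        ((hts.const_mul 2).mul_const _)
    · have h1 := (hd.eval (x : ℂ)).differentiableAt
      have h2 := (hd.conj.eval (x : ℂ)).differentiableAt
      have h3 := (hd.conj.map_derivative.eval (x : ℂ)).differentiableAt
      exact (((h2.const_mul _).add (h2.const_mul _)).sub ((h3.const_mul _).mul_const _)).sub
        (h1.const_mul _)
  · rcases i with x | x
    · exact (hw.eval x).differentiableAt.mul (hd.eval (x : ℂ)).differentiableAt
    · exact differentiableAt_const _
  · rcases i with x | x
    · change (x - x₀) * (polyOf fun j : Fin N => (P t).coeff j).eval (x : ℂ) -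
        c t * (charPoly N (u t)).eval (x : ℂ) +
        2 * ((t - s : ℝ) : ℂ) * (polyOf fun j : Fin N => (S t).coeff j).eval (x : ℂ) =
        logDerivFn (charPoly N (u t)) x * (charPoly N (u t)).eval (x : ℂ)
      have := (hQ t).lower.eval_real_ne_zero x
      rw [polyOf_coeff (hP t), polyOf_coeff (hS t), ← he]
      field_simp
    · change (polyOf fun j : Fin N => (S t).coeff j).eval (x : ℂ) *
          (conjPoly (charPoly N (u t))).eval (x : ℂ) +
        Complex.I * (derivative (polyOf fun j : Fin N => (P t).coeff j)).eval (x : ℂ) *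
          (conjPoly (charPoly N (u t))).eval (x : ℂ) -
        Complex.I * (derivative (conjPoly (charPoly N (u t)))).eval (x : ℂ) *
          (polyOf fun j : Fin N => (P t).coeff j).eval (x : ℂ) -
        (polyOf fun j : Fin N => (B t).coeff j).eval (x : ℂ) * (charPoly N (u t)).eval (x : ℂ) = 0
      rw [polyOf_coeff (hP t), polyOf_coeff (hS t), polyOf_coeff (hB t)]
      exact ((hQ t).laxRel_iff (by rw [hdeg]; exact hP t) (by rw [hdeg]; exact hS t)
        (by rw [hdeg]; exact hB t)).1 (hL t) x

theorem exists_hasPolyDeriv_of_coeff {P : ℝ → ℂ[X]} (hP : ∀ t, (P t).degree < N) {t₀ : ℝ}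
    (h : DifferentiableAt ℝ (fun t => fun j : Fin N => (P t).coeff j) t₀) :
    ∃ P' : ℂ[X], P'.degree < N ∧ HasPolyDeriv P P' t₀ := by
  have h1 := hasPolyDeriv_polyOf h.hasDerivAt
  simp only [polyOf_coeff (hP _)] at h1
  exact ⟨_, degree_polyOf_lt _, h1⟩

/-- For a solution `u(t)`, the solution of `(G + 2 (t - s) L_{u(t)} - x₀) f = Π u(t)` in the model
space of `u(t)`, which depends differentiably on `t`. -/
theorem IsSolitonSolution.exists_pencil_family (h : IsSolitonSolution N u) (s x₀ : ℝ) :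
    ∃ (f g β : ℝ → ℝ → ℂ) (c : ℝ → ℂ), (∀ t, ModelMem (charPoly N (u t)) (f t) ∧
      LaxRel (u t) (f t) (g t) (β t) ∧ (∃ l, RatPlus l ∧ ∀ x : ℝ, x * f t x = l x + c t) ∧
      ∀ x : ℝ, (x - x₀) * f t x - c t + 2 * ((t - s : ℝ) : ℂ) * g t x =
        logDerivFn (charPoly N (u t)) x) ∧
      ∀ t, ∃ f' g' β' c', HasTimeDeriv f f' t ∧ HasTimeDeriv g g' t ∧ RatMinus β' ∧
        (∀ x, HasDerivAt (fun t => β t x) (β' x) t) ∧ HasDerivAt c c' t := by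
  have hQ := fun s => isSolitonPoly_charPoly (h.1 s)
  choose P S B c hP hS hB hL hl he using fun t => exists_pencil_solution (h.1 t) x₀ (t - s)
  have hdeg := h.degree_charPoly
  refine ⟨_, _, _, c, fun t => ⟨modelMem_of_poly (hQ t).lower (by rw [hdeg]; exact hP t), hL t, hl t,
    he t⟩, fun t => ?_⟩
  obtain ⟨r, hr, -, hsq⟩ := (hQ t).isRealPartOf.exists_sq
  obtain ⟨Q', hQ', hd, -⟩ := h.hasTimeDeriv hr hsq
  have key := h.differentiableAt_pencil s x₀ hP hS hB hL he t
  obtain ⟨P', hP', k1⟩ := exists_hasPolyDeriv_of_coeff hP key.fst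
  obtain ⟨S', hS', k2⟩ := exists_hasPolyDeriv_of_coeff hS key.snd.fst
  obtain ⟨B', hB', k3⟩ := exists_hasPolyDeriv_of_coeff hB key.snd.snd.fst
  have hlow := fun t => (hQ t).lower
  have hne := (hlow t).1.ne_zero
  rw [← hdeg t] at hP' hS' hB' hQ'
  have hPt := hP t
  have hSt := hS t
  have hBt := hB t
  rw [← hdeg t] at hPt hSt hBt
  have e : conjPoly (charPoly N (u t)) * conjPoly (charPoly N (u t)) =
      conjPoly (charPoly N (u t) * charPoly N (u t)) := (Polynomial.map_mul _).symm
  have hlt : (B' * conjPoly (charPoly N (u t)) - B t * conjPoly Q').degree <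
      (charPoly N (u t) * charPoly N (u t)).degree := by
    rw [← degree_conjPoly (charPoly N (u t) * charPoly N (u t)), ← e]
    refine degree_wronskian_lt (fun h0 => ?_) ?_ ?_ ?_
    · have h1 := degree_conjPoly (charPoly N (u t))
      rw [h0, hdeg, degree_zero] at h1
      exact absurd h1.symm (by simp)
    all_goals simpa only [degree_conjPoly]
  have hβ := RatMinus.of_poly ((hlow t).mul (hlow t)) hlt
  rw [← e] at hβ
  exact ⟨_, _, _, _, k1.hasTimeDeriv hd hlow (degree_wronskian_lt hne hPt hP' hQ'),
    k2.hasTimeDeriv hd hlow (degree_wronskian_lt hne hSt hS' hQ'), hβ,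
    fun x => k3.hasDerivAt_div hd.conj ((hlow t).conj_eval_real_ne_zero x),
    key.snd.snd.snd.hasDerivAt⟩

end Flow

/-! ### The flow -/

theorem LaxRel.realPart {u : ℝ → ℝ} {w r : ℝ → ℂ} (hw : IsRealPartOf u w) (hr : RatPlus r)
    (hs : ∀ x, w x * (starRingEnd ℂ) (w x) = r x + (starRingEnd ℂ) (r x)) :
    LaxRel u w (fun x => -Complex.I * deriv w x - w x * w x - r x)
      (fun x => (starRingEnd ℂ) (r x)) :=
  ⟨hw.1, ((hw.1.deriv.smul (-Complex.I)).sub (hw.1.mul hw.1)).sub hr, RatMinus.of_conj hr, fun x => by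
    rw [hw.2]
    linear_combination hs x⟩

theorem deriv_eq_of_forall_eq {F G : ℝ → ℂ} {a b : ℂ} {x : ℝ} (h : ∀ y, F y = G y)
    (hF : HasDerivAt F a x) (hG : HasDerivAt G b x) : a = b :=
  hF.unique (by rwa [funext h])

/-- The image of the pencil equation `(x - x₀) f - c + 2 τ L_u f = Π u` under `L_u`. -/
theorem LaxRel.pencil_apply {u : ℝ → ℝ} {w r f g h β β' k : ℝ → ℂ} {c : ℂ} {x₀ τ : ℝ}
    (hw : IsRealPartOf u w) (hr : RatPlus r)
    (hs : ∀ x, w x * (starRingEnd ℂ) (w x) = r x + (starRingEnd ℂ) (r x))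
    (hL : LaxRel u f g β) (hL' : LaxRel u g h β') (hk : RatPlus k) (hc : ∀ x : ℝ, x * f x = k x + c)
    (he : ∀ x : ℝ, (x - x₀) * f x - c + 2 * (τ : ℂ) * g x = w x) :
    ∃ d : ℂ, ∀ x : ℝ, (x - x₀) * g x - d - Complex.I * f x + c * w x + 2 * τ * h x =
      -Complex.I * deriv w x - w x * w x - r x := by
  obtain ⟨d, l, hl, hd⟩ := hL.right.exists_const
  obtain ⟨γ, hγ⟩ := hL.commutator hw hk hc hl hd
  have h1 := (hγ.comb 1 (-x₀) hL).comb 1 (2 * τ) hL'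
  have h2 : (fun x => 1 * (1 * k x + -x₀ * f x) + 2 * τ * g x) = w := by
    funext x
    linear_combination he x - hc x
  rw [h2] at h1
  refine ⟨d, fun x => ?_⟩
  linear_combination h1.unique (LaxRel.realPart hw hr hs) x + hd x

/-- Let `f_t` solve `(x - x₀) f - c + 2 (t - s) L_u f = Π u` along a solution `u` of the
Benjamin-Ono equation. Then `T = ∂_t f - i f'' - 2 w' f - 2 (L_u f)'` solves the homogeneous
equation `(x - x₀) T - ∂_t c + 2 (t - s) L_u T = 0`; hence the limit `c` of `x f(x)` at infinity
does not depend on `t`. -/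
theorem deriv_const_eq_zero {u : ℝ → ℝ → ℝ} {w f g β : ℝ → ℝ → ℂ} {c : ℝ → ℂ} {r f' g' β' w' : ℝ → ℂ}
    {c' : ℂ} {x₀ s t : ℝ} (hw : ∀ t, IsRealPartOf (u t) (w t)) (hr : RatPlus r)
    (hs : ∀ x, w t x * (starRingEnd ℂ) (w t x) = r x + (starRingEnd ℂ) (r x))
    (hwt : ∀ x, HasDerivAt (fun t => w t x) (w' x) t)
    (hw' : ∀ x, w' x = -Complex.I * deriv (deriv (w t)) x -
      (2 * w t x * deriv (w t) x + 2 * deriv r x))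
    (hL : ∀ t, LaxRel (u t) (f t) (g t) (β t)) (hk : ∃ k, RatPlus k ∧ ∀ x : ℝ, x * f t x = k x + c t)
    (he : ∀ t, ∀ x : ℝ, (x - x₀) * f t x - c t + 2 * ((t - s : ℝ) : ℂ) * g t x = w t x)
    (hf : HasTimeDeriv f f' t) (hg : HasTimeDeriv g g' t) (hβ : RatMinus β')
    (hβt : ∀ x, HasDerivAt (fun t => β t x) (β' x) t) (hc : HasDerivAt c c' t) : c' = 0 := by
  obtain ⟨k, hk, hkc⟩ := hk
  obtain ⟨h, β₂, hL'⟩ := (hw t).exists_laxRel (hL t).right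
  obtain ⟨d, hd⟩ := LaxRel.pencil_apply (hw t) hr hs (hL t) hL' hk hkc (he t)
  have rw' := (hw t).1
  have rf := (hL t).left
  have rg := (hL t).right
  have rβ := (hL t).rem
  have rh := hL'.right
  -- spatial derivatives of the pencil equation
  have E1 : ∀ x : ℝ, f t x + (x - x₀) * deriv (f t) x + 2 * ((t - s : ℝ) : ℂ) * deriv (g t) x =
      deriv (w t) x := fun x => deriv_eq_of_forall_eq (he t)
    (((((((hasDerivAt_id x).ofReal_comp).sub_const (x₀ : ℂ)).mul (rf.hasDerivAt x)).sub_const (c t)).add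
      ((rg.hasDerivAt x).const_mul (2 * ((t - s : ℝ) : ℂ)))).congr_deriv (by push_cast; simp))
    (rw'.hasDerivAt x)
  have E2 : ∀ x : ℝ, 2 * deriv (f t) x + (x - x₀) * deriv (deriv (f t)) x +
      2 * ((t - s : ℝ) : ℂ) * deriv (deriv (g t)) x = deriv (deriv (w t)) x := fun x =>
    deriv_eq_of_forall_eq E1 ((((rf.hasDerivAt x).add
      ((((hasDerivAt_id x).ofReal_comp).sub_const (x₀ : ℂ)).mul (rf.deriv.hasDerivAt x))).add
      ((rg.deriv.hasDerivAt x).const_mul (2 * ((t - s : ℝ) : ℂ)))).congr_deriv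
        (by push_cast; simp; ring))
    (rw'.deriv.hasDerivAt x)
  have D1 : ∀ x : ℝ, g t x + (x - x₀) * deriv (g t) x - Complex.I * deriv (f t) x +
      c t * deriv (w t) x + 2 * ((t - s : ℝ) : ℂ) * deriv h x =
      -Complex.I * deriv (deriv (w t)) x - 2 * w t x * deriv (w t) x - deriv r x := fun x =>
    deriv_eq_of_forall_eq hd
    (((((((((hasDerivAt_id x).ofReal_comp).sub_const (x₀ : ℂ)).mul (rg.hasDerivAt x)).sub_const d).sub
      ((rf.hasDerivAt x).const_mul Complex.I)).add ((rw'.hasDerivAt x).const_mul (c t))).add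
      ((rh.hasDerivAt x).const_mul (2 * ((t - s : ℝ) : ℂ)))).congr_deriv (by push_cast; simp))
    (((((rw'.deriv.hasDerivAt x).const_mul (-Complex.I)).sub
      ((rw'.hasDerivAt x).mul (rw'.hasDerivAt x))).sub (hr.hasDerivAt x)).congr_deriv (by ring))
  -- time derivatives of the pencil equation and of the relation `L_u f = g`
  have Et : ∀ x : ℝ, (x - x₀) * f' x - c' + (2 * g t x + 2 * ((t - s : ℝ) : ℂ) * g' x) = w' x :=
    fun x => deriv_eq_of_forall_eq (fun t => he t x)
    ((((hf.eval x).const_mul _).sub hc).add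
      (((((hasDerivAt_id t).sub_const s).ofReal_comp).const_mul 2).mul (hg.eval x)) |>.congr_deriv
        (by push_cast; simp)) (hwt x)
  have hu : ∀ t x, (u t x : ℂ) = w t x + (starRingEnd ℂ) (w t x) := fun t => (hw t).2
  have hLx : ∀ t x, g t x = -Complex.I * deriv (f t) x -
      (w t x + (starRingEnd ℂ) (w t x)) * f t x + β t x := fun t x => by
    rw [← hu]; exact (hL t).eq x
  have Lt : ∀ x, g' x = -Complex.I * deriv f' x - ((w' x + (starRingEnd ℂ) (w' x)) * f t x +
      (w t x + (starRingEnd ℂ) (w t x)) * f' x) + β' x := fun x =>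
    deriv_eq_of_forall_eq (fun t => hLx t x) (hg.eval x)
      ((((hf.deriv x).const_mul (-Complex.I)).sub
        (((hwt x).add (RatMinus.hasDerivAt_conj (hwt x))).mul (hf.eval x))).add (hβt x))
  have hud : ∀ x, HasDerivAt (fun x => w t x + (starRingEnd ℂ) (w t x))
      (deriv (w t) x + (starRingEnd ℂ) (deriv (w t) x)) x := fun x =>
    (rw'.hasDerivAt x).add (RatMinus.hasDerivAt_conj (rw'.hasDerivAt x))
  have hudd : ∀ x, HasDerivAt (fun x => deriv (w t) x + (starRingEnd ℂ) (deriv (w t) x))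
      (deriv (deriv (w t)) x + (starRingEnd ℂ) (deriv (deriv (w t)) x)) x := fun x =>
    (rw'.deriv.hasDerivAt x).add (RatMinus.hasDerivAt_conj (rw'.deriv.hasDerivAt x))
  have G1 : ∀ x, deriv (g t) x = -Complex.I * deriv (deriv (f t)) x -
      ((deriv (w t) x + (starRingEnd ℂ) (deriv (w t) x)) * f t x +
        (w t x + (starRingEnd ℂ) (w t x)) * deriv (f t) x) + deriv (β t) x := fun x =>
    deriv_eq_of_forall_eq (hLx t) (rg.hasDerivAt x)
      ((((rf.deriv.hasDerivAt x).const_mul (-Complex.I)).sub ((hud x).mul (rf.hasDerivAt x))).add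
        (rβ.hasDerivAt x))
  have G2 : ∀ x, deriv (deriv (g t)) x = -Complex.I * deriv (deriv (deriv (f t))) x -
      (((deriv (deriv (w t)) x + (starRingEnd ℂ) (deriv (deriv (w t)) x)) * f t x +
        (deriv (w t) x + (starRingEnd ℂ) (deriv (w t) x)) * deriv (f t) x) +
        ((deriv (w t) x + (starRingEnd ℂ) (deriv (w t) x)) * deriv (f t) x +
        (w t x + (starRingEnd ℂ) (w t x)) * deriv (deriv (f t)) x)) + deriv (deriv (β t)) x := fun x =>
    deriv_eq_of_forall_eq G1 (rg.deriv.hasDerivAt x)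
      ((((rf.deriv.deriv.hasDerivAt x).const_mul (-Complex.I)).sub
        (((hudd x).mul (rf.hasDerivAt x)).add ((hud x).mul (rf.deriv.hasDerivAt x)))).add
        (rβ.deriv.hasDerivAt x))
  have hLx' : ∀ x, h x = -Complex.I * deriv (g t) x -
      (w t x + (starRingEnd ℂ) (w t x)) * g t x + β₂ x := fun x => by
    rw [← hu]; exact hL'.eq x
  have H1 : ∀ x, deriv h x = -Complex.I * deriv (deriv (g t)) x -
      ((deriv (w t) x + (starRingEnd ℂ) (deriv (w t) x)) * g t x +
        (w t x + (starRingEnd ℂ) (w t x)) * deriv (g t) x) + deriv β₂ x := fun x =>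
    deriv_eq_of_forall_eq hLx' (rh.hasDerivAt x)
      ((((rg.deriv.hasDerivAt x).const_mul (-Complex.I)).sub ((hud x).mul (rg.hasDerivAt x))).add
        (hL'.rem.hasDerivAt x))
  have W1 : ∀ x, (starRingEnd ℂ) (w' x) = Complex.I * (starRingEnd ℂ) (deriv (deriv (w t)) x) -
      (2 * (starRingEnd ℂ) (w t x) * (starRingEnd ℂ) (deriv (w t) x) +
        2 * (starRingEnd ℂ) (deriv r x)) := fun x => by
    rw [hw']
    simp only [map_sub, map_add, map_mul, map_neg, Complex.conj_I, map_ofNat, neg_neg]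
  have S1 : ∀ x, deriv (w t) x * (starRingEnd ℂ) (w t x) + w t x * (starRingEnd ℂ) (deriv (w t) x) =
      deriv r x + (starRingEnd ℂ) (deriv r x) := fun x =>
    deriv_eq_of_forall_eq hs ((rw'.hasDerivAt x).mul (RatMinus.hasDerivAt_conj (rw'.hasDerivAt x)))
      ((hr.hasDerivAt x).add (RatMinus.hasDerivAt_conj (hr.hasDerivAt x)))
  have T1 : ∀ x, HasDerivAt (fun x => f' x + -Complex.I * deriv (deriv (f t)) x +
      -2 * (deriv (w t) x * f t x) + -2 * deriv (g t) x) (deriv f' x +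
      -Complex.I * deriv (deriv (deriv (f t))) x + -2 * (deriv (deriv (w t)) x * f t x +
        deriv (w t) x * deriv (f t) x) + -2 * deriv (deriv (g t)) x) x := fun x =>
    (((hf.ratPlus.hasDerivAt x).add ((rf.deriv.deriv.hasDerivAt x).const_mul _)).add
      (((rw'.deriv.hasDerivAt x).mul (rf.hasDerivAt x)).const_mul _)).add
      ((rg.deriv.hasDerivAt x).const_mul _)
  have hT : LaxRel (u t) (fun x => f' x + -Complex.I * deriv (deriv (f t)) x +
      -2 * (deriv (w t) x * f t x) + -2 * deriv (g t) x)
      (fun x => g' x + -Complex.I * deriv (deriv (g t)) x +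
      -2 * (deriv (w t) x * g t x) + -2 * deriv h x)
      (fun x => β' x + -Complex.I * deriv (deriv (β t)) x + -2 * deriv β₂ x +
        2 * ((starRingEnd ℂ) (deriv (w t) x) * β t x)) := by
    refine ⟨((hf.ratPlus.add (rf.deriv.deriv.smul _)).add ((rw'.deriv.mul rf).smul _)).add
      (rg.deriv.smul _), ((hg.ratPlus.add (rg.deriv.deriv.smul _)).add ((rw'.deriv.mul rg).smul _)).add
      (rh.deriv.smul _), ((hβ.add (rβ.deriv.deriv.smul _)).add (hL'.rem.deriv.smul _)).add
      (((RatMinus.of_conj rw'.deriv).mul rβ).smul _), fun x => ?_⟩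
    rw [(T1 x).deriv, hu]
    linear_combination Lt x - 2 * H1 x - Complex.I * G2 x +
      2 * (starRingEnd ℂ) (deriv (w t) x) * hLx t x - f t x * hw' x - f t x * W1 x - 2 * f t x * S1 x
  refine (hT.eq_zero_of_pencil (hw t) (t - s) x₀ (c := c') fun x => ?_).2
  linear_combination Et x - Complex.I * E2 x - 2 * deriv (w t) x * he t x - 2 * D1 x + hw' x

/-- The constant `c` of the pencil equation does not depend on `t`. At `t = s` the equation is
`(x - x₀) f - c = Π u(s)` and its value at `x₀` is `-c = Π u(s)(x₀)`; at `t = 0` the constant is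
expressed by the matrix of the pencil of `u(0)`. -/
theorem IsSolitonSolution.eq_matPair {N : ℕ} {u : ℝ → ℝ → ℝ} (h : IsSolitonSolution N u) (s x₀ : ℝ) :
    logDerivFn (charPoly N (u s)) x₀ = -Complex.I * matPair (matM N (u 0) -
      Matrix.scalar (Fin N) (x₀ : ℂ) + Matrix.diagonal fun j => 2 * ((-s : ℝ) : ℂ) * eigval N (u 0) j)
      (vecX N (u 0)) (vecY N (u 0)) := by
  obtain ⟨f, g, β, c, hfam, hd⟩ := h.exists_pencil_family s x₀
  have hQ := fun s => isSolitonPoly_charPoly (h.1 s)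
  have hc : ∀ t, HasDerivAt c 0 t := by
    intro t
    obtain ⟨f', g', β', c', hf, hg, hβ, hβt, hc⟩ := hd t
    obtain ⟨r, hr, hs, hsq⟩ := (hQ t).isRealPartOf.exists_sq
    obtain ⟨Q', -, -, hw⟩ := h.hasTimeDeriv hr hsq
    have h0 := deriv_const_eq_zero (fun t => (hQ t).isRealPartOf) hr hs hw.eval (fun x => rfl)
      (fun t => (hfam t).2.1) (hfam t).2.2.1 (fun t => (hfam t).2.2.2) hf hg hβ hβt hc
    rwa [h0] at hc
  have h1 : c s = c 0 :=
    is_const_of_deriv_eq_zero (fun t => (hc t).differentiableAt) (fun t => (hc t).deriv) s 0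
  have h2 := (hfam s).2.2.2 x₀
  have h3 := const_eq_matPair (h.1 0) x₀ (-s) (hfam 0).1 (hfam 0).2.1 (hfam 0).2.2.1 fun x => by
    have := (hfam 0).2.2.2 x
    rwa [zero_sub] at this
  rw [neg_mul, ← h3, ← h1, ← h2]
  push_cast
  ring

theorem pencil_eq_matV (N : ℕ) (u : ℝ → ℝ) (t x : ℝ) :
    matM N u - (Matrix.scalar (Fin N) (x : ℂ) + ((t / Real.pi : ℝ) : ℂ) • matV N u) =
      matM N u - Matrix.scalar (Fin N) (x : ℂ) +
        Matrix.diagonal fun j => 2 * ((-t : ℝ) : ℂ) * eigval N u j := by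
  have h1 : ((t / Real.pi : ℝ) : ℂ) • matV N u =
      -Matrix.diagonal fun j => 2 * ((-t : ℝ) : ℂ) * eigval N u j := by
    rw [matV, ← Matrix.diagonal_smul, Matrix.diagonal_neg]
    congr 1
    funext j
    have hpi : (Real.pi : ℂ) ≠ 0 := by exact_mod_cast Real.pi_ne_zero
    simp only [Pi.smul_apply, smul_eq_mul, action]
    push_cast
    field_simp
  rw [h1]
  abel

theorem IsSolitonSolution.explicit_formula {N : ℕ} {u : ℝ → ℝ → ℝ} (h : IsSolitonSolution N u)
    (t x : ℝ) : IsUnit (matM N (u 0) -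
        (Matrix.scalar (Fin N) (x : ℂ) + ((t / Real.pi : ℝ) : ℂ) • matV N (u 0))) ∧
      u t x = 2 * (matPair (matM N (u 0) -
        (Matrix.scalar (Fin N) (x : ℂ) + ((t / Real.pi : ℝ) : ℂ) • matV N (u 0)))
          (vecX N (u 0)) (vecY N (u 0))).im := by
  rw [pencil_eq_matV]
  refine ⟨isUnit_pencil (h.1 0) x (-t), ?_⟩
  rw [(isSolitonPoly_charPoly (h.1 t)).isRealPartOf.eq_re, h.eq_matPair t x]
  simp

end BenjaminOno

end

open BenjaminOno in
theorem mainTheorem10 (N : ℕ) (hN : 0 < N) :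
    (∀ u ∈ solitons N,
      (∃! Q : Polynomial ℂ, IsCharPoly N u Q) ∧
      (∃! p : (Fin N → ℝ) × (Fin N → hardy), IsSpectralData N u p) ∧
      MemLp (oneSubInner N u) 2 volume ∧
      (∀ f ∈ purePoint (cls u), f ∈ genG.domain ∧ genGApply f ∈ purePoint (cls u)) ∧
      (∀ f ∈ purePoint (cls u),
        IsHardyExtension (f : L2) (hardyEval (f : L2)) ∧
        ∀ z : ℂ, 0 < z.im →
          (∃! g : hardy, IsResolvent z f g) ∧
          ∀ g : hardy, IsResolvent z f g →
            g ∈ purePoint (cls u) ∧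
            hardyEval (f : L2) z =
              1 / (2 * Real.pi * Complex.I) * pairing (g : L2) (oneSubInner N u)) ∧
      (∀ k j : Fin N, matM N u k j =
        if j = k then (angle N u j : ℂ) - Complex.I / (2 * |eigval N u j| : ℝ)
        else Complex.I / (eigval N u k - eigval N u j : ℝ) *
          (Real.sqrt (|eigval N u k| / |eigval N u j|) : ℂ)) ∧
      (∀ x : ℝ,
        IsUnit (matM N u - Matrix.scalar (Fin N) (x : ℂ)) ∧
        (∃! g : hardy, IsResolvent x (szegoHardy (cls u)) g) ∧
        ∀ g : hardy, IsResolvent x (szegoHardy (cls u)) g →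
          g ∈ purePoint (cls u) ∧
          1 / (2 * Real.pi * Complex.I) * pairing (g : L2) (oneSubInner N u) =
            -Complex.I * matPair (matM N u - Matrix.scalar (Fin N) (x : ℂ))
              (vecX N u) (vecY N u)) ∧
      Continuous (fun x : ℝ => -Complex.I *
        matPair (matM N u - Matrix.scalar (Fin N) (x : ℂ)) (vecX N u) (vecY N u)) ∧
      (szego (cls u) =ᵐ[volume] fun x : ℝ => -Complex.I *
        matPair (matM N u - Matrix.scalar (Fin N) (x : ℂ)) (vecX N u) (vecY N u))) ∧
    (Set.MapsTo (actionAngle N) (solitons N) (actionSet N ×ˢ Set.univ) ∧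
      Set.InjOn (actionAngle N) (solitons N)) ∧
    (∀ u : ℝ → ℝ → ℝ, IsSolitonSolution N u → ∀ t x : ℝ,
      IsUnit (matM N (u 0) -
        (Matrix.scalar (Fin N) (x : ℂ) + ((t / Real.pi : ℝ) : ℂ) • matV N (u 0))) ∧
      u t x = 2 * (matPair (matM N (u 0) -
        (Matrix.scalar (Fin N) (x : ℂ) + ((t / Real.pi : ℝ) : ℂ) • matV N (u 0)))
          (vecX N (u 0)) (vecY N (u 0))).im) := by
  refine ⟨fun u hu => ⟨existsUnique_isCharPoly hu, ⟨_, isSpectralData_spectralData hu,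
    fun p hp => hp.unique (isSpectralData_spectralData hu)⟩, memLp_oneSubInner hu,
    fun f hf => genG_purePoint hu hf, fun f hf => hardy_formula hu hf, matM_apply hu,
    fun x => ⟨isUnit_matM_sub hu x, exists_isResolvent_szego hu x, fun g hg => ?_⟩, ?_, ?_⟩,
    ⟨actionAngle_mapsTo N, actionAngle_injOn N⟩, fun u hu t x => hu.explicit_formula t x⟩
  · obtain ⟨h1, h2, h3⟩ := resolvent_szego hu x hg
    exact ⟨h1, h2.trans h3⟩
  · rw [← funext (logDerivFn_charPoly hu)]
    exact (isSolitonPoly_charPoly hu).lower.ratPlus_logDerivFn.continuous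
  · rw [← funext (logDerivFn_charPoly hu)]
    exact (isSolitonPoly_charPoly hu).isCharPoly.2.2.2
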